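/- Let $d\ge 2$, let $g$ be the fundamental solution of $-\Delta$ on $\mathbb R^d$ ($g(x)=-\frac1{2\pi}\log|x|$ for $d=2$, $g(x)=\frac{1}{d(d-2)\nu_d}|x|^{2-d}$ for $d\ge3$, where $\nu_d=\frac{2\pi^{d/2}}{d\,\Gamma(d/2)}$ is the volume of the unit ball), and let $K$ be the $d\times d$ matrix-valued quasi-static Maxwell kernel $$K(x)=-D^2g(x)=-\frac1{\nu_d}\Bigl(xx^\top-\frac1d\,|x|^2\,\mathrm{Id}_d\Bigr)|x|^{-d-2}\qquad(x\ne0).$$ Let $Q=[-\pi,\pi]^d$ and let $F(\tau)=\sum_{m\in\mathbb Z^d,\,m\ne0}K(m)e^{im\cdot\tau}$ be the symbol; the series converges in $L^2(Q)$, its sum has a representative that is continuous on $Q\setminus\{0\}$, and $F$ denotes that representative. Let $T$ be the operator on $\ell^2(\mathbb Z^d;\mathbb C^d)$ with block matrix $t_{mn}=K(m-n)$ for $m\ne n$ and $t_{mm}=0$; it is well defined and bounded. For a non-empty bounded open set $\Omega\subset\mathbb R^d$, an integer $N\ge1$ and a grid origin $a^N\in\mathbb R^d$, let $x^N_m=a^N+\frac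 mN$ ($m\in\mathbb Z^d$), $\omega^N=\{m\in\mathbb Z^d: x^N_m\in\Omega\}$, and let $T^N$ be the operator on $\ell^2(\omega^N;\mathbb C^d)$ whose block at $(m,n)$ is $N^{-d}K(x^N_m-x^N_n)$ for $m\neq n$ and $0$ for $m=n$, so that $(\lambda\,\mathrm{Id}-T^N)U=f$ is the discrete dipole (delta-delta) scheme. Write $\mathrm{Sp}$ for the spectrum and $W(A)=\{(u,Au):\|u\|=1\}$ for the numerical range. The scheme is called stable for $\lambda\in\mathbb C$ if, for all sufficiently large $N$, $\lambda\,\mathrm{Id}-T^N$ is invertible with $\|(\lambda\,\mathrm{Id}-T^N)^{-1}\|$ bounded independently of $N$. Then there are real numbers $\Lambda_-^{(d)}\le-\frac1d$ and $\Lambda_+^{(d)}\ge1-\frac1d$, depending only on $d$, such that, with $\mathcal C=[\Lambda_-^{(d)},\Lambda_+^{(d)}]\subset\mathbb C$, the following holds. (i) For every $\tau\in Q\setminus\{0\}$, $F(\tau)$ is a real symmetric matrix with all its eigenvalues in $\mathcal C$, and $$\Lambda_-^{(d)}=\inf_{\tau\in Q\setminus\{0\}}\min\mathrm{Sp}(F(\tau)),\qquad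 \Lambda_+^{(d)}=\sup_{\tau\in Q\setminus\{0\}}\max\mathrm{Sp}(F(\tau)).$$ (ii) $\overline{W(T)}=\mathcal C$. For every $\Omega$ and every choice of origins $(a^N)_{N\ge1}$, $W(T^N)\subset W(T)$ for all $N\ge1$, and $$\Lambda_-^{(d)}=\inf_{N}\min\mathrm{Sp}(T^N),\qquad \Lambda_+^{(d)}=\sup_{N}\max\mathrm{Sp}(T^N),$$ where $N$ runs over the positive integers with $\omega^N\neq\emptyset$. (iii) For every $\Omega$, every choice of origins and every $\lambda\in\mathbb C$, the scheme is stable if and only if $\lambda\notin\mathcal C$; and for $\lambda\notin\mathcal C$ and every $N\ge1$, $\lambda\,\mathrm{Id}-T^N$ is invertible and $$\|(\lambda\,\mathrm{Id}-T^N)^{-1}\|\le\mathrm{dist}(\lambda,\mathcal C)^{-1}.$$ -/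

import Mathlib

noncomputable section

namespace QuasiStaticMaxwell

open Filter Topology MeasureTheory

/-- The volume `ν_d` of the unit ball in `ℝ^d`. -/
def unitBallVolume (d : ℕ) : ℝ :=
  2 * Real.pi ^ ((d : ℝ) / 2) / ((d : ℝ) * Real.Gamma ((d : ℝ) / 2))

/-- The free-space Green function `g` of `-Δ` on `ℝ^d`, `d ≥ 2`
(so that `-Δ g = δ₀`, that is, `ĝ(ξ) = |ξ|⁻²`). -/
def greenFunction (d : ℕ) (x : EuclideanSpace ℝ (Fin d)) : ℝ :=
  if d = 2 then -(1 / (2 * Real.pi)) * Real.log ‖x‖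
  else 1 / ((d : ℝ) * ((d : ℝ) - 2) * unitBallVolume d) * ‖x‖ ^ (2 - (d : ℝ))

/-- The kernel `K = -D²g`, i.e. `K(x)_{ij} = -∂_i ∂_j g(x)`; it is only used for `x ≠ 0`. -/
def kernel (d : ℕ) (x : EuclideanSpace ℝ (Fin d)) : Matrix (Fin d) (Fin d) ℝ :=
  Matrix.of fun i j =>
    -(fderiv ℝ (fun y => fderiv ℝ (greenFunction d) y (EuclideanSpace.single j (1 : ℝ))) x
        (EuclideanSpace.single i (1 : ℝ)))

/-- The explicit first derivatives `∂_j g(x) = -x_j / (d ν_d |x|^d)`. -/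
theorem fderiv_greenFunction {d : ℕ} (hd : 2 ≤ d) {x : EuclideanSpace ℝ (Fin d)} (hx : x ≠ 0)
    (j : Fin d) :
    fderiv ℝ (greenFunction d) x (EuclideanSpace.single j (1 : ℝ)) =
      -(1 / ((d : ℝ) * unitBallVolume d)) * (x j * ‖x‖ ^ (-(d : ℝ))) := by
  have hx0 : 0 < ‖x‖ := norm_pos_iff.mpr hx
  have hsq : HasFDerivAt (fun y : EuclideanSpace ℝ (Fin d) => ‖y‖ ^ 2) (2 • innerSL ℝ x) x :=
    (hasStrictFDerivAt_norm_sq x).hasFDerivAt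
  have hin : inner ℝ x (EuclideanSpace.single j (1 : ℝ)) = x j := by
    simp [EuclideanSpace.inner_single_right]
  by_cases h2 : d = 2
  · subst h2
    have hg : greenFunction 2 = fun y => -(1 / (4 * Real.pi)) * Real.log (‖y‖ ^ 2) := by
      funext y
      simp only [greenFunction, if_true, Real.log_pow]
      push_cast
      ring
    have hD := (hsq.log (by positivity)).const_mul (-(1 / (4 * Real.pi)))
    rw [hg, hD.fderiv]
    have hpi := Real.pi_pos.ne'
    simp only [_root_.smul_apply, innerSL_apply_apply, hin, unitBallVolume]
    have : ‖x‖ ^ (-((2 : ℕ) : ℝ)) = (‖x‖ ^ 2)⁻¹ := by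
      rw [Real.rpow_neg hx0.le, Real.rpow_natCast]
    rw [this]
    simp
    field_simp
    norm_num
  · have hd3 : (2 : ℝ) < d := by
      have : 2 < d := lt_of_le_of_ne hd (Ne.symm h2)
      exact_mod_cast this
    have hν : 0 < unitBallVolume d := by
      have : 0 < Real.Gamma ((d : ℝ) / 2) := Real.Gamma_pos_of_pos (by linarith)
      have hdp : (0 : ℝ) < d := by linarith
      unfold unitBallVolume
      positivity
    have hg : greenFunction d = fun y =>
        1 / ((d : ℝ) * ((d : ℝ) - 2) * unitBallVolume d) * (‖y‖ ^ 2) ^ ((2 - (d : ℝ)) / 2) := by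
      funext y
      simp only [greenFunction, h2, if_false]
      rw [← Real.rpow_natCast, ← Real.rpow_mul (norm_nonneg _)]
      congr 2
      push_cast
      ring
    have hD := (hsq.rpow_const (p := (2 - (d : ℝ)) / 2) (Or.inl (by positivity))).const_mul
      (1 / ((d : ℝ) * ((d : ℝ) - 2) * unitBallVolume d))
    rw [hg, hD.fderiv]
    have : (‖x‖ ^ 2) ^ ((2 - (d : ℝ)) / 2 - 1) = ‖x‖ ^ (-(d : ℝ)) := by
      rw [← Real.rpow_natCast, ← Real.rpow_mul (norm_nonneg _)]
      congr 1
      push_cast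
      ring
    have hd2 : (d : ℝ) - 2 ≠ 0 := by linarith
    have hd0 : (d : ℝ) ≠ 0 := by linarith
    simp only [_root_.smul_apply, innerSL_apply_apply, hin, this, smul_eq_mul,
      nsmul_eq_mul]
    push_cast
    field_simp
    ring

/-- The explicit form `K(x) = -ν_d⁻¹ (x xᵀ - d⁻¹ |x|² I) |x|^{-d-2}` of the kernel. -/
theorem kernel_apply {d : ℕ} (hd : 2 ≤ d) {x : EuclideanSpace ℝ (Fin d)} (hx : x ≠ 0)
    (i j : Fin d) :
    kernel d x i j =
      -(1 / unitBallVolume d) * (x i * x j - 1 / (d : ℝ) * (if i = j then 1 else 0) * ‖x‖ ^ 2)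
        / ‖x‖ ^ (d + 2) := by
  have hx0 : 0 < ‖x‖ := norm_pos_iff.mpr hx
  have hsq : HasFDerivAt (fun y : EuclideanSpace ℝ (Fin d) => ‖y‖ ^ 2) (2 • innerSL ℝ x) x :=
    (hasStrictFDerivAt_norm_sq x).hasFDerivAt
  have hin : inner ℝ x (EuclideanSpace.single i (1 : ℝ)) = x i := by
    simp [EuclideanSpace.inner_single_right]
  have hd0 : (0 : ℝ) < d := by
    have : 0 < d := by omega
    exact_mod_cast this
  have hν : 0 < unitBallVolume d := by
    have : 0 < Real.Gamma ((d : ℝ) / 2) := Real.Gamma_pos_of_pos (by linarith)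
    unfold unitBallVolume
    positivity
  have hev : (fun y => fderiv ℝ (greenFunction d) y (EuclideanSpace.single j (1 : ℝ))) =ᶠ[𝓝 x]
      fun y => -(1 / ((d : ℝ) * unitBallVolume d)) * (y j * (‖y‖ ^ 2) ^ (-(d : ℝ) / 2)) := by
    filter_upwards [isOpen_ne.mem_nhds hx] with y hy
    rw [fderiv_greenFunction hd hy j, ← Real.rpow_natCast, ← Real.rpow_mul (norm_nonneg _)]
    congr 3
    push_cast
    ring
  have hj : HasFDerivAt (fun y : EuclideanSpace ℝ (Fin d) => y j)
      (EuclideanSpace.proj j : EuclideanSpace ℝ (Fin d) →L[ℝ] ℝ) x :=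
    (EuclideanSpace.proj j : EuclideanSpace ℝ (Fin d) →L[ℝ] ℝ).hasFDerivAt
  have hD : HasFDerivAt (fun y : EuclideanSpace ℝ (Fin d) =>
      -(1 / ((d : ℝ) * unitBallVolume d)) * (y j * (‖y‖ ^ 2) ^ (-(d : ℝ) / 2))) _ x :=
    ((hj.mul (hsq.rpow_const (p := -(d : ℝ) / 2) (Or.inl (by positivity)))).const_mul
      (-(1 / ((d : ℝ) * unitBallVolume d))))
  have h1 : (‖x‖ ^ 2) ^ (-(d : ℝ) / 2 - 1) = (‖x‖ ^ (d + 2))⁻¹ := by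
    rw [← Real.rpow_natCast, ← Real.rpow_mul (norm_nonneg _), ← Real.rpow_natCast,
      ← Real.rpow_neg (norm_nonneg _)]
    congr 1
    push_cast
    ring
  have h2 : (‖x‖ ^ 2) ^ (-(d : ℝ) / 2) = ‖x‖ ^ 2 * (‖x‖ ^ (d + 2))⁻¹ := by
    rw [← h1, Real.rpow_sub_one (by positivity)]
    field_simp
  have hs : (EuclideanSpace.proj j : EuclideanSpace ℝ (Fin d) →L[ℝ] ℝ)
      (EuclideanSpace.single i (1 : ℝ)) = if i = j then 1 else 0 := by
    simp [eq_comm]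
  simp only [kernel, Matrix.of_apply]
  rw [hev.fderiv_eq, hD.fderiv]
  simp only [_root_.smul_apply, _root_.add_apply, innerSL_apply_apply,
    hin, h1, h2, smul_eq_mul, nsmul_eq_mul, hs]
  push_cast
  field_simp
  ring

/-- A lattice point `m ∈ ℤ^d`, as a point of `ℝ^d`. -/
def latticePoint {d : ℕ} (m : Fin d → ℤ) : EuclideanSpace ℝ (Fin d) :=
  WithLp.toLp 2 fun i => (m i : ℝ)

/-! ### The infinite block Toeplitz matrix and its symbol -/

/-- The block `t_{mn} ∈ ℂ^{d×d}` of the infinite Toeplitz matrix: `K(m-n)` for `m ≠ n`, and `0`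
for `m = n`. -/
def toeplitzBlock (d : ℕ) (m n : Fin d → ℤ) : Matrix (Fin d) (Fin d) ℂ :=
  if m = n then 0 else (kernel d (latticePoint (m - n))).map Complex.ofReal

/-- `ℓ²(ℤ^d; ℂ^d)`. -/
abbrev LatticeL2 (d : ℕ) : Type :=
  lp (fun _ : Fin d → ℤ => EuclideanSpace ℂ (Fin d)) 2

/-- `T` is the bounded operator on `ℓ²(ℤ^d; ℂ^d)` with the block matrix `(t_{mn})`:
`(T u)_m = ∑_n t_{mn} u_n`. There is at most one such `T`. -/
def IsToeplitzOperator (d : ℕ) (T : LatticeL2 d →L[ℂ] LatticeL2 d) : Prop :=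
  ∀ (u : LatticeL2 d) (m : Fin d → ℤ),
    HasSum (fun n => Matrix.toEuclideanLin (toeplitzBlock d m n) (u n)) ((T u) m)

/-- The period cube `Q = [-π, π]^d`. -/
def periodCube (d : ℕ) : Set (Fin d → ℝ) :=
  Set.Icc (fun _ => -Real.pi) (fun _ => Real.pi)

/-- The sum `∑_{m ∈ s, m ≠ 0} K(m) e^{i m·τ}` over a finite set `s` of lattice points. -/
def symbolPartialSum (d : ℕ) (s : Finset (Fin d → ℤ)) (τ : Fin d → ℝ) :
    Matrix (Fin d) (Fin d) ℂ :=
  ∑ m ∈ s, Complex.exp (Complex.I * ((∑ k, (m k : ℝ) * τ k : ℝ) : ℂ)) • toeplitzBlock d m 0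

/-- `F` is the symbol `F(τ) = ∑_{m ≠ 0} K(m) e^{i m·τ}`. The Fourier series does not converge
absolutely; it converges (unconditionally, entry by entry) in `L²(Q)`, and `F` is the representative
of its sum that is continuous on `Q \ {0}`. This determines `F` on `Q \ {0}`. -/
def IsSymbol (d : ℕ) (F : (Fin d → ℝ) → Matrix (Fin d) (Fin d) ℂ) : Prop :=
  ContinuousOn F (periodCube d \ {0}) ∧
    ∀ i j, Tendsto
      (fun s : Finset (Fin d → ℤ) =>
        eLpNorm (fun τ => symbolPartialSum d s τ i j - F τ i j) 2
          (volume.restrict (periodCube d)))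
      atTop (𝓝 0)

/-! ### Numerical range and spectrum -/

/-- The numerical range `W(A) = {(u, A u) | ‖u‖ = 1}`. -/
def numericalRange {H : Type*} [NormedAddCommGroup H] [InnerProductSpace ℂ H]
    (A : H →L[ℂ] H) : Set ℂ :=
  {z | ∃ u : H, ‖u‖ = 1 ∧ z = inner ℂ u (A u)}

/-- The real points of the spectrum (which is all of the spectrum for the self-adjoint operators and
Hermitian matrices at hand). -/
def realSpectrum {R : Type*} [Ring R] [Algebra ℂ R] (A : R) : Set ℝ :=
  {x | (x : ℂ) ∈ spectrum ℂ A}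

/-! ### The delta-delta discretization -/

/-- The grid point `x_m^N = a + m/N`. -/
def gridPoint {d : ℕ} (a : EuclideanSpace ℝ (Fin d)) (N : ℕ+) (m : Fin d → ℤ) :
    EuclideanSpace ℝ (Fin d) :=
  a + (1 / (N : ℝ)) • latticePoint m

theorem finite_gridPoint_mem {d : ℕ} {Ω : Set (EuclideanSpace ℝ (Fin d))}
    (hΩ : Bornology.IsBounded Ω) (a : EuclideanSpace ℝ (Fin d)) (N : ℕ+) :
    {m : Fin d → ℤ | gridPoint a N m ∈ Ω}.Finite := by
  obtain ⟨R, hR⟩ := hΩ.exists_norm_le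
  have hN : (0 : ℝ) < (N : ℝ) := by exact_mod_cast N.pos
  refine (Set.finite_Icc (fun i => -⌈(N : ℝ) * (R + |a i|)⌉)
    (fun i => ⌈(N : ℝ) * (R + |a i|)⌉)).subset ?_
  intro m hm
  have key : ∀ i, |(m i : ℝ)| ≤ ⌈(N : ℝ) * (R + |a i|)⌉ := by
    intro i
    have h1 : |gridPoint a N m i| ≤ R :=
      (PiLp.norm_apply_le (gridPoint a N m) i).trans (hR _ hm)
    have h2 : gridPoint a N m i = a i + 1 / (N : ℝ) * (m i : ℝ) := by
      simp [gridPoint, latticePoint]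
    have h3 : (m i : ℝ) = (N : ℝ) * (gridPoint a N m i - a i) := by
      rw [h2]
      field_simp
      ring
    refine le_trans ?_ (Int.le_ceil _)
    rw [h3, abs_mul, abs_of_pos hN]
    gcongr
    exact (abs_sub _ _).trans (by linarith)
  refine ⟨fun i => ?_, fun i => ?_⟩
  · have := (abs_le.mp (key i)).1
    exact_mod_cast this
  · have := (abs_le.mp (key i)).2
    exact_mod_cast this

/-- The finite index set `ω^N = {m ∈ ℤ^d | x_m^N ∈ Ω}`. -/
def gridIndex {d : ℕ} {Ω : Set (EuclideanSpace ℝ (Fin d))} (hΩ : Bornology.IsBounded Ω)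
    (a : EuclideanSpace ℝ (Fin d)) (N : ℕ+) : Finset (Fin d → ℤ) :=
  (finite_gridPoint_mem hΩ a N).toFinset

/-- The system matrix `T^N`, of size `d|ω^N| × d|ω^N|`: the block at `(m, n)` is
`N^{-d} K(x_m^N - x_n^N)` for `m ≠ n`, and `0` for `m = n`. -/
def systemMatrix {d : ℕ} {Ω : Set (EuclideanSpace ℝ (Fin d))} (hΩ : Bornology.IsBounded Ω)
    (a : EuclideanSpace ℝ (Fin d)) (N : ℕ+) :
    Matrix (gridIndex hΩ a N × Fin d) (gridIndex hΩ a N × Fin d) ℂ :=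
  Matrix.of fun p q =>
    if p.1 = q.1 then 0
    else (((N : ℝ) ^ d)⁻¹ * kernel d (gridPoint a N p.1 - gridPoint a N q.1) p.2 q.2 : ℝ)

/-- The operator `T^N` on `ℓ²(ω^N; ℂ^d)`. -/
def systemOperator {d : ℕ} {Ω : Set (EuclideanSpace ℝ (Fin d))} (hΩ : Bornology.IsBounded Ω)
    (a : EuclideanSpace ℝ (Fin d)) (N : ℕ+) :
    EuclideanSpace ℂ (gridIndex hΩ a N × Fin d) →L[ℂ]
      EuclideanSpace ℂ (gridIndex hΩ a N × Fin d) :=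
  Matrix.toEuclideanCLM (𝕜 := ℂ) (systemMatrix hΩ a N)

/-- Stability of the scheme `(λ - T^N) U = F` on `Ω`, with grid origins `a^N`: the inverses
`(λ - T^N)⁻¹` exist and are bounded uniformly in `N`, for all large `N`. -/
def IsStable {d : ℕ} {Ω : Set (EuclideanSpace ℝ (Fin d))} (hΩ : Bornology.IsBounded Ω)
    (a : ℕ+ → EuclideanSpace ℝ (Fin d)) (lam : ℂ) : Prop :=
  ∃ M : ℝ, ∀ᶠ N : ℕ+ in atTop,
    lam ∈ resolventSet ℂ (systemOperator hΩ (a N) N) ∧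
      ‖resolvent (systemOperator hΩ (a N) N) lam‖ ≤ M

end QuasiStaticMaxwell

end

noncomputable section

namespace QuasiStaticMaxwell

open Filter Topology MeasureTheory

/-! Ewald's splitting makes the symbol explicit. The kernel is an integral of Gaussian expressions
over a parameter `u ∈ (0, ∞)`. The part `u > 1` has Gaussian decay at the nonzero lattice points, so
its Fourier series converges absolutely. The part `u ≤ 1` is, up to the factor `(2π)^d`, the Fourier
transform of `ξξᵀ/|ξ|² · e^{-|ξ|²/4}`, so its Fourier series is the periodization of this profile
over `2πℤ^d`. The result, `realSymbol`, is the profile itself, discontinuous only at `0`, plus a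
function continuous on all of `Q`. Its Fourier coefficients are the blocks `K(m)`
(`integral_conj_mul_realSymbol`), and so the Toeplitz operator is unitarily equivalent to
multiplication by the symbol on `L²(Q; ℂ^d)`; bounds for the eigenvalues of the symbol become bounds
for the quadratic form of `T` (`inner_toeplitzOperator_mem`).

Two features of the symbol matter. Near `0` the singular term and the trace-free property produce
the limits `1 - 1/d` and `-1/d` on the diagonal (`symbolRegular_zero`), hence the bounds on `Λ₊` and
`Λ₋`. At the corner `(π, …, π)` the symbol vanishes by symmetry (`realSymbol_cubeCorner`); following
the extreme eigenvalue along a segment from any point to the corner, the intermediate value theorem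
shows that the eigenvalues fill `(Λ₋, Λ₊)` (`exists_eigenvector_symbolOperator`). Consequently every
point of `𝒞` is an approximate eigenvalue of `T`, with finitely supported approximate eigenvectors
(`exists_finite_approx_eigenvector`).

Since `K` is homogeneous of degree `-d`, the factor `N^{-d}` cancels the grid scale and `T^N` is a
finite section of `T` (`systemMatrix_apply`). Its numerical range therefore lies in that of `T`,
which gives the resolvent bound off `𝒞`. Conversely, a finitely supported approximate eigenvector of
`T` can be translated into the grid of the open set `Ω` once `N` is large, which gives instability
on `𝒞` and the sharpness of the extreme eigenvalues. -/

/-- The squared Euclidean norm on `ℝ^d`, realized as `Fin d → ℝ`. -/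
def normSq {d : ℕ} (x : Fin d → ℝ) : ℝ := ∑ i, x i ^ 2

theorem normSq_nonneg {d : ℕ} (x : Fin d → ℝ) : 0 ≤ normSq x :=
  Finset.sum_nonneg fun _ _ => sq_nonneg _

theorem sq_le_normSq {d : ℕ} (x : Fin d → ℝ) (i : Fin d) : x i ^ 2 ≤ normSq x :=
  Finset.single_le_sum (f := fun i => x i ^ 2) (fun _ _ => sq_nonneg _) (Finset.mem_univ i)

theorem normSq_pos {d : ℕ} {x : Fin d → ℝ} (hx : x ≠ 0) : 0 < normSq x := by
  obtain ⟨i, hi⟩ := Function.ne_iff.mp hx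
  exact lt_of_lt_of_le (by have : x i ≠ 0 := hi; positivity) (sq_le_normSq x i)

theorem abs_mul_le_normSq {d : ℕ} (x : Fin d → ℝ) (i j : Fin d) : |x i * x j| ≤ normSq x := by
  rw [abs_mul]
  nlinarith [sq_le_normSq x i, sq_le_normSq x j, sq_nonneg (|x i| - |x j|), sq_abs (x i),
    sq_abs (x j)]

theorem continuous_normSq {d : ℕ} : Continuous (normSq : (Fin d → ℝ) → ℝ) := by
  unfold normSq
  fun_prop

theorem normSq_neg {d : ℕ} (x : Fin d → ℝ) : normSq (-x) = normSq x := by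
  simp [normSq]

/-! ### Heat kernel representation of the kernel and its splitting at `u = 1`. -/

/-- The integrand of the heat kernel representation of `K`, in the variable `u = 1 / (4 t)`. -/
def kernelIntegrand {d : ℕ} (x : Fin d → ℝ) (i j : Fin d) (u : ℝ) : ℝ :=
  Real.pi ^ (-((d : ℝ) / 2)) *
    ((if i = j then 1 / 2 else 0) * (u ^ ((d : ℝ) / 2 - 1) * Real.exp (-(normSq x * u)))
      - x i * x j * (u ^ ((d : ℝ) / 2 + 1 - 1) * Real.exp (-(normSq x * u))))

/-- The Gamma integral has a positive value, whereas the integral of a non-integrable function is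
`0` by convention; integrability is read off from the value. -/
theorem integrableOn_rpow_mul_exp {a r : ℝ} (ha : 0 < a) (hr : 0 < r) :
    IntegrableOn (fun u : ℝ => u ^ (a - 1) * Real.exp (-(r * u))) (Set.Ioi 0) := by
  by_contra h
  have h1 := integral_undef h
  rw [Real.integral_rpow_mul_exp_neg_mul_Ioi ha hr] at h1
  have := Real.Gamma_pos_of_pos ha
  have : 0 < (1 / r) ^ a * Real.Gamma a := by positivity
  linarith

theorem integrableOn_kernelIntegrand {d : ℕ} (hd : 2 ≤ d) {x : Fin d → ℝ} (hx : x ≠ 0)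
    (i j : Fin d) : IntegrableOn (kernelIntegrand x i j) (Set.Ioi 0) := by
  have hd0 : (0 : ℝ) < d := by exact_mod_cast (by omega : 0 < d)
  have h1 := integrableOn_rpow_mul_exp (a := (d : ℝ) / 2) (by positivity) (normSq_pos hx)
  have h2 := integrableOn_rpow_mul_exp (a := (d : ℝ) / 2 + 1) (by positivity) (normSq_pos hx)
  exact ((h1.const_mul _).sub (h2.const_mul _)).const_mul _

theorem norm_toLp_eq {d : ℕ} (x : Fin d → ℝ) :
    ‖(WithLp.toLp 2 x : EuclideanSpace ℝ (Fin d))‖ = Real.sqrt (normSq x) := by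
  simp [EuclideanSpace.norm_eq, normSq]

/-- Both terms are Gamma integrals, related by `Γ(d/2 + 1) = (d/2) Γ(d/2)`. Representing the second
derivatives, and not `g` itself, covers `d = 2`, where the heat integral for `g` diverges. -/
theorem integral_kernelIntegrand {d : ℕ} (hd : 2 ≤ d) {x : Fin d → ℝ} (hx : x ≠ 0)
    (i j : Fin d) :
    ∫ u in Set.Ioi 0, kernelIntegrand x i j u = kernel d (WithLp.toLp 2 x) i j := by
  have hd0 : (0 : ℝ) < d := by exact_mod_cast (by omega : 0 < d)
  have hr := normSq_pos hx
  have h1 := integrableOn_rpow_mul_exp (a := (d : ℝ) / 2) (by positivity) hr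
  have h2 := integrableOn_rpow_mul_exp (a := (d : ℝ) / 2 + 1) (by positivity) hr
  have hx' : (WithLp.toLp 2 x : EuclideanSpace ℝ (Fin d)) ≠ 0 := by simpa using hx
  rw [kernel_apply hd hx', norm_toLp_eq]
  unfold kernelIntegrand
  rw [integral_const_mul, integral_sub (h1.const_mul _) (h2.const_mul _), integral_const_mul,
    integral_const_mul, Real.integral_rpow_mul_exp_neg_mul_Ioi (by positivity) hr,
    Real.integral_rpow_mul_exp_neg_mul_Ioi (by positivity) hr, Real.Gamma_add_one (by positivity)]
  have e1 : Real.sqrt (normSq x) ^ (d + 2) = normSq x ^ ((d : ℝ) / 2) * normSq x := by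
    rw [pow_add, Real.sq_sqrt hr.le, Real.sqrt_eq_rpow, ← Real.rpow_natCast,
      ← Real.rpow_mul hr.le]
    congr 2
    ring
  have e2 : (1 / normSq x) ^ ((d : ℝ) / 2) = (normSq x ^ ((d : ℝ) / 2))⁻¹ := by
    rw [one_div, Real.inv_rpow hr.le]
  have e3 : (1 / normSq x) ^ ((d : ℝ) / 2 + 1) = (normSq x ^ ((d : ℝ) / 2))⁻¹ * (normSq x)⁻¹ := by
    rw [Real.rpow_add_one (by positivity), e2, one_div]
  rw [e1, e2, e3, Real.sq_sqrt hr.le, unitBallVolume, Real.rpow_neg Real.pi_pos.le]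
  have := Real.Gamma_pos_of_pos (by positivity : 0 < (d : ℝ) / 2)
  have hp : 0 < Real.pi ^ ((d : ℝ) / 2) := by positivity
  have hq : 0 < normSq x ^ ((d : ℝ) / 2) := by positivity
  generalize Real.pi ^ ((d : ℝ) / 2) = P at *
  generalize normSq x ^ ((d : ℝ) / 2) = R at *
  simp only
  split_ifs <;> field_simp <;> ring

/-- The part of the kernel that decays like a Gaussian. -/
def kernelShort {d : ℕ} (x : Fin d → ℝ) (i j : Fin d) : ℝ :=
  ∫ u in Set.Ioi 1, kernelIntegrand x i j u

/-- The smooth part of the kernel. -/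
def kernelLong {d : ℕ} (x : Fin d → ℝ) (i j : Fin d) : ℝ :=
  ∫ u in Set.Ioc 0 1, kernelIntegrand x i j u

theorem kernelShort_add_kernelLong {d : ℕ} (hd : 2 ≤ d) {x : Fin d → ℝ} (hx : x ≠ 0)
    (i j : Fin d) :
    kernelShort x i j + kernelLong x i j = kernel d (WithLp.toLp 2 x) i j := by
  have h := integrableOn_kernelIntegrand hd hx i j
  rw [← integral_kernelIntegrand hd hx, ← Set.Ioc_union_Ioi_eq_Ioi zero_le_one,
    setIntegral_union (Set.Ioc_disjoint_Ioi le_rfl) measurableSet_Ioi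
      (h.mono_set Set.Ioc_subset_Ioi_self) (h.mono_set (Set.Ioi_subset_Ioi zero_le_one)),
    add_comm]
  rfl

theorem exists_abs_kernelShort_le {d : ℕ} (hd : 2 ≤ d) :
    ∃ C : ℝ, ∀ x : Fin d → ℝ, 1 ≤ normSq x → ∀ i j,
      |kernelShort x i j| ≤ C * Real.exp (-(normSq x / 4)) := by
  have hd0 : (0 : ℝ) < d := by exact_mod_cast (by omega : 0 < d)
  have h1 := (integrableOn_rpow_mul_exp (a := (d : ℝ) / 2) (r := 1 / 4) (by positivity)
    (by norm_num)).mono_set (Set.Ioi_subset_Ioi zero_le_one)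
  refine ⟨∫ u in Set.Ioi (1 : ℝ), Real.pi ^ (-((d : ℝ) / 2)) * 2 *
    (u ^ ((d : ℝ) / 2 - 1) * Real.exp (-(1 / 4 * u))), fun x hx i j => ?_⟩
  rw [← integral_mul_const, kernelShort, ← Real.norm_eq_abs]
  refine norm_integral_le_of_norm_le ((h1.const_mul _).mul_const _) ?_
  refine (ae_restrict_iff' measurableSet_Ioi).mpr (Eventually.of_forall fun u hu => ?_)
  have hu : 1 < u := hu
  have hu0 : 0 < u := by linarith
  set r := normSq x
  have e1 : u ^ ((d : ℝ) / 2 + 1 - 1) = u * u ^ ((d : ℝ) / 2 - 1) := by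
    rw [← Real.rpow_one_add' hu0.le (by linarith)]
    congr 1
    ring
  have e2 : kernelIntegrand x i j u = Real.pi ^ (-((d : ℝ) / 2)) * u ^ ((d : ℝ) / 2 - 1) *
      (((if i = j then 1 / 2 else 0) - x i * x j * u) * Real.exp (-(r * u))) := by
    rw [kernelIntegrand, e1]
    ring
  have e3 : |(if i = j then 1 / 2 else 0) - x i * x j * u| ≤ 1 + r * u := by
    refine (abs_sub _ _).trans (add_le_add ?_ ?_)
    · split_ifs <;> norm_num
    · rw [abs_mul, abs_of_pos hu0]
      gcongr
      exact abs_mul_le_normSq x i j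
  -- Half of the exponent `r u` absorbs the polynomial factor; the other half gives decay in `r` and
  -- in `u` separately, because `r ≥ 1` and `u > 1`.
  have e4 : 1 + r * u ≤ 2 * Real.exp (r * u / 2) := by
    nlinarith [Real.add_one_le_exp (r * u / 2)]
  have e5 : Real.exp (r * u / 2) * Real.exp (-(r * u)) ≤
      Real.exp (-(1 / 4 * u)) * Real.exp (-(r / 4)) := by
    rw [← Real.exp_add, ← Real.exp_add, Real.exp_le_exp]
    nlinarith [mul_nonneg (sub_nonneg.mpr hx) hu0.le, mul_nonneg (sub_nonneg.mpr hu.le)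
      (by linarith : 0 ≤ r)]
  have hP : 0 ≤ Real.pi ^ (-((d : ℝ) / 2)) * u ^ ((d : ℝ) / 2 - 1) := by positivity
  rw [e2, norm_mul, norm_mul (_ - _), Real.norm_of_nonneg hP, Real.norm_of_nonneg (Real.exp_pos _).le,
    Real.norm_eq_abs]
  calc _ ≤ Real.pi ^ (-((d : ℝ) / 2)) * u ^ ((d : ℝ) / 2 - 1) *
        (2 * Real.exp (r * u / 2) * Real.exp (-(r * u))) := by
        gcongr
        exact e3.trans e4
    _ = Real.pi ^ (-((d : ℝ) / 2)) * u ^ ((d : ℝ) / 2 - 1) * 2 *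
        (Real.exp (r * u / 2) * Real.exp (-(r * u))) := by ring
    _ ≤ _ := by
        refine (mul_le_mul_of_nonneg_left e5 (by positivity)).trans (le_of_eq ?_)
        ring

/-! ### Lattice sums and Fourier moments of Gaussians. -/

theorem summable_pi_prod {d : ℕ} {f : ℤ → ℝ} (hf : Summable f) (h0 : ∀ k, 0 ≤ f k) :
    Summable fun m : Fin d → ℤ => ∏ i, f (m i) := by
  induction d with
  | zero => exact Summable.of_finite
  | succ d ih =>
    rw [← (Fin.consEquiv fun _ : Fin (d + 1) => ℤ).summable_iff]
    have := hf.mul_of_nonneg ih h0 fun m => Finset.prod_nonneg fun i _ => h0 _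
    refine this.congr fun p => ?_
    simp [Fin.prod_univ_succ, Fin.consEquiv]

theorem summable_exp_neg_mul_sq {c : ℝ} (hc : 0 < c) {d : ℕ} :
    Summable fun m : Fin d → ℤ => Real.exp (-(c * normSq fun i => (m i : ℝ))) := by
  have h1 : Summable fun k : ℕ => Real.exp (-(c * (k : ℝ) ^ 2)) := by
    refine (Real.summable_exp_nat_mul_of_ge (neg_lt_zero.mpr hc) (f := fun k : ℕ => (k : ℝ) ^ 2)
      fun k => ?_).congr fun k => by rw [neg_mul]
    exact_mod_cast Nat.le_self_pow two_ne_zero k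
  have h2 : Summable fun k : ℤ => Real.exp (-(c * (k : ℝ) ^ 2)) :=
    Summable.of_nat_of_neg (by simpa using h1) (by simpa using h1)
  refine (summable_pi_prod (d := d) h2 fun _ => (Real.exp_pos _).le).congr fun m => ?_
  rw [← Real.exp_sum, normSq, Finset.mul_sum, Finset.sum_neg_distrib]

/-- A modulated one-dimensional Gaussian. -/
def gaussianWave (s y x : ℝ) : ℂ := Complex.exp (-(s : ℂ) * (x : ℂ) ^ 2 - Complex.I * y * x)

theorem norm_gaussianWave (s y x : ℝ) : ‖gaussianWave s y x‖ = Real.exp (-s * x ^ 2) := by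
  rw [gaussianWave, Complex.norm_exp]
  congr 1
  simp [← Complex.ofReal_pow]

theorem continuous_gaussianWave (s y : ℝ) : Continuous (gaussianWave s y) := by
  unfold gaussianWave
  fun_prop

theorem integrable_pow_mul_gaussianWave {s : ℝ} (hs : 0 < s) (y : ℝ) (n : ℕ) :
    Integrable fun x : ℝ => (x : ℂ) ^ n * gaussianWave s y x := by
  have h := (integrable_rpow_mul_exp_neg_mul_sq hs (s := n)
    (lt_of_lt_of_le (by norm_num) (Nat.cast_nonneg n))).norm
  refine h.mono' ?_ (Eventually.of_forall fun x => ?_)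
  · exact ((by fun_prop : Continuous fun x : ℝ => (x : ℂ) ^ n).mul
      (continuous_gaussianWave s y)).aestronglyMeasurable
  · rw [norm_mul, norm_mul, norm_gaussianWave, Real.rpow_natCast, norm_pow, Complex.norm_real,
      norm_pow, Real.norm_eq_abs (Real.exp _), Real.abs_exp]

theorem hasDerivAt_gaussianWave (s y x : ℝ) :
    HasDerivAt (gaussianWave s y)
      (gaussianWave s y x * (-2 * s * x - Complex.I * y)) x := by
  have h : HasDerivAt (fun z : ℂ => Complex.exp (-(s : ℂ) * z ^ 2 - Complex.I * y * z))
      (Complex.exp (-(s : ℂ) * (x : ℂ) ^ 2 - Complex.I * y * x) *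
        (-2 * s * x - Complex.I * y)) (x : ℂ) := by
    have h1 : HasDerivAt (fun z : ℂ => -(s : ℂ) * z ^ 2 - Complex.I * y * z)
        (-(s : ℂ) * (2 * (x : ℂ)) - Complex.I * y * 1) (x : ℂ) := by
      have := ((hasDerivAt_pow 2 (x : ℂ)).const_mul (-(s : ℂ))).sub
        ((hasDerivAt_id (x : ℂ)).const_mul (Complex.I * y))
      exact this.congr_deriv (by simp)
    refine h1.cexp.congr_deriv ?_
    ring
  exact h.comp_ofReal

theorem integral_gaussianWave {s : ℝ} (hs : 0 < s) (y : ℝ) :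
    ∫ x : ℝ, gaussianWave s y x =
      (((Real.pi / s) ^ (1 / 2 : ℝ) * Real.exp (-(y ^ 2 / (4 * s))) : ℝ) : ℂ) := by
  have h := integral_cexp_quadratic (b := -(s : ℂ)) (by simpa using hs) (-(Complex.I * y)) 0
  simp only [gaussianWave]
  convert h using 1
  · congr 1
    ext x
    congr 1
    ring
  · rw [neg_neg, Complex.ofReal_mul, Complex.ofReal_cpow (by positivity), Complex.ofReal_exp]
    congr 2
    · push_cast; rfl
    · push_cast; rfl
    · push_cast
      rw [neg_sq, mul_pow, Complex.I_sq]
      have : (s : ℂ) ≠ 0 := by exact_mod_cast hs.ne'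
      field_simp
      ring

/-- The derivative of the wave has integral zero, which expresses the first moment through the
zeroth. -/
theorem integral_mul_gaussianWave {s : ℝ} (hs : 0 < s) (y : ℝ) :
    ∫ x : ℝ, (x : ℂ) * gaussianWave s y x =
      -(Complex.I * y / (2 * s)) * ∫ x : ℝ, gaussianWave s y x := by
  have i0 := integrable_pow_mul_gaussianWave hs y 0
  have i1 := integrable_pow_mul_gaussianWave hs y 1
  simp only [pow_zero, one_mul, pow_one] at i0 i1
  have e : (fun x : ℝ => gaussianWave s y x * (-2 * s * x - Complex.I * y)) =
      fun x : ℝ => (-2 * s : ℂ) * ((x : ℂ) * gaussianWave s y x) -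
        Complex.I * y * gaussianWave s y x := by
    ext x; ring
  have h := integral_eq_zero_of_hasDerivAt_of_integrable (hasDerivAt_gaussianWave s y)
    (by rw [e]; exact (i1.const_mul _).sub (i0.const_mul _)) i0
  rw [e, integral_sub (i1.const_mul _) (i0.const_mul _), integral_const_mul,
    integral_const_mul] at h
  have : (s : ℂ) ≠ 0 := by exact_mod_cast hs.ne'
  field_simp
  linear_combination (-1 : ℂ) * h

/-- The same integration by parts, applied to `x` times the wave. -/
theorem integral_sq_mul_gaussianWave {s : ℝ} (hs : 0 < s) (y : ℝ) :
    ∫ x : ℝ, (x : ℂ) ^ 2 * gaussianWave s y x =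
      (1 / (2 * s) + (-(Complex.I * y / (2 * s))) ^ 2) * ∫ x : ℝ, gaussianWave s y x := by
  have i0 := integrable_pow_mul_gaussianWave hs y 0
  have i1 := integrable_pow_mul_gaussianWave hs y 1
  have i2 := integrable_pow_mul_gaussianWave hs y 2
  simp only [pow_zero, one_mul, pow_one] at i0 i1
  have hd : ∀ x : ℝ, HasDerivAt (fun x : ℝ => (x : ℂ) * gaussianWave s y x)
      (1 * gaussianWave s y x + x * (gaussianWave s y x * (-2 * s * x - Complex.I * y))) x :=
    fun x => (hasDerivAt_id x).ofReal_comp.mul (hasDerivAt_gaussianWave s y x)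
  have e : (fun x : ℝ => 1 * gaussianWave s y x +
      x * (gaussianWave s y x * (-2 * s * x - Complex.I * y))) =
      fun x : ℝ => gaussianWave s y x + ((-2 * s : ℂ) * ((x : ℂ) ^ 2 * gaussianWave s y x) -
        Complex.I * y * (x * gaussianWave s y x)) := by
    ext x; ring
  have h := integral_eq_zero_of_hasDerivAt_of_integrable hd
    (by rw [e]; exact i0.add ((i2.const_mul _).sub (i1.const_mul _))) i1
  have i3 : Integrable fun x : ℝ => (-2 * s : ℂ) * ((x : ℂ) ^ 2 * gaussianWave s y x) -
      Complex.I * y * (x * gaussianWave s y x) := (i2.const_mul _).sub (i1.const_mul _)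
  rw [e, integral_add i0 i3, integral_sub (i2.const_mul _) (i1.const_mul _), integral_const_mul,
    integral_const_mul, integral_mul_gaussianWave hs] at h
  have : (s : ℂ) ≠ 0 := by exact_mod_cast hs.ne'
  field_simp
  field_simp at h
  linear_combination (-1 : ℂ) * h

/-- The Gaussian `e^{-s|x|²}` modulated by `e^{-iy·x}` on `ℝ^d`. -/
def gaussianWaves {d : ℕ} (s : ℝ) (y x : Fin d → ℝ) : ℂ :=
  (Real.exp (-s * normSq x) : ℂ) * Complex.exp (-(Complex.I * ((∑ k, y k * x k : ℝ) : ℂ)))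

theorem gaussianWaves_eq_prod {d : ℕ} (s : ℝ) (y x : Fin d → ℝ) :
    gaussianWaves s y x = ∏ k, gaussianWave s (y k) (x k) := by
  simp only [gaussianWaves, gaussianWave, ← Complex.exp_sum, normSq]
  rw [Complex.ofReal_exp, ← Complex.exp_add]
  congr 1
  push_cast
  rw [Finset.sum_sub_distrib, ← Finset.mul_sum, Finset.mul_sum Finset.univ _ Complex.I]
  simp only [mul_assoc]
  ring

theorem integral_mul_mul_gaussianWaves {d : ℕ} {s : ℝ} (hs : 0 < s) (y : Fin d → ℝ)
    (i j : Fin d) :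
    ∫ x : Fin d → ℝ, ((x i * x j : ℝ) : ℂ) * gaussianWaves s y x =
      (((((if i = j then 1 / (2 * s) else 0) - y i * y j / (2 * s) ^ 2)) *
        ((Real.pi / s) ^ ((d : ℝ) / 2) * Real.exp (-(normSq y / (4 * s)))) : ℝ) : ℂ) := by
  have hM : ∏ k, ∫ x : ℝ, gaussianWave s (y k) x =
      (((Real.pi / s) ^ ((d : ℝ) / 2) * Real.exp (-(normSq y / (4 * s))) : ℝ) : ℂ) := by
    simp only [integral_gaussianWave hs, ← Complex.ofReal_prod]
    rw [Finset.prod_mul_distrib, ← Real.exp_sum, Finset.prod_const, Finset.card_univ,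
      Fintype.card_fin, ← Real.rpow_natCast, ← Real.rpow_mul (by positivity), normSq,
      Finset.sum_neg_distrib, Finset.sum_div, one_div_mul_eq_div]
  -- `c k` counts the occurrences of `k` in the pair `(i, j)`. The integrand becomes a product over
  -- coordinates, with the cases `i = j` and `i ≠ j` treated together.
  set c : Fin d → ℕ := fun k => (if k = i then 1 else 0) + (if k = j then 1 else 0) with hc
  have e : (fun x : Fin d → ℝ => ((x i * x j : ℝ) : ℂ) * gaussianWaves s y x) =
      fun x => ∏ k, ((x k : ℂ) ^ c k * gaussianWave s (y k) (x k)) := by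
    ext x
    rw [Finset.prod_mul_distrib, gaussianWaves_eq_prod]
    congr 1
    simp only [hc, pow_add, Finset.prod_mul_distrib, pow_ite, pow_zero, pow_one,
      Finset.prod_ite_eq', Finset.mem_univ, if_true]
    push_cast
    rfl
  rw [e, integral_fintype_prod_volume_eq_prod
    (fun k (t : ℝ) => (t : ℂ) ^ c k * gaussianWave s (y k) t), Complex.ofReal_mul, ← hM]
  -- `a k` is the ratio of the first to the zeroth moment in coordinate `k`.
  set a : Fin d → ℂ := fun k => -(Complex.I * y k / (2 * s)) with ha
  have h1 : ∀ k, ∫ x : ℝ, (x : ℂ) ^ c k * gaussianWave s (y k) x =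
      (if k = i ∧ k = j then 1 / (2 * s) + a k ^ 2 else (if k = i then a k else 1) *
        (if k = j then a k else 1)) * ∫ x : ℝ, gaussianWave s (y k) x := by
    intro k
    simp only [hc, ha]
    by_cases hi : k = i <;> by_cases hj : k = j
    · subst hi; subst hj
      simpa using integral_sq_mul_gaussianWave hs (y k)
    · simp only [if_pos hi, if_neg hj, if_neg (fun h : k = i ∧ k = j => hj h.2), mul_one, add_zero,
        pow_one]
      exact integral_mul_gaussianWave hs _
    · simp only [if_pos hj, if_neg hi, if_neg (fun h : k = i ∧ k = j => hi h.1), one_mul, zero_add,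
        pow_one]
      exact integral_mul_gaussianWave hs _
    · simp [hi, hj]
  simp only [h1]
  rw [Finset.prod_mul_distrib]
  congr 1
  have hI : Complex.I ^ 2 = -1 := Complex.I_sq
  by_cases hij : i = j
  · subst hij
    rw [Finset.prod_eq_single i (fun k _ hk => by simp [hk]) (by simp)]
    simp only [and_self, if_true, ha]
    push_cast
    linear_combination ((y i : ℂ) / (2 * s)) ^ 2 * hI
  · have : ∀ k, (if k = i ∧ k = j then 1 / (2 * s) + a k ^ 2 else (if k = i then a k else 1) *
        (if k = j then a k else 1)) = (if k = i then a k else 1) * (if k = j then a k else 1) := by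
      intro k
      rw [if_neg]
      rintro ⟨rfl, rfl⟩
      exact hij rfl
    simp only [this, Finset.prod_mul_distrib, Finset.prod_ite_eq', Finset.mem_univ, if_true,
      if_neg hij]
    simp only [ha]
    push_cast
    linear_combination ((y i : ℂ) / (2 * s)) * ((y j : ℂ) / (2 * s)) * hI

/-! ### Fourier transform of the long-range part. -/

/-- The long-range part of the symbol, on frequency space. -/
def gradientProfile {d : ℕ} (x : Fin d → ℝ) (i j : Fin d) : ℝ :=
  x i * x j / normSq x * Real.exp (-(normSq x / 4))

theorem hasDerivAt_exp_neg_div {r u : ℝ} (hu : 0 < u) :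
    HasDerivAt (fun u : ℝ => Real.exp (-(r / (4 * u))))
      (r * (Real.exp (-(1 / (4 * u)) * r) / (4 * u ^ 2))) u := by
  have h1 : HasDerivAt (fun u : ℝ => -(r / (4 * u))) (r / (4 * u ^ 2)) u := by
    have := ((hasDerivAt_inv hu.ne').const_mul (r / 4)).neg
    refine (this.congr_deriv ?_).congr_of_eventuallyEq (Eventually.of_forall fun v => ?_)
    · field_simp
    · simp only [Pi.neg_apply]
      by_cases hv : v = 0
      · simp [hv]
      · field_simp
  refine h1.exp.congr_deriv ?_
  rw [show -(r / (4 * u)) = -(1 / (4 * u)) * r by ring]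
  ring

theorem integrable_integral_exp_neg_div {r : ℝ} (hr : 0 < r) :
    IntegrableOn (fun u : ℝ => r * (Real.exp (-(1 / (4 * u)) * r) / (4 * u ^ 2)))
        (Set.Ioc 0 1) ∧
      ∫ u in Set.Ioc (0 : ℝ) 1, r * (Real.exp (-(1 / (4 * u)) * r) / (4 * u ^ 2)) =
        Real.exp (-(r / 4)) := by
  -- The primitive `e^{-r/(4u)}`, extended by `0` to `u ≤ 0`, is smooth; the fundamental theorem of
  -- calculus then applies up to the endpoint `0`.
  set g : ℝ → ℝ := fun u => expNegInvGlue (4 * u / r) with hg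
  have hgd : ContDiff ℝ 1 g := (expNegInvGlue.contDiff (n := 1)).comp (by fun_prop)
  have hpos : ∀ u : ℝ, 0 < u → g u = Real.exp (-(r / (4 * u))) := by
    intro u hu
    rw [hg]
    simp only [expNegInvGlue]
    rw [if_neg (by have : 0 < 4 * u / r := by positivity
                   linarith), inv_div]
  have hd : ∀ u ∈ Set.Ioc (0 : ℝ) 1,
      deriv g u = r * (Real.exp (-(1 / (4 * u)) * r) / (4 * u ^ 2)) := by
    intro u hu
    refine ((hasDerivAt_exp_neg_div hu.1).congr_of_eventuallyEq ?_).deriv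
    filter_upwards [lt_mem_nhds hu.1] with v hv using hpos v hv
  have hc : Continuous (deriv g) := hgd.continuous_deriv le_rfl
  constructor
  · exact (integrableOn_congr_fun hd measurableSet_Ioc).mp
      (hc.integrableOn_Icc.mono_set Set.Ioc_subset_Icc_self)
  · rw [← setIntegral_congr_fun measurableSet_Ioc hd, ← intervalIntegral.integral_of_le zero_le_one,
      intervalIntegral.integral_deriv_eq_sub
        (fun x _ => (hgd.differentiable one_ne_zero).differentiableAt)
        (hc.intervalIntegrable _ _), hpos 1 one_pos]
    simp [hg, expNegInvGlue]

/-- This trades the singular quotient by `|x|²` for a superposition of Gaussians times `x i * x j`,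
whose Fourier transforms are known. -/
theorem gradientProfile_eq_integral {d : ℕ} {x : Fin d → ℝ} (hx : x ≠ 0) (i j : Fin d) :
    gradientProfile x i j = ∫ u in Set.Ioc (0 : ℝ) 1,
      x i * x j * (Real.exp (-(1 / (4 * u)) * normSq x) / (4 * u ^ 2)) := by
  have hr := normSq_pos hx
  rw [gradientProfile, ← (integrable_integral_exp_neg_div hr).2, ← integral_const_mul]
  congr 1
  ext u
  field_simp

theorem abs_gradientProfile_le {d : ℕ} (x : Fin d → ℝ) (i j : Fin d) :
    |gradientProfile x i j| ≤ Real.exp (-(normSq x / 4)) := by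
  rw [gradientProfile, abs_mul, Real.abs_exp, abs_div, abs_of_nonneg (normSq_nonneg x)]
  refine mul_le_of_le_one_left (Real.exp_pos _).le ?_
  exact div_le_one_of_le₀ (abs_mul_le_normSq x i j) (normSq_nonneg x)

theorem measurable_gradientProfile {d : ℕ} (i j : Fin d) :
    Measurable fun x : Fin d → ℝ => gradientProfile x i j := by
  unfold gradientProfile normSq
  fun_prop

theorem integrable_exp_neg_normSq {d : ℕ} {s : ℝ} (hs : 0 < s) :
    Integrable fun x : Fin d → ℝ => Real.exp (-s * normSq x) := by
  have := Integrable.fintype_prod (ι := Fin d) (f := fun _ (t : ℝ) => Real.exp (-s * t ^ 2))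
    fun _ => integrable_exp_neg_mul_sq hs
  refine this.congr (Eventually.of_forall fun x => ?_)
  simp only [normSq, Finset.mul_sum, Real.exp_sum]

/-- The character `e^{-iy·x}`. -/
def negChar {d : ℕ} (y x : Fin d → ℝ) : ℂ :=
  Complex.exp (-(Complex.I * ((∑ k, y k * x k : ℝ) : ℂ)))

theorem norm_negChar {d : ℕ} (y x : Fin d → ℝ) : ‖negChar y x‖ = 1 := by
  rw [negChar, Complex.norm_exp]
  simp

theorem continuous_negChar {d : ℕ} (y : Fin d → ℝ) : Continuous (negChar y) := by
  unfold negChar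
  fun_prop

theorem integrable_gradientProfile_mul {d : ℕ} (y : Fin d → ℝ) (i j : Fin d) :
    Integrable fun x : Fin d → ℝ => (gradientProfile x i j : ℂ) * negChar y x := by
  refine (integrable_exp_neg_normSq (d := d) (s := 1 / 4) (by norm_num)).mono' ?_
    (Eventually.of_forall fun x => ?_)
  · exact ((Complex.measurable_ofReal.comp (measurable_gradientProfile i j)).mul
      (continuous_negChar y).measurable).aestronglyMeasurable
  · rw [norm_mul, norm_negChar, mul_one, Complex.norm_real]
    refine (abs_gradientProfile_le x i j).trans (le_of_eq ?_)
    congr 1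
    ring

/-- By Fubini the transform is an integral over `u` of Gaussian moments with `s = 1/(4u)`, and each
of these is `(2π)^d` times `kernelIntegrand` at `y`. The case `y = 0` is included; it supplies the
zeroth Fourier coefficient. -/
theorem integral_gradientProfile_mul {d : ℕ} (hd : 2 ≤ d) (y : Fin d → ℝ) (i j : Fin d) :
    ∫ x : Fin d → ℝ, (gradientProfile x i j : ℂ) * negChar y x =
      (((2 * Real.pi) ^ d * kernelLong y i j : ℝ) : ℂ) := by
  have hd0 : 0 < d := by omega
  have : Nonempty (Fin d) := ⟨⟨0, hd0⟩⟩
  have hne : ∀ᵐ x : Fin d → ℝ, x ≠ 0 := by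
    simp [ae_iff]
  set f : (Fin d → ℝ) → ℝ → ℂ := fun x u =>
    ((x i * x j * (Real.exp (-(1 / (4 * u)) * normSq x) / (4 * u ^ 2)) : ℝ) : ℂ) * negChar y x
    with hf
  have hint : ∀ x : Fin d → ℝ, x ≠ 0 → IntegrableOn (fun u : ℝ =>
      x i * x j * (Real.exp (-(1 / (4 * u)) * normSq x) / (4 * u ^ 2))) (Set.Ioc 0 1) := by
    intro x hx
    have hr := normSq_pos hx
    refine ((integrable_integral_exp_neg_div hr).1.const_mul (x i * x j / normSq x)).congr
      (Eventually.of_forall fun u => ?_)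
    simp only
    field_simp
  have h1 : ∫ x : Fin d → ℝ, (gradientProfile x i j : ℂ) * negChar y x =
      ∫ x : Fin d → ℝ, ∫ u in Set.Ioc (0 : ℝ) 1, f x u := by
    refine integral_congr_ae ?_
    filter_upwards [hne] with x hx
    rw [gradientProfile_eq_integral hx, hf]
    simp only
    rw [integral_mul_const, integral_complex_ofReal]
  have hfm : Measurable (Function.uncurry f) := by
    simp only [hf, normSq, negChar, Function.uncurry_def]
    fun_prop
  have hfi : Integrable (Function.uncurry f)
      ((volume : Measure (Fin d → ℝ)).prod (volume.restrict (Set.Ioc (0 : ℝ) 1))) := by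
    rw [integrable_prod_iff hfm.aestronglyMeasurable]
    constructor
    · filter_upwards [hne] with x hx
      exact (Integrable.ofReal (𝕜 := ℂ) (hint x hx)).mul_const (negChar y x)
    -- The inner integral of the norm equals `|x i * x j| / |x|² · e^{-|x|²/4}`, which is dominated
    -- by the Gaussian.
    · refine (integrable_exp_neg_normSq (d := d) (s := 1 / 4) (by norm_num)).mono' ?_ ?_
      · exact hfm.norm.stronglyMeasurable.integral_prod_right.aestronglyMeasurable
      · filter_upwards [hne] with x hx
        have hr := normSq_pos hx
        have : ∀ u, ‖Function.uncurry f (x, u)‖ = |x i * x j| / normSq x *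
            (normSq x * (Real.exp (-(1 / (4 * u)) * normSq x) / (4 * u ^ 2))) := by
          intro u
          rw [hf]
          simp only [Function.uncurry_apply_pair]
          rw [norm_mul, norm_negChar, mul_one, Complex.norm_real, Real.norm_eq_abs, abs_mul,
            abs_of_nonneg (by positivity : 0 ≤ Real.exp (-(1 / (4 * u)) * normSq x) / (4 * u ^ 2))]
          field_simp
        simp only [this]
        rw [integral_const_mul, (integrable_integral_exp_neg_div hr).2, norm_mul,
          Real.norm_of_nonneg (Real.exp_pos _).le, Real.norm_of_nonneg (by positivity)]
        rw [show -(1 / 4 : ℝ) * normSq x = -(normSq x / 4) by ring]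
        exact mul_le_of_le_one_left (Real.exp_pos _).le
          (div_le_one_of_le₀ (abs_mul_le_normSq x i j) hr.le)
  rw [h1, integral_integral_swap hfi, kernelLong, ← integral_const_mul,
    ← integral_complex_ofReal]
  refine setIntegral_congr_fun measurableSet_Ioc fun u hu => ?_
  have hu0 : 0 < u := hu.1
  have h2 := integral_mul_mul_gaussianWaves (s := 1 / (4 * u)) (by positivity) y i j
  have h3 : ∫ x : Fin d → ℝ, f x u = ((1 / (4 * u ^ 2) : ℝ) : ℂ) *
      ∫ x : Fin d → ℝ, ((x i * x j : ℝ) : ℂ) * gaussianWaves (1 / (4 * u)) y x := by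
    rw [← integral_const_mul]
    congr 1
    ext x
    simp only [hf, gaussianWaves, negChar]
    push_cast
    ring
  rw [h3, h2, ← Complex.ofReal_mul]
  congr 1
  have e1 : (Real.pi / (1 / (4 * u))) ^ ((d : ℝ) / 2) =
      2 ^ d * Real.pi ^ ((d : ℝ) / 2) * u ^ ((d : ℝ) / 2) := by
    rw [show Real.pi / (1 / (4 * u)) = 2 ^ (2 : ℝ) * Real.pi * u by
      rw [Real.rpow_two]; field_simp; norm_num, Real.mul_rpow (by positivity) hu0.le,
      Real.mul_rpow (by positivity) Real.pi_pos.le, ← Real.rpow_mul (by norm_num),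
      ← Real.rpow_natCast]
    congr 3
    ring
  have e2 : Real.pi ^ d = Real.pi ^ ((d : ℝ) / 2) * Real.pi ^ ((d : ℝ) / 2) := by
    rw [← Real.rpow_add Real.pi_pos, add_halves, Real.rpow_natCast]
  have e3 : u ^ ((d : ℝ) / 2 - 1) = u ^ ((d : ℝ) / 2) / u := Real.rpow_sub_one hu0.ne' _
  rw [kernelIntegrand, e1, mul_pow 2 Real.pi, e2, e3, add_sub_cancel_right,
    Real.rpow_neg Real.pi_pos.le,
    show normSq y / (4 * (1 / (4 * u))) = normSq y * u by field_simp]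
  have hp : 0 < Real.pi ^ ((d : ℝ) / 2) := by positivity
  split_ifs <;> field_simp <;> ring

/-! ### The characters as a Hilbert basis of `L²(Q)`. -/

/-- The normalized Lebesgue measure on the period cube. -/
def cubeMeasure (d : ℕ) : Measure (Fin d → ℝ) :=
  ENNReal.ofReal |((2 * Real.pi) ^ d)⁻¹| • volume.restrict (periodCube d)

/-- The half-open period cube. -/
def halfOpenCube (d : ℕ) : Set (Fin d → ℝ) :=
  Set.univ.pi fun _ => Set.Ioc (-Real.pi) Real.pi

theorem restrict_halfOpenCube (d : ℕ) :
    (volume : Measure (Fin d → ℝ)).restrict (halfOpenCube d) =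
      volume.restrict (periodCube d) :=
  Measure.restrict_congr_set Measure.univ_pi_Ioc_ae_eq_Icc

theorem measurableSet_halfOpenCube (d : ℕ) : MeasurableSet (halfOpenCube d) :=
  MeasurableSet.univ_pi fun _ => measurableSet_Ioc

/-- The character `e^{im·τ}`. -/
def latticeChar {d : ℕ} (m : Fin d → ℤ) (τ : Fin d → ℝ) : ℂ :=
  Complex.exp (Complex.I * ((∑ k, (m k : ℝ) * τ k : ℝ) : ℂ))

theorem norm_latticeChar {d : ℕ} (m : Fin d → ℤ) (τ : Fin d → ℝ) : ‖latticeChar m τ‖ = 1 := by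
  rw [latticeChar, Complex.norm_exp]
  simp

theorem continuous_latticeChar {d : ℕ} (m : Fin d → ℤ) : Continuous (latticeChar m) := by
  unfold latticeChar
  fun_prop

theorem conj_latticeChar {d : ℕ} (m : Fin d → ℤ) (τ : Fin d → ℝ) :
    starRingEnd ℂ (latticeChar m τ) = negChar (fun k => (m k : ℝ)) τ := by
  rw [latticeChar, negChar, ← Complex.exp_conj]
  simp

theorem latticeChar_mul_conj {d : ℕ} (m n : Fin d → ℤ) (τ : Fin d → ℝ) :
    starRingEnd ℂ (latticeChar m τ) * latticeChar n τ =
      starRingEnd ℂ (latticeChar (m - n) τ) := by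
  rw [conj_latticeChar, conj_latticeChar, latticeChar, negChar, negChar, ← Complex.exp_add]
  congr 1
  rw [← mul_neg, ← mul_neg, ← mul_add]
  congr 1
  rw [← Complex.ofReal_neg, ← Complex.ofReal_neg, ← Complex.ofReal_add, add_comm,
    ← sub_eq_add_neg, ← Finset.sum_sub_distrib, ← Finset.sum_neg_distrib]
  congr 1
  refine Finset.sum_congr rfl fun k _ => ?_
  simp only [Pi.sub_apply]
  push_cast
  ring

/-- The representative in the period cube of a point of the torus. -/
def torusRep {d : ℕ} (x : UnitAddTorus (Fin d)) : Fin d → ℝ :=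
  (2 * Real.pi) • (UnitAddTorus.measurableEquivPiIoc (fun _ => -(1 / 2 : ℝ)) x).1

/-- The Haar probability measure of the torus. -/
abbrev torusMeasure (d : ℕ) : Measure (UnitAddTorus (Fin d)) :=
  Measure.pi fun _ => AddCircle.haarAddCircle

/-- The unit torus is represented by `(-1/2, 1/2]^d`, which dilation by `2π` carries onto the
half-open cube. The missing faces of the closed cube are null, and the dilation accounts for the
normalizing constant. -/
theorem measurePreserving_torusRep (d : ℕ) :
    MeasurePreserving (torusRep (d := d)) (torusMeasure d) (cubeMeasure d) := by
  have h1 : MeasurePreserving (UnitAddTorus.measurableEquivPiIoc (fun _ : Fin d => -(1 / 2 : ℝ)))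
      (torusMeasure d) (Measure.comap Subtype.val volume) :=
    UnitAddTorus.measurePreserving_equivPiIoc _
  have hs : MeasurableSet {x : Fin d → ℝ | ∀ i, x i ∈ Set.Ioc (-(1 / 2 : ℝ)) (-(1 / 2) + 1)} :=
    MeasurableSet.univ_pi' fun _ => measurableSet_Ioc
  have h2 := measurePreserving_subtype_coe (μa := (volume : Measure (Fin d → ℝ))) hs
  have hpi := Real.pi_pos
  have h3 : MeasurePreserving (fun x : Fin d → ℝ => (2 * Real.pi) • x) volume
      (ENNReal.ofReal |((2 * Real.pi) ^ d)⁻¹| • volume) := by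
    refine ⟨by fun_prop, ?_⟩
    rw [Measure.map_addHaar_smul volume (by positivity : 2 * Real.pi ≠ 0)]
    simp
  have h4 := h3.restrict_preimage (measurableSet_halfOpenCube d)
  have h5 : (fun x : Fin d → ℝ => (2 * Real.pi) • x) ⁻¹' halfOpenCube d =
      {x : Fin d → ℝ | ∀ i, x i ∈ Set.Ioc (-(1 / 2 : ℝ)) (-(1 / 2) + 1)} := by
    ext x
    simp only [halfOpenCube, Set.mem_preimage, Set.mem_univ_pi, Set.mem_Ioc, Pi.smul_apply,
      smul_eq_mul, Set.mem_ofPred_eq]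
    refine forall_congr' fun i => and_congr ⟨fun h => ?_, fun h => ?_⟩
      ⟨fun h => ?_, fun h => ?_⟩ <;> nlinarith
  rw [h5, Measure.restrict_smul, restrict_halfOpenCube] at h4
  exact h4.comp (h2.comp h1)

theorem latticeChar_torusRep {d : ℕ} (m : Fin d → ℤ) (x : UnitAddTorus (Fin d)) :
    latticeChar m (torusRep x) = UnitAddTorus.mFourier m x := by
  have h : ∀ i, ((UnitAddTorus.measurableEquivPiIoc (fun _ : Fin d => -(1 / 2 : ℝ)) x).1 i :
      AddCircle (1 : ℝ)) = x i := fun i => AddCircle.coe_equivIoc ..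
  have h' : x = fun i => ((UnitAddTorus.measurableEquivPiIoc (fun _ : Fin d => -(1 / 2 : ℝ)) x).1 i :
      AddCircle (1 : ℝ)) := funext fun i => (h i).symm
  rw [latticeChar, torusRep]
  generalize (UnitAddTorus.measurableEquivPiIoc (fun _ : Fin d => -(1 / 2 : ℝ)) x).1 = t at h'
  rw [h']
  simp only [UnitAddTorus.mFourier, ContinuousMap.coe_mk, fourier_coe_apply, ← Complex.exp_sum]
  congr 1
  push_cast
  rw [Finset.mul_sum]
  refine Finset.sum_congr rfl fun k _ => ?_
  simp only [Pi.smul_apply, smul_eq_mul]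
  push_cast
  ring

instance isProbabilityMeasure_cubeMeasure (d : ℕ) : IsProbabilityMeasure (cubeMeasure d) :=
  (measurePreserving_torusRep d).map_eq ▸
    Measure.isProbabilityMeasure_map (measurePreserving_torusRep d).measurable.aemeasurable

theorem memLp_latticeChar {d : ℕ} (m : Fin d → ℤ) :
    MemLp (latticeChar m) 2 (cubeMeasure d) :=
  MemLp.of_bound (continuous_latticeChar m).aestronglyMeasurable 1
    (Eventually.of_forall fun τ => (norm_latticeChar m τ).le)

/-- Composition with `torusRep`. -/
def cubeToTorus (d : ℕ) :
    Lp ℂ 2 (cubeMeasure d) →ₗᵢ[ℂ] Lp ℂ 2 (torusMeasure d) :=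
  Lp.compMeasurePreservingₗᵢ ℂ torusRep (measurePreserving_torusRep d)

theorem cubeToTorus_latticeChar {d : ℕ} (m : Fin d → ℤ) :
    cubeToTorus d ((memLp_latticeChar m).toLp _) = UnitAddTorus.mFourierLp 2 m := by
  refine (Lp.toLp_compMeasurePreserving (memLp_latticeChar m)
    (measurePreserving_torusRep d)).trans ?_
  refine Lp.ext ?_
  refine (MemLp.coeFn_toLp _).trans ?_
  refine EventuallyEq.trans ?_ (UnitAddTorus.coeFn_mFourierLp 2 m).symm
  exact Eventually.of_forall fun x => latticeChar_torusRep m x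

theorem orthonormal_latticeChar (d : ℕ) :
    Orthonormal ℂ fun m : Fin d → ℤ => (memLp_latticeChar m).toLp (latticeChar m) := by
  rw [← (cubeToTorus d).orthonormal_comp_iff]
  have : (cubeToTorus d ∘ fun m : Fin d → ℤ => (memLp_latticeChar m).toLp (latticeChar m)) =
      UnitAddTorus.mFourierLp 2 := funext cubeToTorus_latticeChar
  rw [this]
  exact UnitAddTorus.orthonormal_mFourier

/-- The characters `e^{im·τ}` as a Hilbert basis of `L²(Q)`. -/
def cubeBasis (d : ℕ) : HilbertBasis (Fin d → ℤ) ℂ (Lp ℂ 2 (cubeMeasure d)) :=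
  HilbertBasis.mkOfOrthogonalEqBot (orthonormal_latticeChar d) <| by
    -- Completeness is inherited from the torus: a function orthogonal to all characters is sent to
    -- one without Fourier coefficients. Only injectivity of `cubeToTorus` is needed.
    rw [Submodule.eq_bot_iff]
    intro f hf
    rw [Submodule.mem_orthogonal] at hf
    have h : ∀ m, inner ℂ (UnitAddTorus.mFourierBasis (d := Fin d) m) (cubeToTorus d f) = 0 := by
      intro m
      have h1 := hf _ (Submodule.subset_span ⟨m, rfl⟩)
      rw [← (cubeToTorus d).inner_map_map, cubeToTorus_latticeChar] at h1
      rw [UnitAddTorus.coe_mFourierBasis]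
      exact h1
    have h2 : UnitAddTorus.mFourierBasis.repr (cubeToTorus d f) = 0 := by
      ext m
      rw [HilbertBasis.repr_apply_apply]
      exact h m
    have h3 : cubeToTorus d f = 0 := (LinearIsometryEquiv.map_eq_zero_iff _).mp h2
    exact (map_eq_zero_iff _ (cubeToTorus d).injective).mp h3

theorem coe_cubeBasis {d : ℕ} (m : Fin d → ℤ) :
    cubeBasis d m = (memLp_latticeChar m).toLp (latticeChar m) := by
  rw [cubeBasis, HilbertBasis.coe_mkOfOrthogonalEqBot]

theorem cubeBasis_repr {d : ℕ} {f : (Fin d → ℝ) → ℂ} (hf : MemLp f 2 (cubeMeasure d))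
    (m : Fin d → ℤ) :
    (cubeBasis d).repr (hf.toLp f) m =
      ∫ τ, starRingEnd ℂ (latticeChar m τ) * f τ ∂(cubeMeasure d) := by
  rw [HilbertBasis.repr_apply_apply, L2.inner_def, coe_cubeBasis]
  refine integral_congr_ae ?_
  filter_upwards [(memLp_latticeChar m).coeFn_toLp, hf.coeFn_toLp] with τ h1 h2
  rw [h1, h2, RCLike.inner_apply, mul_comm]

theorem integral_conj_latticeChar {d : ℕ} (m : Fin d → ℤ) :
    ∫ τ, starRingEnd ℂ (latticeChar m τ) ∂(cubeMeasure d) = if m = 0 then 1 else 0 := by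
  have h := (orthonormal_iff_ite.mp (orthonormal_latticeChar d)) m 0
  rw [← h, L2.inner_def]
  refine (integral_congr_ae ?_).symm
  filter_upwards [(memLp_latticeChar m).coeFn_toLp,
    (memLp_latticeChar (0 : Fin d → ℤ)).coeFn_toLp] with τ h1 h2
  rw [h1, h2, RCLike.inner_apply, mul_comm, latticeChar_mul_conj, sub_zero]

/-! ### The symbol as an Ewald sum: convergence, continuity, bounds, symmetry. -/

/-- A lattice point as a vector in `Fin d → ℝ`. -/
def latticeVec {d : ℕ} (m : Fin d → ℤ) : Fin d → ℝ := fun i => (m i : ℝ)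

theorem latticeVec_ne_zero {d : ℕ} {m : Fin d → ℤ} (hm : m ≠ 0) : latticeVec m ≠ 0 := by
  contrapose! hm
  ext i
  have h := congrFun hm i
  simpa [latticeVec] using h

theorem one_le_normSq_latticeVec {d : ℕ} {m : Fin d → ℤ} (hm : m ≠ 0) :
    1 ≤ normSq (latticeVec m) := by
  obtain ⟨i, hi⟩ := Function.ne_iff.mp hm
  refine le_trans ?_ (sq_le_normSq _ i)
  have h1 : (1 : ℤ) ≤ m i ^ 2 := Int.add_one_le_iff.mpr (by
    have h : m i ≠ 0 := hi
    exact sq_pos_iff.mpr h)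
  change (1 : ℝ) ≤ (m i : ℝ) ^ 2
  exact_mod_cast h1

/-- The coefficients of the absolutely convergent part of the symbol. -/
def shortCoeff {d : ℕ} (m : Fin d → ℤ) (i j : Fin d) : ℝ :=
  -- The value at `m = 0` cancels the zeroth coefficient of the periodized long-range part, since
  -- the diagonal blocks are `0`.
  if m = 0 then -kernelLong (latticeVec m) i j else kernelShort (latticeVec m) i j

theorem exists_abs_shortCoeff_le {d : ℕ} (hd : 2 ≤ d) :
    ∃ C : ℝ, ∀ (m : Fin d → ℤ) i j,
      |shortCoeff m i j| ≤ C * Real.exp (-(1 / 4 * normSq (latticeVec m))) := by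
  obtain ⟨C, hC⟩ := exists_abs_kernelShort_le hd
  refine ⟨max C (∑ i : Fin d, ∑ j : Fin d, |kernelLong (0 : Fin d → ℝ) i j|), fun m i j => ?_⟩
  rw [shortCoeff]
  split_ifs with hm
  · have h0 : latticeVec m = 0 := by
      ext k
      simp [latticeVec, hm]
    rw [h0, abs_neg, show normSq (0 : Fin d → ℝ) = 0 by simp [normSq]]
    simp only [mul_zero, neg_zero, Real.exp_zero, mul_one]
    refine le_trans ?_ (le_max_right _ _)
    refine le_trans ?_ (Finset.single_le_sum (f := fun i => ∑ j : Fin d,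
      |kernelLong (0 : Fin d → ℝ) i j|) (fun _ _ => Finset.sum_nonneg fun _ _ => abs_nonneg _)
      (Finset.mem_univ i))
    exact Finset.single_le_sum (f := fun j => |kernelLong (0 : Fin d → ℝ) i j|)
      (fun _ _ => abs_nonneg _) (Finset.mem_univ j)
  · refine (hC _ (one_le_normSq_latticeVec hm) i j).trans ?_
    rw [show 1 / 4 * normSq (latticeVec m) = normSq (latticeVec m) / 4 by ring]
    gcongr
    exact le_max_left _ _

theorem summable_abs_shortCoeff {d : ℕ} (hd : 2 ≤ d) (i j : Fin d) :
    Summable fun m : Fin d → ℤ => |shortCoeff m i j| := by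
  obtain ⟨C, hC⟩ := exists_abs_shortCoeff_le hd
  exact ((summable_exp_neg_mul_sq (c := 1 / 4) (by norm_num)).mul_left C).of_nonneg_of_le
    (fun _ => abs_nonneg _) fun m => hC m i j

/-- The phase `m·τ`. -/
def phase {d : ℕ} (m : Fin d → ℤ) (τ : Fin d → ℝ) : ℝ := ∑ k, (m k : ℝ) * τ k

theorem continuous_phase {d : ℕ} (m : Fin d → ℤ) : Continuous (phase m) := by
  unfold phase
  fun_prop

/-- The absolutely convergent part of the symbol. -/
def symbolShort {d : ℕ} (τ : Fin d → ℝ) (i j : Fin d) : ℝ :=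
  -- The coefficients are even, so the cosine can replace the exponential; the symbol is then real
  -- by construction.
  ∑' m : Fin d → ℤ, shortCoeff m i j * Real.cos (phase m τ)

/-- The dual lattice translate `τ + 2πk`. -/
def dualShift {d : ℕ} (τ : Fin d → ℝ) (k : Fin d → ℤ) : Fin d → ℝ :=
  τ + (2 * Real.pi) • latticeVec k

/-- The periodization of `gradientProfile`, without the term that is singular at the origin. -/
def symbolTail {d : ℕ} (τ : Fin d → ℝ) (i j : Fin d) : ℝ :=
  ∑' k : Fin d → ℤ, if k = 0 then 0 else gradientProfile (dualShift τ k) i j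

/-- The symbol, as a real matrix. -/
def realSymbol {d : ℕ} (τ : Fin d → ℝ) : Matrix (Fin d) (Fin d) ℝ :=
  Matrix.of fun i j => gradientProfile τ i j + (symbolShort τ i j + symbolTail τ i j)

theorem mem_periodCube_iff {d : ℕ} {τ : Fin d → ℝ} :
    τ ∈ periodCube d ↔ ∀ k, |τ k| ≤ Real.pi := by
  simp only [periodCube, Set.mem_Icc, Pi.le_def, abs_le, ← forall_and]

/-- Coordinatewise, `|τ i| ≤ π` gives `|τ i + 2π k i| ≥ 2π|k i| - π ≥ π|k i|` whenever `k i ≠ 0`.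
The bound is uniform on the closed cube and keeps the terms with `k ≠ 0` away from the singularity.
-/
theorem normSq_dualShift_ge {d : ℕ} {τ : Fin d → ℝ} (hτ : τ ∈ periodCube d) (k : Fin d → ℤ) :
    Real.pi ^ 2 * normSq (latticeVec k) ≤ normSq (dualShift τ k) := by
  rw [normSq, normSq, Finset.mul_sum]
  refine Finset.sum_le_sum fun i _ => ?_
  have hpi := Real.pi_pos
  simp only [dualShift, latticeVec, Pi.add_apply, Pi.smul_apply, smul_eq_mul]
  have h1 := abs_le.mp (mem_periodCube_iff.mp hτ i)
  have h2 : (k i : ℝ) ≤ -1 ∨ (k i : ℝ) = 0 ∨ (1 : ℝ) ≤ k i := by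
    rcases lt_trichotomy (k i) 0 with h | h | h
    · left; exact_mod_cast (by omega : k i ≤ -1)
    · right; left; exact_mod_cast h
    · right; right; exact_mod_cast (by omega : 1 ≤ k i)
  rcases h2 with h | h | h
  · nlinarith [mul_nonneg hpi.le (by linarith : 0 ≤ -(k i : ℝ) - 1),
      mul_nonneg hpi.le (by linarith : 0 ≤ -(k i : ℝ))]
  · rw [h]; nlinarith [sq_nonneg (τ i)]
  · nlinarith [mul_nonneg hpi.le (by linarith : 0 ≤ (k i : ℝ) - 1),
      mul_nonneg hpi.le (by linarith : 0 ≤ (k i : ℝ))]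

theorem abs_gradientProfile_dualShift_le {d : ℕ} {τ : Fin d → ℝ} (hτ : τ ∈ periodCube d)
    (k : Fin d → ℤ) (i j : Fin d) :
    |gradientProfile (dualShift τ k) i j| ≤
      Real.exp (-(Real.pi ^ 2 / 4 * normSq (latticeVec k))) := by
  refine (abs_gradientProfile_le _ i j).trans (Real.exp_le_exp.mpr ?_)
  have := normSq_dualShift_ge hτ k
  linarith

theorem summable_exp_dual {d : ℕ} : Summable fun k : Fin d → ℤ =>
    Real.exp (-(Real.pi ^ 2 / 4 * normSq (latticeVec k))) :=
  summable_exp_neg_mul_sq (by positivity)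

theorem continuousAt_gradientProfile {d : ℕ} {x : Fin d → ℝ} (hx : x ≠ 0) (i j : Fin d) :
    ContinuousAt (fun x => gradientProfile x i j) x := by
  have := continuous_normSq (d := d)
  exact ContinuousAt.mul (ContinuousAt.div (by fun_prop) this.continuousAt (normSq_pos hx).ne')
    (by fun_prop)

theorem continuous_symbolShort {d : ℕ} (hd : 2 ≤ d) (i j : Fin d) :
    Continuous fun τ : Fin d → ℝ => symbolShort τ i j := by
  refine continuous_tsum (fun m => ?_) (summable_abs_shortCoeff hd i j) fun m τ => ?_
  · have := continuous_phase m
    fun_prop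
  · rw [norm_mul]
    exact mul_le_of_le_one_right (abs_nonneg _) (Real.abs_cos_le_one _)

theorem continuousOn_symbolTail {d : ℕ} (i j : Fin d) :
    ContinuousOn (fun τ : Fin d → ℝ => symbolTail τ i j) (periodCube d) := by
  refine continuousOn_tsum (fun k => ?_) summable_exp_dual fun k τ hτ => ?_
  · by_cases hk : k = 0
    · simp only [hk, if_true]
      exact continuousOn_const
    · simp only [hk, if_false]
      intro τ hτ
      have h0 : dualShift τ k ≠ 0 := by
        intro h
        have h1 := normSq_dualShift_ge hτ k
        rw [h, show normSq (0 : Fin d → ℝ) = 0 by simp [normSq]] at h1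
        have h2 := one_le_normSq_latticeVec hk
        have : 0 < Real.pi ^ 2 * normSq (latticeVec k) := by positivity
        linarith
      refine (ContinuousAt.comp (f := fun τ => dualShift τ k)
        (continuousAt_gradientProfile h0 i j) ?_).continuousWithinAt
      unfold dualShift
      fun_prop
  · split_ifs
    · simp [(Real.exp_pos _).le]
    · exact abs_gradientProfile_dualShift_le hτ k i j

theorem continuousOn_realSymbol {d : ℕ} (hd : 2 ≤ d) (i j : Fin d) :
    ContinuousOn (fun τ : Fin d → ℝ => realSymbol τ i j) (periodCube d \ {0}) := by
  refine ContinuousOn.add (fun τ hτ => (continuousAt_gradientProfile hτ.2 i j).continuousWithinAt)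
    ((continuous_symbolShort hd i j).continuousOn.add
      ((continuousOn_symbolTail i j).mono Set.sdiff_subset))

theorem exists_abs_realSymbol_le {d : ℕ} (hd : 2 ≤ d) :
    ∃ C : ℝ, ∀ τ ∈ periodCube d, ∀ i j, |realSymbol τ i j| ≤ C := by
  obtain ⟨C₁, hC₁⟩ := exists_abs_shortCoeff_le hd
  have hs1 : Summable fun m : Fin d → ℤ =>
      C₁ * Real.exp (-(1 / 4 * normSq (latticeVec m))) :=
    (summable_exp_neg_mul_sq (c := 1 / 4) (by norm_num)).mul_left C₁
  refine ⟨1 + (∑' m : Fin d → ℤ, C₁ * Real.exp (-(1 / 4 * normSq (latticeVec m))) +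
    ∑' k : Fin d → ℤ, Real.exp (-(Real.pi ^ 2 / 4 * normSq (latticeVec k)))), fun τ hτ i j => ?_⟩
  rw [realSymbol, Matrix.of_apply]
  refine (abs_add_le _ _).trans (add_le_add ?_ ((abs_add_le _ _).trans (add_le_add ?_ ?_)))
  · refine (abs_gradientProfile_le τ i j).trans (Real.exp_le_one_iff.mpr ?_)
    have := normSq_nonneg τ
    linarith
  · rw [symbolShort, ← Real.norm_eq_abs]
    refine tsum_of_norm_bounded hs1.hasSum fun m => ?_
    rw [norm_mul]
    exact (mul_le_of_le_one_right (abs_nonneg _) (Real.abs_cos_le_one _)).trans (hC₁ m i j)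
  · rw [symbolTail, ← Real.norm_eq_abs]
    refine tsum_of_norm_bounded summable_exp_dual.hasSum fun k => ?_
    split_ifs
    · simp [(Real.exp_pos _).le]
    · exact abs_gradientProfile_dualShift_le hτ k i j

theorem gradientProfile_add_symbolTail {d : ℕ} {τ : Fin d → ℝ} (hτ : τ ∈ periodCube d)
    (i j : Fin d) :
    gradientProfile τ i j + symbolTail τ i j =
      ∑' k : Fin d → ℤ, gradientProfile (dualShift τ k) i j := by
  have hs : Summable fun k : Fin d → ℤ => gradientProfile (dualShift τ k) i j :=
    Summable.of_norm_bounded summable_exp_dual fun k =>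
      abs_gradientProfile_dualShift_le hτ k i j
  rw [hs.tsum_eq_add_tsum_ite 0, symbolTail]
  congr 2
  ext k
  simp [dualShift, latticeVec]

theorem kernelIntegrand_neg {d : ℕ} (x : Fin d → ℝ) (i j : Fin d) :
    kernelIntegrand (-x) i j = kernelIntegrand x i j := by
  ext u
  simp [kernelIntegrand, normSq_neg]

theorem kernelIntegrand_symm {d : ℕ} (x : Fin d → ℝ) (i j : Fin d) :
    kernelIntegrand x i j = kernelIntegrand x j i := by
  ext u
  simp only [kernelIntegrand, mul_comm (x i), eq_comm]

theorem shortCoeff_neg {d : ℕ} (m : Fin d → ℤ) (i j : Fin d) :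
    shortCoeff (-m) i j = shortCoeff m i j := by
  have : latticeVec (-m) = -latticeVec m := by
    ext k
    simp [latticeVec]
  simp only [shortCoeff, neg_eq_zero, this, kernelLong, kernelShort, kernelIntegrand_neg]

theorem shortCoeff_symm {d : ℕ} (m : Fin d → ℤ) (i j : Fin d) :
    shortCoeff m i j = shortCoeff m j i := by
  simp only [shortCoeff, kernelLong, kernelShort, kernelIntegrand_symm _ i j]

theorem gradientProfile_neg {d : ℕ} (x : Fin d → ℝ) (i j : Fin d) :
    gradientProfile (-x) i j = gradientProfile x i j := by
  simp [gradientProfile, normSq_neg]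

theorem gradientProfile_symm {d : ℕ} (x : Fin d → ℝ) (i j : Fin d) :
    gradientProfile x i j = gradientProfile x j i := by
  simp only [gradientProfile, mul_comm (x i)]

theorem realSymbol_isSymm {d : ℕ} (τ : Fin d → ℝ) : (realSymbol τ).IsSymm := by
  ext i j
  simp only [realSymbol, Matrix.transpose_apply, Matrix.of_apply, symbolShort, symbolTail,
    gradientProfile_symm _ j i, shortCoeff_symm _ j i]

/-- Evenness permits replacing `τ` by `-τ` when a path to the corner has to avoid the origin. -/
theorem realSymbol_neg {d : ℕ} (τ : Fin d → ℝ) : realSymbol (-τ) = realSymbol τ := by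
  ext i j
  simp only [realSymbol, Matrix.of_apply, gradientProfile_neg]
  congr 2
  · simp only [symbolShort]
    congr 1
    ext m
    rw [show phase m (-τ) = -phase m τ by simp [phase], Real.cos_neg]
  · simp only [symbolTail]
    rw [← (Equiv.neg (Fin d → ℤ)).tsum_eq]
    congr 1
    ext k
    have : dualShift (-τ) (-k) = -dualShift τ k := by
      ext l
      simp [dualShift, latticeVec]
      ring
    simp only [Equiv.neg_apply, neg_eq_zero, this, gradientProfile_neg]

/-! ### Fourier coefficients of the symbol and convergence of its series. -/

theorem hasSum_setIntegral_dualShift {d : ℕ} {E : Type*} [NormedAddCommGroup E] [NormedSpace ℝ E]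
    {f : (Fin d → ℝ) → E} (hf : Integrable f) :
    HasSum (fun k : Fin d → ℤ => ∫ τ in halfOpenCube d, f (dualShift τ k)) (∫ ξ, f ξ) := by
  have hpi := Real.pi_pos
  set v : (Fin d → ℤ) → (Fin d → ℝ) := fun k => (2 * Real.pi) • latticeVec k with hv
  -- The translates of the half-open cube by `2πℤ^d` partition space exactly, by uniqueness of the
  -- representative in each coordinate.
  set s : (Fin d → ℤ) → Set (Fin d → ℝ) := fun k => (fun ξ => ξ - v k) ⁻¹' halfOpenCube d with hs
  have hsm : ∀ k, MeasurableSet (s k) := fun k =>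
    (measurableSet_halfOpenCube d).preimage (by fun_prop)
  have hmem : ∀ k ξ, ξ ∈ s k ↔
      ∀ i, ξ i - k i • (2 * Real.pi) ∈ Set.Ioc (-Real.pi) (-Real.pi + 2 * Real.pi) := by
    intro k ξ
    have e : -Real.pi + 2 * Real.pi = Real.pi := by ring
    simp only [hs, hv, halfOpenCube, Set.mem_preimage, Set.mem_univ_pi, Pi.sub_apply,
      Pi.smul_apply, latticeVec, smul_eq_mul, zsmul_eq_mul, e, mul_comm (2 * Real.pi)]
  have hd : Pairwise (Function.onFun Disjoint s) := by
    intro k l hkl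
    refine Set.disjoint_left.mpr fun ξ h1 h2 => hkl ?_
    rw [hmem] at h1 h2
    ext i
    exact (existsUnique_sub_zsmul_mem_Ioc Real.two_pi_pos (ξ i) (-Real.pi)).unique (h1 i) (h2 i)
  have hu : ⋃ k, s k = Set.univ := by
    refine Set.eq_univ_of_forall fun ξ => ?_
    choose k hk _ using fun i => existsUnique_sub_zsmul_mem_Ioc Real.two_pi_pos (ξ i) (-Real.pi)
    exact Set.mem_iUnion.mpr ⟨k, (hmem k ξ).mpr hk⟩
  have h := hasSum_integral_iUnion hsm hd (f := f) (μ := volume) hf.integrableOn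
  rw [hu, setIntegral_univ] at h
  refine h.congr_fun fun k => ?_
  have hp : MeasurePreserving (fun ξ : Fin d → ℝ => ξ - v k) volume volume :=
    measurePreserving_sub_right volume (v k)
  have he : MeasurableEmbedding (fun ξ : Fin d → ℝ => ξ - v k) :=
    (MeasurableEquiv.subRight (v k)).measurableEmbedding
  rw [← hp.setIntegral_preimage_emb he (fun τ => f (dualShift τ k))]
  simp [dualShift, hv, hs]

theorem negChar_dualShift {d : ℕ} (n : Fin d → ℤ) (τ : Fin d → ℝ) (k : Fin d → ℤ) :
    negChar (latticeVec n) (dualShift τ k) = negChar (latticeVec n) τ := by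
  rw [negChar, negChar, Complex.exp_eq_exp_iff_exists_int]
  refine ⟨-∑ i, n i * k i, ?_⟩
  simp only [dualShift, latticeVec, Pi.add_apply, Pi.smul_apply, smul_eq_mul, mul_add,
    Finset.sum_add_distrib]
  push_cast
  have : ∑ i, (n i : ℂ) * (2 * Real.pi * k i) = 2 * Real.pi * ∑ i, (n i : ℂ) * k i := by
    rw [Finset.mul_sum]
    exact Finset.sum_congr rfl fun i _ => by ring
  rw [this]
  ring

theorem integral_cubeMeasure {d : ℕ} (f : (Fin d → ℝ) → ℂ) :
    ∫ τ, f τ ∂(cubeMeasure d) =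
      ((((2 * Real.pi) ^ d)⁻¹ : ℝ) : ℂ) * ∫ τ in halfOpenCube d, f τ := by
  have : 0 < ((2 * Real.pi) ^ d)⁻¹ := by positivity
  rw [cubeMeasure, integral_smul_measure, restrict_halfOpenCube, abs_of_pos this,
    ENNReal.toReal_ofReal this.le]
  rfl

theorem ae_mem_periodCube (d : ℕ) : ∀ᵐ τ ∂(cubeMeasure d), τ ∈ periodCube d :=
  Measure.ae_smul_measure (ae_restrict_mem measurableSet_Icc) _

/-- Unfolding: the character is `2πℤ^d`-periodic, so integrating the periodization over one cell
amounts to integrating the profile over the whole space. This is Poisson summation at the level of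
coefficients, where no pointwise convergence is at stake. -/
theorem integral_conj_mul_periodization {d : ℕ} (hd : 2 ≤ d) (n : Fin d → ℤ) (i j : Fin d) :
    ∫ τ, starRingEnd ℂ (latticeChar n τ) *
        ((∑' k : Fin d → ℤ, gradientProfile (dualShift τ k) i j : ℝ) : ℂ) ∂(cubeMeasure d) =
      (kernelLong (latticeVec n) i j : ℂ) := by
  set f : (Fin d → ℝ) → ℂ := fun x => (gradientProfile x i j : ℂ) * negChar (latticeVec n) x
    with hf
  have hfi : Integrable f := integrable_gradientProfile_mul _ i j
  have h1 := hasSum_setIntegral_dualShift hfi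
  have h2 := hasSum_setIntegral_dualShift hfi.norm
  have hint : ∀ k, Integrable (fun τ => f (dualShift τ k)) (volume.restrict (halfOpenCube d)) :=
    fun k => (hfi.comp_add_right _).integrableOn
  have h3 := hasSum_integral_of_summable_integral_norm hint h2.summable
  have h4 : ∀ τ, starRingEnd ℂ (latticeChar n τ) *
      ((∑' k : Fin d → ℤ, gradientProfile (dualShift τ k) i j : ℝ) : ℂ) =
      ∑' k, f (dualShift τ k) := by
    intro τ
    simp only [hf, negChar_dualShift]
    rw [tsum_mul_right, Complex.ofReal_tsum, conj_latticeChar, mul_comm]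
    rfl
  simp only [h4]
  rw [integral_cubeMeasure, h3.unique h1, hf, integral_gradientProfile_mul hd, ← Complex.ofReal_mul,
    inv_mul_cancel_left₀ (by positivity)]

/-- Absolute summability allows termwise integration. Each cosine contributes half a coefficient at
`n` and half at `-n`, and evenness of `shortCoeff` restores the full one, also when `n = 0`. -/
theorem integral_conj_mul_symbolShort {d : ℕ} (hd : 2 ≤ d) (n : Fin d → ℤ) (i j : Fin d) :
    ∫ τ, starRingEnd ℂ (latticeChar n τ) * (symbolShort τ i j : ℂ) ∂(cubeMeasure d) =
      (shortCoeff n i j : ℂ) := by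
  set f : (Fin d → ℤ) → (Fin d → ℝ) → ℂ := fun m τ =>
    starRingEnd ℂ (latticeChar n τ) * ((shortCoeff m i j * Real.cos (phase m τ) : ℝ) : ℂ) with hf
  have hcont : ∀ m, Continuous (f m) := by
    intro m
    have h1 := continuous_phase m
    have h2 := continuous_latticeChar n
    have h3 : Continuous fun τ => starRingEnd ℂ (latticeChar n τ) := by fun_prop
    simp only [hf]
    fun_prop
  have hb : ∀ m τ, ‖f m τ‖ ≤ |shortCoeff m i j| := by
    intro m τ
    rw [hf]
    simp only
    rw [norm_mul, RCLike.norm_conj, norm_latticeChar, one_mul, Complex.norm_real, norm_mul]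
    exact mul_le_of_le_one_right (abs_nonneg _) (Real.abs_cos_le_one _)
  have hint : ∀ m, Integrable (f m) (cubeMeasure d) := fun m =>
    Integrable.of_bound (hcont m).aestronglyMeasurable _ (Eventually.of_forall (hb m))
  have hsum : Summable fun m => ∫ τ, ‖f m τ‖ ∂(cubeMeasure d) := by
    refine (summable_abs_shortCoeff hd i j).of_nonneg_of_le
      (fun m => integral_nonneg fun _ => norm_nonneg _) fun m => ?_
    refine (integral_mono (hint m).norm (integrable_const _) (hb m)).trans (le_of_eq ?_)
    simp
  have h := hasSum_integral_of_summable_integral_norm hint hsum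
  have h4 : ∀ τ, starRingEnd ℂ (latticeChar n τ) * (symbolShort τ i j : ℂ) = ∑' m, f m τ := by
    intro τ
    rw [symbolShort, Complex.ofReal_tsum, ← tsum_mul_left]
  have h5 : ∀ m, ∫ τ, f m τ ∂(cubeMeasure d) =
      (shortCoeff m i j : ℂ) * ((if n = m then 1 else 0) / 2 + (if n = -m then 1 else 0) / 2) := by
    intro m
    have e : ∀ τ, f m τ = (shortCoeff m i j : ℂ) *
        (starRingEnd ℂ (latticeChar (n - m) τ) / 2 + starRingEnd ℂ (latticeChar (n - -m) τ) / 2) := by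
      intro τ
      rw [← latticeChar_mul_conj, ← latticeChar_mul_conj, hf]
      simp only
      have : ((Real.cos (phase m τ) : ℝ) : ℂ) = latticeChar m τ / 2 + latticeChar (-m) τ / 2 := by
        rw [Complex.ofReal_cos, Complex.cos, latticeChar, latticeChar]
        have : ∑ k, (((-m) k : ℤ) : ℝ) * τ k = -phase m τ := by simp [phase]
        rw [this, phase]
        push_cast
        rw [mul_comm Complex.I, mul_comm Complex.I]
        ring
      rw [Complex.ofReal_mul, this]
      ring
    have hc : ∀ l : Fin d → ℤ, Integrable (fun τ => starRingEnd ℂ (latticeChar l τ) / 2)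
        (cubeMeasure d) := by
      intro l
      have h2 := continuous_latticeChar l
      refine Integrable.div_const (Integrable.of_bound (C := 1)
        (by fun_prop : Continuous fun τ => starRingEnd ℂ (latticeChar l τ)).aestronglyMeasurable
        (Eventually.of_forall fun τ => ?_)) _
      rw [RCLike.norm_conj, norm_latticeChar]
    simp only [e]
    rw [integral_const_mul, integral_add (hc _) (hc _), integral_div, integral_div,
      integral_conj_latticeChar, integral_conj_latticeChar]
    simp only [sub_eq_zero]
  simp only [h4]
  rw [← h.tsum_eq]
  simp only [h5]
  have h6 : HasSum (fun m : Fin d → ℤ => (shortCoeff m i j : ℂ) *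
      ((if n = m then 1 else 0) / 2 + (if n = -m then 1 else 0) / 2))
      ((shortCoeff n i j : ℂ) / 2 + (shortCoeff (-n) i j : ℂ) / 2) := by
    have e : (fun m : Fin d → ℤ => (shortCoeff m i j : ℂ) *
        ((if n = m then 1 else 0) / 2 + (if n = -m then 1 else 0) / 2)) = fun m =>
        (if m = n then (shortCoeff n i j : ℂ) / 2 else 0) +
        (if m = -n then (shortCoeff (-n) i j : ℂ) / 2 else 0) := by
      ext m
      rw [mul_add]
      congr 1
      · by_cases hm : m = n
        · rw [if_pos hm, if_pos hm.symm, hm]; ring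
        · rw [if_neg hm, if_neg (Ne.symm hm)]; ring
      · by_cases hm : m = -n
        · rw [if_pos hm, if_pos (by rw [hm, neg_neg]), hm]; ring
        · rw [if_neg hm, if_neg (fun h => hm (by rw [h, neg_neg]))]; ring
    rw [e]
    exact (hasSum_ite_eq n _).add (hasSum_ite_eq (-n) _)
  rw [h6.tsum_eq, shortCoeff_neg]
  ring

theorem toeplitzBlock_zero_right {d : ℕ} (m : Fin d → ℤ) (i j : Fin d) :
    toeplitzBlock d m 0 i j =
      if m = 0 then 0 else (kernel d (WithLp.toLp 2 (latticeVec m)) i j : ℂ) := by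
  rw [toeplitzBlock]
  split_ifs
  · rfl
  · rw [sub_zero]
    rfl

theorem integrable_mul_of_continuousOn {d : ℕ} {f : (Fin d → ℝ) → ℝ}
    (hf : ContinuousOn f (periodCube d)) (n : Fin d → ℤ) :
    Integrable (fun τ => starRingEnd ℂ (latticeChar n τ) * (f τ : ℂ)) (cubeMeasure d) := by
  have h2 := continuous_latticeChar n
  have h3 : Continuous fun τ => starRingEnd ℂ (latticeChar n τ) := by fun_prop
  refine Integrable.smul_measure ?_ ENNReal.ofReal_ne_top
  refine ContinuousOn.integrableOn_compact (isCompact_Icc : IsCompact (periodCube d)) ?_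
  exact h3.continuousOn.mul (Complex.continuous_ofReal.comp_continuousOn hf)

theorem closure_interior_periodCube (d : ℕ) :
    closure (interior (periodCube d)) = periodCube d := by
  have hint : (interior (periodCube d)).Nonempty := by
    refine ⟨0, mem_interior.mpr ⟨Set.univ.pi fun _ => Set.Ioo (-Real.pi) Real.pi, ?_,
      isOpen_set_pi Set.finite_univ fun _ _ => isOpen_Ioo, ?_⟩⟩
    · intro x hx
      exact ⟨fun i => (hx i trivial).1.le, fun i => (hx i trivial).2.le⟩
    · intro i _
      simp [Real.pi_pos]
  have hconv : Convex ℝ (periodCube d) := convex_Icc _ _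
  exact (hconv.closure_interior_eq_closure_of_nonempty_interior hint).trans isClosed_Icc.closure_eq

theorem cubeMeasure_pos_of_mem_nhds {d : ℕ} {τ : Fin d → ℝ} (hτ : τ ∈ periodCube d)
    {s : Set (Fin d → ℝ)} (hs : s ∈ 𝓝[periodCube d] τ) : 0 < cubeMeasure d (s ∩ periodCube d) := by
  obtain ⟨U, hU, hτU, hUs⟩ := mem_nhdsWithin.mp hs
  rw [← closure_interior_periodCube] at hτ
  have h1 : (U ∩ interior (periodCube d)).Nonempty := mem_closure_iff.mp hτ U hU hτU
  have h2 := (hU.inter isOpen_interior).measure_pos (volume : Measure (Fin d → ℝ)) h1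
  have h3 : U ∩ interior (periodCube d) ⊆ (s ∩ periodCube d) ∩ periodCube d := fun x hx =>
    have hx2 := interior_subset hx.2
    ⟨⟨hUs ⟨hx.1, hx2⟩, hx2⟩, hx2⟩
  rw [cubeMeasure, Measure.smul_apply, smul_eq_mul]
  refine ENNReal.mul_pos (by simp) (ne_of_gt ?_)
  exact h2.trans_le ((measure_mono h3).trans (Measure.le_restrict_apply _ _))

/-- Continuity is available only off the origin. The argument works because `Q \ {0}` lies in the
closure of its own interior, a point having dense complement in positive dimension. -/
theorem ae_eq_continuousOn {d : ℕ} (hd : 2 ≤ d) {E : Type*} [TopologicalSpace E] [T2Space E]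
    {f g : (Fin d → ℝ) → E} (hf : ContinuousOn f (periodCube d \ {0}))
    (hg : ContinuousOn g (periodCube d \ {0})) (h : f =ᵐ[cubeMeasure d] g) :
    Set.EqOn f g (periodCube d \ {0}) := by
  have hne : Nonempty (Fin d) := ⟨⟨0, by omega⟩⟩
  have hc : ENNReal.ofReal |((2 * Real.pi) ^ d)⁻¹| ≠ 0 := by
    simp
  have h1 : f =ᵐ[volume.restrict (periodCube d)] g :=
    (Measure.ae_ennreal_smul_measure_iff hc).mp h
  refine Measure.eqOn_of_ae_eq (ae_restrict_of_ae_restrict_of_subset Set.sdiff_subset h1) hf hg ?_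
  have h3 : closure (interior (periodCube d)) ⊆ closure (interior (periodCube d \ {0})) := by
    refine closure_minimal ?_ isClosed_closure
    refine ((dense_compl_singleton (0 : Fin d → ℝ)).open_subset_closure_inter
      isOpen_interior).trans (closure_mono ?_)
    refine interior_maximal (fun x hx => ⟨interior_subset hx.1, hx.2⟩)
      (isOpen_interior.inter isOpen_compl_singleton)
  exact Set.sdiff_subset.trans ((closure_interior_periodCube d).symm.subset.trans h3)

theorem aestronglyMeasurable_realSymbol {d : ℕ} (hd : 2 ≤ d) (i j : Fin d) :
    AEStronglyMeasurable (fun τ : Fin d → ℝ => (realSymbol τ i j : ℂ)) (cubeMeasure d) := by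
  have hne : Nonempty (Fin d) := ⟨⟨0, by omega⟩⟩
  have h1 : AEStronglyMeasurable (fun τ : Fin d → ℝ => (realSymbol τ i j : ℂ))
      (volume.restrict (periodCube d \ {0})) := (Complex.continuous_ofReal.comp_continuousOn
    (continuousOn_realSymbol hd i j)).aestronglyMeasurable (μ := volume)
      (measurableSet_Icc.diff (measurableSet_singleton 0))
  have h2 : (volume : Measure (Fin d → ℝ)).restrict (periodCube d \ {0}) =
      volume.restrict (periodCube d) :=
    Measure.restrict_congr_set (sdiff_null_ae_eq_self (by simp))
  rw [h2] at h1
  exact h1.smul_measure _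

theorem memLp_realSymbol {d : ℕ} (hd : 2 ≤ d) (p : ENNReal) (i j : Fin d) :
    MemLp (fun τ : Fin d → ℝ => (realSymbol τ i j : ℂ)) p (cubeMeasure d) := by
  obtain ⟨C, hC⟩ := exists_abs_realSymbol_le hd
  refine MemLp.of_bound (aestronglyMeasurable_realSymbol hd i j) C ?_
  filter_upwards [ae_mem_periodCube d] with τ hτ
  rw [Complex.norm_real]
  exact hC τ hτ i j

/-- The Fourier coefficients of the symbol are the blocks of the Toeplitz matrix. -/
theorem integral_conj_mul_realSymbol {d : ℕ} (hd : 2 ≤ d) (n : Fin d → ℤ) (i j : Fin d) :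
    ∫ τ, starRingEnd ℂ (latticeChar n τ) * (realSymbol τ i j : ℂ) ∂(cubeMeasure d) =
      toeplitzBlock d n 0 i j := by
  have e : (fun τ => starRingEnd ℂ (latticeChar n τ) * (realSymbol τ i j : ℂ)) =ᵐ[cubeMeasure d]
      fun τ => starRingEnd ℂ (latticeChar n τ) * (symbolShort τ i j : ℂ) +
        starRingEnd ℂ (latticeChar n τ) *
          ((∑' k : Fin d → ℤ, gradientProfile (dualShift τ k) i j : ℝ) : ℂ) := by
    filter_upwards [ae_mem_periodCube d] with τ hτ
    rw [← gradientProfile_add_symbolTail hτ, realSymbol, Matrix.of_apply]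
    push_cast
    ring
  have i1 := integrable_mul_of_continuousOn (continuous_symbolShort hd i j).continuousOn n
  have i0 : Integrable (fun τ => starRingEnd ℂ (latticeChar n τ) * (realSymbol τ i j : ℂ))
      (cubeMeasure d) := by
    have h2 := continuous_latticeChar n
    have h3 : Continuous fun τ => starRingEnd ℂ (latticeChar n τ) := by fun_prop
    refine ((memLp_realSymbol hd 1 i j).integrable le_rfl).bdd_mul (c := 1)
      h3.aestronglyMeasurable (Eventually.of_forall fun τ => ?_)
    rw [RCLike.norm_conj, norm_latticeChar]
  have i2 : Integrable (fun τ => starRingEnd ℂ (latticeChar n τ) *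
      ((∑' k : Fin d → ℤ, gradientProfile (dualShift τ k) i j : ℝ) : ℂ)) (cubeMeasure d) := by
    refine (i0.sub i1).congr ?_
    filter_upwards [e] with τ hτ
    rw [Pi.sub_apply, hτ]
    ring
  rw [integral_congr_ae e, integral_add i1 i2, integral_conj_mul_symbolShort hd,
    integral_conj_mul_periodization hd, toeplitzBlock_zero_right, shortCoeff, ← Complex.ofReal_add]
  split_ifs with hn
  · simp
  · rw [kernelShort_add_kernelLong hd (latticeVec_ne_zero hn)]

/-- The entries of the symbol in `L²`. -/
def symbolLp {d : ℕ} (hd : 2 ≤ d) (i j : Fin d) : Lp ℂ 2 (cubeMeasure d) :=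
  (memLp_realSymbol hd 2 i j).toLp _

theorem repr_symbolLp {d : ℕ} (hd : 2 ≤ d) (m : Fin d → ℤ) (i j : Fin d) :
    (cubeBasis d).repr (symbolLp hd i j) m = toeplitzBlock d m 0 i j := by
  rw [symbolLp, cubeBasis_repr, integral_conj_mul_realSymbol hd]

theorem isSymbol_realSymbol {d : ℕ} (hd : 2 ≤ d) :
    IsSymbol d fun τ => (realSymbol τ).map Complex.ofReal := by
  constructor
  · refine continuousOn_pi.mpr fun i => continuousOn_pi.mpr fun j => ?_
    exact Complex.continuous_ofReal.comp_continuousOn (continuousOn_realSymbol hd i j)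
  · intro i j
    -- The Hilbert basis expansion is already unconditional `L²` convergence, but for the normalized
    -- measure; the normalization is removed at the end.
    have h := (cubeBasis d).hasSum_repr (symbolLp hd i j)
    have h1 := (Lp.tendsto_Lp_iff_tendsto_eLpNorm' _ _).mp h
    have hc : ENNReal.ofReal |((2 * Real.pi) ^ d)⁻¹| ≠ 0 := by
      simp
    have e : ∀ s : Finset (Fin d → ℤ),
        eLpNorm (fun τ => symbolPartialSum d s τ i j - ((realSymbol τ).map Complex.ofReal) i j) 2
          (cubeMeasure d) = eLpNorm (⇑(∑ m ∈ s, (cubeBasis d).repr (symbolLp hd i j) m •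
            (cubeBasis d) m) - ⇑(symbolLp hd i j)) 2 (cubeMeasure d) := by
      intro s
      refine eLpNorm_congr_ae ?_
      have h2 : ∀ᵐ τ ∂(cubeMeasure d), ∀ m : Fin d → ℤ,
          ((cubeBasis d).repr (symbolLp hd i j) m • (cubeBasis d) m :
            Lp ℂ 2 (cubeMeasure d)) τ = toeplitzBlock d m 0 i j * latticeChar m τ := by
        rw [ae_all_iff]
        intro m
        rw [repr_symbolLp, coe_cubeBasis]
        filter_upwards [Lp.coeFn_smul (toeplitzBlock d m 0 i j)
          ((memLp_latticeChar m).toLp (latticeChar m)), (memLp_latticeChar m).coeFn_toLp]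
          with τ h3 h4
        rw [h3, Pi.smul_apply, h4, smul_eq_mul]
      have h6 : symbolLp hd i j =ᵐ[cubeMeasure d] fun τ => (realSymbol τ i j : ℂ) :=
        (memLp_realSymbol hd 2 i j).coeFn_toLp
      filter_upwards [h2, h6,
        Lp.coeFn_finsetSum s fun m => ((cubeBasis d).repr (symbolLp hd i j) m • (cubeBasis d) m :
            Lp ℂ 2 (cubeMeasure d))] with τ h3 h4 h5
      rw [Pi.sub_apply, h5, h4]
      congr 1
      rw [symbolPartialSum, Matrix.sum_apply, Finset.sum_apply]
      refine Finset.sum_congr rfl fun m _ => ?_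
      rw [h3 m, Matrix.smul_apply, smul_eq_mul, mul_comm]
      rfl
    have h2 : Tendsto (fun s : Finset (Fin d → ℤ) =>
        eLpNorm (fun τ => symbolPartialSum d s τ i j - ((realSymbol τ).map Complex.ofReal) i j) 2
          (cubeMeasure d)) atTop (𝓝 0) := by
      simp only [e]
      exact h1
    have h3 : volume.restrict (periodCube d) =
        (ENNReal.ofReal |((2 * Real.pi) ^ d)⁻¹|)⁻¹ • cubeMeasure d := by
      rw [cubeMeasure, smul_smul, ENNReal.inv_mul_cancel hc ENNReal.ofReal_ne_top, one_smul]
    simp only [h3, eLpNorm_smul_measure_of_ne_top (ENNReal.ofNat_ne_top (n := 2)), smul_eq_mul]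
    have h4 := ENNReal.Tendsto.const_mul h2 (Or.inr (ENNReal.rpow_ne_top_of_nonneg
      ENNReal.toReal_nonneg (ENNReal.inv_ne_top.mpr hc)) :
        _ ∨ ((ENNReal.ofReal |((2 * Real.pi) ^ d)⁻¹|)⁻¹) ^ (1 / (2 : ENNReal)).toReal ≠ ⊤)
    rwa [mul_zero] at h4

/-! ### Trace and symmetries of the symbol: its value at the corner and its limits at the origin. -/

theorem trace_toeplitzBlock {d : ℕ} (hd : 2 ≤ d) (m : Fin d → ℤ) :
    ∑ i, toeplitzBlock d m 0 i i = 0 := by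
  simp only [toeplitzBlock_zero_right]
  split_ifs with hm
  · simp
  · have hx : (WithLp.toLp 2 (latticeVec m) : EuclideanSpace ℝ (Fin d)) ≠ 0 := by
      simpa using latticeVec_ne_zero hm
    have hd0 : (d : ℝ) ≠ 0 := by exact_mod_cast (by omega : d ≠ 0)
    rw [← Complex.ofReal_sum]
    simp only [kernel_apply hd hx, if_true, norm_toLp_eq, Real.sq_sqrt (normSq_nonneg _), mul_one]
    rw [← Finset.sum_div, ← Finset.mul_sum, Finset.sum_sub_distrib, Finset.sum_const,
      Finset.card_univ, Fintype.card_fin]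
    have : ∑ i, latticeVec m i * latticeVec m i = normSq (latticeVec m) := by
      simp only [normSq, sq]
    rw [this, nsmul_eq_mul, ← mul_assoc, mul_one_div_cancel hd0]
    simp

/-- All Fourier coefficients of the trace vanish, so the trace is zero almost everywhere, and
continuity off the origin removes the exceptional set. The Ewald sums need not be evaluated. -/
theorem trace_realSymbol {d : ℕ} (hd : 2 ≤ d) {τ : Fin d → ℝ} (hτ : τ ∈ periodCube d)
    (h0 : τ ≠ 0) : ∑ i, realSymbol τ i i = 0 := by
  have h1 : ∑ i, symbolLp hd i i = 0 := by
    rw [← map_eq_zero_iff _ (cubeBasis d).repr.injective]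
    ext m
    rw [map_sum, lp.coeFn_sum, Finset.sum_apply]
    simp only [repr_symbolLp, trace_toeplitzBlock hd]
    rfl
  have h2 : (fun τ : Fin d → ℝ => ∑ i, realSymbol τ i i) =ᵐ[cubeMeasure d] fun _ => 0 := by
    have h3 := Lp.coeFn_finsetSum Finset.univ fun i => symbolLp hd i i
    rw [h1] at h3
    have h4 : ∀ᵐ τ ∂(cubeMeasure d), ∀ i, symbolLp hd i i τ = (realSymbol τ i i : ℂ) :=
      ae_all_iff.mpr fun i => (memLp_realSymbol hd 2 i i).coeFn_toLp
    filter_upwards [h3, h4, Lp.coeFn_zero ℂ 2 (cubeMeasure d)] with τ h3 h4 h5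
    rw [h5, Finset.sum_apply] at h3
    simp only [h4, Pi.zero_apply] at h3
    exact_mod_cast h3.symm
  exact ae_eq_continuousOn hd (continuousOn_finsetSum _ fun i _ => continuousOn_realSymbol hd i i)
    continuousOn_const h2 ⟨hτ, h0⟩

theorem normSq_comp_perm {d : ℕ} (σ : Equiv.Perm (Fin d)) (x : Fin d → ℝ) :
    normSq (x ∘ σ) = normSq x :=
  Equiv.sum_comp σ fun i => x i ^ 2

theorem kernelIntegrand_comp_perm {d : ℕ} (σ : Equiv.Perm (Fin d)) (x : Fin d → ℝ)
    (i j : Fin d) : kernelIntegrand (x ∘ σ) i j = kernelIntegrand x (σ i) (σ j) := by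
  ext u
  simp only [kernelIntegrand, normSq_comp_perm, σ.injective.eq_iff, Function.comp_apply]

theorem gradientProfile_comp_perm {d : ℕ} (σ : Equiv.Perm (Fin d)) (x : Fin d → ℝ)
    (i j : Fin d) : gradientProfile (x ∘ σ) i j = gradientProfile x (σ i) (σ j) := by
  simp only [gradientProfile, normSq_comp_perm, Function.comp_apply]

/-- Permutation of the coordinates of a lattice point. -/
def permLattice {d : ℕ} (σ : Equiv.Perm (Fin d)) : (Fin d → ℤ) ≃ (Fin d → ℤ) :=
  σ.symm.arrowCongr (Equiv.refl ℤ)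

theorem permLattice_apply {d : ℕ} (σ : Equiv.Perm (Fin d)) (m : Fin d → ℤ) :
    permLattice σ m = m ∘ σ := rfl

theorem comp_perm_eq_zero {d : ℕ} (σ : Equiv.Perm (Fin d)) (m : Fin d → ℤ) :
    m ∘ σ = 0 ↔ m = 0 := by
  refine ⟨fun h => ?_, fun h => by rw [h]; rfl⟩
  ext k
  simpa using congrFun h (σ.symm k)

theorem symbolShort_comp_perm {d : ℕ} (σ : Equiv.Perm (Fin d)) (τ : Fin d → ℝ) (i j : Fin d) :
    symbolShort (τ ∘ σ) i j = symbolShort τ (σ i) (σ j) := by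
  rw [symbolShort, ← (permLattice σ).tsum_eq]
  simp only [permLattice_apply]
  refine tsum_congr fun m => ?_
  have h1 : phase (m ∘ σ) (τ ∘ σ) = phase m τ := Equiv.sum_comp σ fun k => (m k : ℝ) * τ k
  have h2 : latticeVec (m ∘ σ) = latticeVec m ∘ σ := rfl
  simp only [shortCoeff, comp_perm_eq_zero, h1, h2, kernelLong, kernelShort,
    kernelIntegrand_comp_perm]

theorem symbolTail_comp_perm {d : ℕ} (σ : Equiv.Perm (Fin d)) (τ : Fin d → ℝ) (i j : Fin d) :
    symbolTail (τ ∘ σ) i j = symbolTail τ (σ i) (σ j) := by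
  rw [symbolTail, ← (permLattice σ).tsum_eq]
  simp only [permLattice_apply]
  refine tsum_congr fun k => ?_
  have h2 : dualShift (τ ∘ σ) (k ∘ σ) = dualShift τ k ∘ σ := rfl
  simp only [comp_perm_eq_zero, h2, gradientProfile_comp_perm]

/-- Reflection of the `i`-th coordinate. -/
def reflectAt {d : ℕ} {α : Type*} [Neg α] (i : Fin d) (x : Fin d → α) : Fin d → α :=
  fun k => if k = i then -x k else x k

theorem normSq_reflectAt {d : ℕ} (i : Fin d) (x : Fin d → ℝ) :
    normSq (reflectAt i x) = normSq x := by
  refine Finset.sum_congr rfl fun k _ => ?_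
  rw [reflectAt]
  split_ifs <;> ring

theorem reflectAt_mul {d : ℕ} {i j : Fin d} (hij : i ≠ j) (x : Fin d → ℝ) :
    reflectAt i x i * reflectAt i x j = -(x i * x j) := by
  simp [reflectAt, hij.symm]

theorem kernelIntegrand_reflectAt {d : ℕ} {i j : Fin d} (hij : i ≠ j) (x : Fin d → ℝ) (u : ℝ) :
    kernelIntegrand (reflectAt i x) i j u = -kernelIntegrand x i j u := by
  simp only [kernelIntegrand, normSq_reflectAt, reflectAt_mul hij, hij, if_false]
  ring

theorem gradientProfile_reflectAt {d : ℕ} {i j : Fin d} (hij : i ≠ j) (x : Fin d → ℝ) :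
    gradientProfile (reflectAt i x) i j = -gradientProfile x i j := by
  simp only [gradientProfile, normSq_reflectAt, reflectAt_mul hij]
  ring

theorem tsum_eq_zero_of_equiv_neg {ι : Type*} {f : ι → ℝ} (e : ι ≃ ι)
    (h : ∀ k, f (e k) = -f k) : ∑' k, f k = 0 := by
  have h1 := e.tsum_eq f
  simp only [h, tsum_neg] at h1
  linarith

theorem reflectAt_involutive {d : ℕ} (i : Fin d) :
    Function.Involutive (reflectAt i : (Fin d → ℤ) → Fin d → ℤ) := by
  intro m
  ext k
  simp only [reflectAt]
  split_ifs <;> simp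

theorem reflectAt_eq_zero {d : ℕ} (i : Fin d) (m : Fin d → ℤ) : reflectAt i m = 0 ↔ m = 0 := by
  constructor
  · intro h
    rw [← reflectAt_involutive i m, h]
    ext k
    simp [reflectAt]
  · rintro rfl
    ext k
    simp [reflectAt]

theorem latticeVec_reflectAt {d : ℕ} (i : Fin d) (m : Fin d → ℤ) :
    latticeVec (reflectAt i m) = reflectAt i (latticeVec m) := by
  ext k
  simp only [latticeVec, reflectAt]
  split_ifs <;> simp

/-- The corner `(π, …, π)` of the period cube. -/
def cubeCorner (d : ℕ) : Fin d → ℝ := fun _ => Real.pi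

theorem cubeCorner_mem (d : ℕ) : cubeCorner d ∈ periodCube d :=
  mem_periodCube_iff.mpr fun _ => (abs_of_pos Real.pi_pos).le

/-- Reflecting the `i`-th coordinate of `m` changes the phase at the corner by a multiple of `2π`,
but changes the sign of the off-diagonal coefficient. -/
theorem symbolShort_cubeCorner {d : ℕ} {i j : Fin d} (hij : i ≠ j) :
    symbolShort (cubeCorner d) i j = 0 := by
  refine tsum_eq_zero_of_equiv_neg (reflectAt_involutive i).toPerm fun m => ?_
  have h1 : Real.cos (phase (reflectAt i m) (cubeCorner d)) =
      Real.cos (phase m (cubeCorner d)) := by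
    have h : phase (reflectAt i m) (cubeCorner d) =
        phase m (cubeCorner d) - (m i : ℝ) * (2 * Real.pi) := by
      have h2 : ∀ k, ((reflectAt i m k : ℤ) : ℝ) * Real.pi =
          (m k : ℝ) * Real.pi - if k = i then (m i : ℝ) * (2 * Real.pi) else 0 := by
        intro k
        rw [reflectAt]
        by_cases hk : k = i
        · rw [if_pos hk, if_pos hk, hk]
          push_cast
          ring
        · rw [if_neg hk, if_neg hk, sub_zero]
      simp only [phase, cubeCorner, h2]
      rw [Finset.sum_sub_distrib, Finset.sum_ite_eq' Finset.univ i, if_pos (Finset.mem_univ i)]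
    rw [h, Real.cos_sub_int_mul_two_pi]
  have h2 : shortCoeff (reflectAt i m) i j = -shortCoeff m i j := by
    simp only [shortCoeff, reflectAt_eq_zero, latticeVec_reflectAt, kernelLong, kernelShort,
      kernelIntegrand_reflectAt hij, integral_neg]
    split_ifs <;> rfl
  simp only [Function.Involutive.coe_toPerm, h1, h2]
  ring

theorem periodization_cubeCorner {d : ℕ} {i j : Fin d} (hij : i ≠ j) :
    ∑' k : Fin d → ℤ, gradientProfile (dualShift (cubeCorner d) k) i j = 0 := by
  -- On the dual lattice the reflection is `k i ↦ -1 - k i`, because `π + 2π(-1 - k i) = -(π + 2π k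
  -- i)`.
  have hinv : Function.Involutive
      (fun (k : Fin d → ℤ) l => if l = i then -1 - k l else k l) := by
    intro k
    ext l
    simp only
    split_ifs <;> ring
  refine tsum_eq_zero_of_equiv_neg hinv.toPerm fun k => ?_
  rw [Function.Involutive.coe_toPerm, ← gradientProfile_reflectAt hij]
  congr 1
  ext l
  simp only [dualShift, latticeVec, cubeCorner, reflectAt, Pi.add_apply, Pi.smul_apply,
    smul_eq_mul]
  split_ifs
  · push_cast
    ring
  · rfl

theorem realSymbol_comp_perm {d : ℕ} (σ : Equiv.Perm (Fin d)) (τ : Fin d → ℝ) (i j : Fin d) :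
    realSymbol (τ ∘ σ) i j = realSymbol τ (σ i) (σ j) := by
  simp only [realSymbol, Matrix.of_apply, gradientProfile_comp_perm, symbolShort_comp_perm,
    symbolTail_comp_perm]

theorem cubeCorner_ne_zero {d : ℕ} (hd : 2 ≤ d) : cubeCorner d ≠ 0 := by
  intro h
  exact Real.pi_ne_zero (congrFun h ⟨0, by omega⟩)

/-- Permutations of the coordinates fix the corner, so the diagonal entries agree, and their sum is
the trace, which is zero; the off-diagonal entries cancel under reflection. The corner is the point
from which the eigenvalues sweep out an interval. -/
theorem realSymbol_cubeCorner {d : ℕ} (hd : 2 ≤ d) : realSymbol (cubeCorner d) = 0 := by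
  ext i j
  by_cases hij : i = j
  · subst hij
    have h1 : ∀ k, realSymbol (cubeCorner d) k k = realSymbol (cubeCorner d) i i := by
      intro k
      have := realSymbol_comp_perm (Equiv.swap i k) (cubeCorner d) i i
      rw [Equiv.swap_apply_left] at this
      exact this.symm
    have h2 := trace_realSymbol hd (cubeCorner_mem d) (cubeCorner_ne_zero hd)
    simp only [h1, Finset.sum_const, Finset.card_univ, Fintype.card_fin, nsmul_eq_mul] at h2
    have hd0 : (d : ℝ) ≠ 0 := by exact_mod_cast (by omega : d ≠ 0)
    exact (mul_eq_zero.mp h2).resolve_left hd0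
  · rw [realSymbol, Matrix.of_apply, add_left_comm,
      gradientProfile_add_symbolTail (cubeCorner_mem d), symbolShort_cubeCorner hij,
      periodization_cubeCorner hij]
    simp

/-- The symbol without its discontinuous part. -/
def symbolRegular {d : ℕ} (τ : Fin d → ℝ) (i j : Fin d) : ℝ := symbolShort τ i j + symbolTail τ i j

theorem tendsto_symbolRegular {d : ℕ} (hd : 2 ≤ d) (i j : Fin d) :
    Tendsto (fun τ : Fin d → ℝ => symbolRegular τ i j) (𝓝[periodCube d] 0)
      (𝓝 (symbolRegular 0 i j)) :=
  ((continuous_symbolShort hd i j).continuousOn.add (continuousOn_symbolTail i j)) 0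
    (mem_periodCube_iff.mpr fun _ => by simp [Real.pi_pos.le])

theorem tendsto_single_nhdsWithin {d : ℕ} (l : Fin d) :
    Tendsto (fun t : ℝ => (Pi.single l t : Fin d → ℝ)) (𝓝[>] 0) (𝓝[periodCube d \ {0}] 0) := by
  refine tendsto_nhdsWithin_iff.mpr ⟨?_, ?_⟩
  · have h : Continuous fun t : ℝ => (Pi.single l t : Fin d → ℝ) :=
      continuous_single (A := fun _ : Fin d => ℝ) l
    have := h.tendsto 0
    rw [Pi.single_zero] at this
    exact this.mono_left nhdsWithin_le_nhds
  · filter_upwards [Ioo_mem_nhdsGT Real.pi_pos] with t ht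
    refine ⟨mem_periodCube_iff.mpr fun k => ?_, ?_⟩
    · by_cases hk : k = l
      · subst hk
        simp [abs_of_pos ht.1, ht.2.le]
      · simp [hk, Real.pi_pos.le]
    · simp [ht.1.ne']

theorem gradientProfile_single_self {d : ℕ} (l : Fin d) {t : ℝ} (ht : t ≠ 0) :
    gradientProfile (Pi.single l t) l l = Real.exp (-(t ^ 2 / 4)) := by
  have h : normSq (Pi.single l t : Fin d → ℝ) = t ^ 2 := by
    rw [normSq, Finset.sum_eq_single l (fun k _ hk => by simp [hk]) (by simp)]
    simp
  rw [gradientProfile, h, Pi.single_eq_same, ← sq, div_self (by positivity), one_mul]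

theorem gradientProfile_single_of_ne {d : ℕ} {l k : Fin d} (hk : k ≠ l) (t : ℝ) :
    gradientProfile (Pi.single l t) k k = 0 := by
  simp [gradientProfile, hk]

/-- Along a coordinate axis the singular term has trace `e^{-t²/4} → 1`. As the total trace is zero,
the regular part has trace `-1` at the origin, shared equally among the diagonal entries by
permutation symmetry. -/
theorem symbolRegular_zero {d : ℕ} (hd : 2 ≤ d) (i : Fin d) :
    symbolRegular (0 : Fin d → ℝ) i i = -(1 / (d : ℝ)) := by
  have h1 : ∀ k, symbolRegular (0 : Fin d → ℝ) k k = symbolRegular (0 : Fin d → ℝ) i i := by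
    intro k
    have e1 := symbolShort_comp_perm (Equiv.swap i k) 0 i i
    have e2 := symbolTail_comp_perm (Equiv.swap i k) 0 i i
    rw [Equiv.swap_apply_left] at e1 e2
    rw [symbolRegular, ← e1, ← e2]
    rfl
  have h2 : Tendsto (fun t : ℝ => Real.exp (-(t ^ 2 / 4)) +
      ∑ k, symbolRegular (Pi.single i t : Fin d → ℝ) k k) (𝓝[>] 0)
      (𝓝 (1 + ∑ k, symbolRegular (0 : Fin d → ℝ) k k)) := by
    refine Tendsto.add ?_ (tendsto_finsetSum _ fun k _ => (tendsto_symbolRegular hd k k).comp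
      ((tendsto_single_nhdsWithin i).mono_right (nhdsWithin_mono _ Set.sdiff_subset)))
    have : Continuous fun t : ℝ => Real.exp (-(t ^ 2 / 4)) := by fun_prop
    have h := this.tendsto 0
    simp only [ne_eq, OfNat.ofNat_ne_zero, not_false_eq_true, zero_pow, zero_div, neg_zero,
      Real.exp_zero] at h
    exact h.mono_left nhdsWithin_le_nhds
  have h3 : ∀ᶠ t : ℝ in 𝓝[>] 0, Real.exp (-(t ^ 2 / 4)) +
      ∑ k, symbolRegular (Pi.single i t : Fin d → ℝ) k k = 0 := by
    have h4 := (tendsto_single_nhdsWithin i).eventually (self_mem_nhdsWithin)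
    filter_upwards [h4, self_mem_nhdsWithin] with t ht ht0
    rw [← trace_realSymbol hd ht.1 ht.2]
    simp only [realSymbol, Matrix.of_apply]
    rw [Finset.sum_add_distrib]
    congr 1
    rw [Finset.sum_eq_single i (fun k _ hk => gradientProfile_single_of_ne hk t) (by simp),
      gradientProfile_single_self i (ne_of_gt ht0)]
  have h5 : 1 + ∑ k, symbolRegular (0 : Fin d → ℝ) k k = 0 :=
    tendsto_nhds_unique (h2.congr' h3) tendsto_const_nhds
  simp only [h1, Finset.sum_const, Finset.card_univ, Fintype.card_fin, nsmul_eq_mul] at h5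
  have hd0 : (d : ℝ) ≠ 0 := by exact_mod_cast (by omega : d ≠ 0)
  field_simp
  linarith

/-- Approached along an axis, the singular term contributes `1` in that direction and `0` on the
remaining diagonal entries; this discontinuity produces both bounds on `Λ₊` and `Λ₋`. -/
theorem tendsto_realSymbol_single_self {d : ℕ} (hd : 2 ≤ d) (l : Fin d) :
    Tendsto (fun t : ℝ => realSymbol (Pi.single l t : Fin d → ℝ) l l) (𝓝[>] 0)
      (𝓝 (1 - 1 / (d : ℝ))) := by
  have h : Tendsto (fun t : ℝ => Real.exp (-(t ^ 2 / 4)) +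
      symbolRegular (Pi.single l t : Fin d → ℝ) l l) (𝓝[>] 0) (𝓝 (1 - 1 / (d : ℝ))) := by
    rw [sub_eq_add_neg, ← symbolRegular_zero hd l]
    refine Tendsto.add ?_ ((tendsto_symbolRegular hd l l).comp
      ((tendsto_single_nhdsWithin l).mono_right (nhdsWithin_mono _ Set.sdiff_subset)))
    have : Continuous fun t : ℝ => Real.exp (-(t ^ 2 / 4)) := by fun_prop
    have h := this.tendsto 0
    simp only [ne_eq, OfNat.ofNat_ne_zero, not_false_eq_true, zero_pow, zero_div, neg_zero,
      Real.exp_zero] at h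
    exact h.mono_left nhdsWithin_le_nhds
  refine h.congr' ?_
  filter_upwards [self_mem_nhdsWithin] with t ht
  rw [realSymbol, Matrix.of_apply, gradientProfile_single_self l (ne_of_gt ht)]
  rfl

theorem tendsto_realSymbol_single_of_ne {d : ℕ} (hd : 2 ≤ d) {l k : Fin d} (hk : k ≠ l) :
    Tendsto (fun t : ℝ => realSymbol (Pi.single l t : Fin d → ℝ) k k) (𝓝[>] 0)
      (𝓝 (-(1 / (d : ℝ)))) := by
  rw [← symbolRegular_zero hd k]
  refine ((tendsto_symbolRegular hd k k).comp
    ((tendsto_single_nhdsWithin l).mono_right (nhdsWithin_mono _ Set.sdiff_subset))).congr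
      fun t => ?_
  rw [realSymbol, Matrix.of_apply, gradientProfile_single_of_ne hk, zero_add]
  rfl

/-! ### The Toeplitz operator as multiplication by the symbol. -/

/-- `ℓ²(ℤ^d; ℂ)`. -/
abbrev ScalarL2 (d : ℕ) : Type := lp (fun _ : Fin d → ℤ => ℂ) 2

/-- The `j`-th component of a vector-valued sequence. -/
def componentProj (d : ℕ) (j : Fin d) : LatticeL2 d →L[ℂ] ScalarL2 d :=
  LinearMap.mkContinuous
    { toFun := fun u => ⟨fun n => u n j, (lp.memℓp u).mono' fun n => PiLp.norm_apply_le (u n) j⟩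
      map_add' := fun _ _ => rfl
      map_smul' := fun _ _ => rfl } 1 fun u => by
    rw [one_mul]
    exact lp.norm_mono two_ne_zero fun n => PiLp.norm_apply_le (u n) j

theorem componentProj_apply {d : ℕ} (j : Fin d) (u : LatticeL2 d) (n : Fin d → ℤ) :
    componentProj d j u n = u n j := rfl

theorem componentProj_single {d : ℕ} (j : Fin d) (n : Fin d → ℤ) (v : EuclideanSpace ℂ (Fin d)) :
    componentProj d j (lp.single 2 n v) = lp.single 2 n (v j) := by
  ext m
  rw [componentProj_apply, lp.single_apply, lp.single_apply]
  by_cases h : m = n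
  · subst h
    simp
  · simp [h]

theorem inner_eq_sum_componentProj {d : ℕ} (u w : LatticeL2 d) :
    inner ℂ u w = ∑ j, inner ℂ (componentProj d j u) (componentProj d j w) := by
  have h := hasSum_sum (s := Finset.univ) fun j _ =>
    lp.hasSum_inner (𝕜 := ℂ) (G := fun _ => ℂ) (componentProj d j u) (componentProj d j w)
  refine (lp.hasSum_inner u w).unique ?_
  convert h using 2 with n
  rw [PiLp.inner_apply]
  rfl

theorem adjoint_componentProj_apply {d : ℕ} (i : Fin d) (x : ScalarL2 d) (m : Fin d → ℤ) :
    (componentProj d i).adjoint x m = EuclideanSpace.single i (x m) := by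
  refine ext_inner_left ℂ fun w => ?_
  refine (lp.inner_single_left (𝕜 := ℂ) (G := fun _ : Fin d → ℤ => EuclideanSpace ℂ (Fin d)) m w
    ((componentProj d i).adjoint x)).symm.trans ?_
  rw [ContinuousLinearMap.adjoint_inner_right, componentProj_single,
    lp.inner_single_left, EuclideanSpace.inner_single_right]
  simp

theorem componentProj_adjoint {d : ℕ} (i j : Fin d) (x : ScalarL2 d) :
    componentProj d i ((componentProj d j).adjoint x) = if i = j then x else 0 := by
  ext m
  rw [componentProj_apply, adjoint_componentProj_apply]
  by_cases h : i = j
  · simp [h]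
  · simp [h]

/-- The operator of multiplication by an entry of the symbol. -/
def symbolMul {d : ℕ} (hd : 2 ≤ d) (i j : Fin d) :
    Lp ℂ 2 (cubeMeasure d) →L[ℂ] Lp ℂ 2 (cubeMeasure d) :=
  (ContinuousLinearMap.mul ℂ ℂ).holderL (cubeMeasure d) ⊤ 2 2
    ((memLp_realSymbol hd ⊤ i j).toLp _)

theorem coeFn_symbolMul {d : ℕ} (hd : 2 ≤ d) (i j : Fin d) (f : Lp ℂ 2 (cubeMeasure d)) :
    symbolMul hd i j f =ᵐ[cubeMeasure d] fun τ => (realSymbol τ i j : ℂ) * f τ := by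
  have h := (ContinuousLinearMap.mul ℂ ℂ).coeFn_holder (r := 2)
    ((memLp_realSymbol hd ⊤ i j).toLp _) f
  filter_upwards [h, (memLp_realSymbol hd ⊤ i j).coeFn_toLp] with τ h1 h2
  refine h1.trans ?_
  rw [h2]
  rfl

/-- The scalar Toeplitz operators whose symbols are the entries of `realSymbol`. -/
def scalarToeplitz {d : ℕ} (hd : 2 ≤ d) (i j : Fin d) : ScalarL2 d →L[ℂ] ScalarL2 d :=
  ((cubeBasis d).repr.toContinuousLinearEquiv : Lp ℂ 2 (cubeMeasure d) →L[ℂ] ScalarL2 d) ∘L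
    symbolMul hd i j ∘L
      ((cubeBasis d).repr.symm.toContinuousLinearEquiv : ScalarL2 d →L[ℂ] Lp ℂ 2 (cubeMeasure d))

theorem scalarToeplitz_apply {d : ℕ} (hd : 2 ≤ d) (i j : Fin d) (x : ScalarL2 d) :
    scalarToeplitz hd i j x =
      (cubeBasis d).repr (symbolMul hd i j ((cubeBasis d).repr.symm x)) := rfl

theorem toeplitzBlock_sub {d : ℕ} (m n : Fin d → ℤ) :
    toeplitzBlock d (m - n) 0 = toeplitzBlock d m n := by
  simp only [toeplitzBlock, sub_eq_zero, sub_zero]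

/-- On a delta sequence the operator returns Fourier coefficients of the symbol, shifted by `n`. -/
theorem scalarToeplitz_single {d : ℕ} (hd : 2 ≤ d) (i j : Fin d) (m n : Fin d → ℤ) (c : ℂ) :
    scalarToeplitz hd i j (lp.single 2 n c) m = toeplitzBlock d m n i j * c := by
  have h1 : (cubeBasis d).repr.symm (lp.single 2 n c) = c • cubeBasis d n := by
    rw [← (cubeBasis d).repr_symm_single, ← map_smul, ← lp.single_smul, smul_eq_mul, mul_one]
  rw [scalarToeplitz_apply, h1, map_smul, map_smul, lp.coeFn_smul, Pi.smul_apply, smul_eq_mul,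
    mul_comm, HilbertBasis.repr_apply_apply, L2.inner_def, ← toeplitzBlock_sub,
    ← integral_conj_mul_realSymbol hd]
  congr 1
  refine integral_congr_ae ?_
  rw [coe_cubeBasis, coe_cubeBasis]
  filter_upwards [coeFn_symbolMul hd i j ((memLp_latticeChar n).toLp _),
    (memLp_latticeChar n).coeFn_toLp, (memLp_latticeChar m).coeFn_toLp] with τ h1 h2 h3
  rw [h1, h2, h3, RCLike.inner_apply, ← latticeChar_mul_conj]
  ring

/-- The block Toeplitz operator. -/
def toeplitzOperator {d : ℕ} (hd : 2 ≤ d) : LatticeL2 d →L[ℂ] LatticeL2 d :=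
  ∑ i, ∑ j, (componentProj d i).adjoint ∘L scalarToeplitz hd i j ∘L componentProj d j

theorem componentProj_toeplitzOperator {d : ℕ} (hd : 2 ≤ d) (i : Fin d) (u : LatticeL2 d) :
    componentProj d i (toeplitzOperator hd u) =
      ∑ j, scalarToeplitz hd i j (componentProj d j u) := by
  simp only [toeplitzOperator, sum_apply, ContinuousLinearMap.comp_apply,
    map_sum, componentProj_adjoint]
  rw [Finset.sum_comm]
  simp

theorem toeplitzOperator_single {d : ℕ} (hd : 2 ≤ d) (m n : Fin d → ℤ)
    (v : EuclideanSpace ℂ (Fin d)) :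
    toeplitzOperator hd (lp.single 2 n v) m =
      Matrix.toEuclideanLin (toeplitzBlock d m n) v := by
  ext i
  rw [← componentProj_apply, componentProj_toeplitzOperator, lp.coeFn_sum, Finset.sum_apply]
  simp only [componentProj_single, scalarToeplitz_single]
  rfl

/-- Every sequence is a norm-convergent sum of delta sequences. Boundedness of the operator and of
evaluation at `m` then yields the series, although the blocks are not absolutely summable. -/
theorem isToeplitzOperator_toeplitzOperator {d : ℕ} (hd : 2 ≤ d) :
    IsToeplitzOperator d (toeplitzOperator hd) := by
  intro u m
  have h1 := (lp.hasSum_single (by norm_num) u).mapL (toeplitzOperator hd)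
  have h2 := h1.mapL (lp.evalCLM ℂ (fun _ : Fin d → ℤ => EuclideanSpace ℂ (Fin d)) 2 m)
  refine h2.congr_fun fun n => ?_
  exact (toeplitzOperator_single hd m n (u n)).symm

/-- The symbol as an operator on `ℂ^d`. -/
def symbolOperator {d : ℕ} (τ : Fin d → ℝ) :
    EuclideanSpace ℂ (Fin d) →L[ℂ] EuclideanSpace ℂ (Fin d) :=
  Matrix.toEuclideanCLM (𝕜 := ℂ) ((realSymbol τ).map Complex.ofReal)

theorem symbolOperator_apply {d : ℕ} (τ : Fin d → ℝ) (v : EuclideanSpace ℂ (Fin d)) (i : Fin d) :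
    symbolOperator τ v i = ∑ j, (realSymbol τ i j : ℂ) * v j := rfl

/-- The Fourier transform of a vector-valued sequence. -/
def fourierVec {d : ℕ} (u : LatticeL2 d) (τ : Fin d → ℝ) : EuclideanSpace ℂ (Fin d) :=
  WithLp.toLp 2 fun j => (cubeBasis d).repr.symm (componentProj d j u) τ

theorem inner_eq_integral_fourierVec {d : ℕ} (u w : LatticeL2 d) :
    Integrable (fun τ => inner ℂ (fourierVec u τ) (fourierVec w τ)) (cubeMeasure d) ∧
      inner ℂ u w = ∫ τ, inner ℂ (fourierVec u τ) (fourierVec w τ) ∂(cubeMeasure d) := by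
  have hi : ∀ j, Integrable (fun τ => inner ℂ ((cubeBasis d).repr.symm (componentProj d j u) τ)
      ((cubeBasis d).repr.symm (componentProj d j w) τ)) (cubeMeasure d) :=
    fun j => L2.integrable_inner _ _
  have e : ∀ τ, inner ℂ (fourierVec u τ) (fourierVec w τ) = ∑ j,
      inner ℂ ((cubeBasis d).repr.symm (componentProj d j u) τ)
      ((cubeBasis d).repr.symm (componentProj d j w) τ) := by
    intro τ
    simp only [PiLp.inner_apply, fourierVec]
  simp only [e]
  refine ⟨integrable_finsetSum _ fun j _ => hi j, ?_⟩
  rw [integral_finsetSum _ fun j _ => hi j, inner_eq_sum_componentProj]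
  refine Finset.sum_congr rfl fun j _ => ?_
  rw [← L2.inner_def, LinearIsometryEquiv.inner_map_map]

theorem fourierVec_toeplitzOperator {d : ℕ} (hd : 2 ≤ d) (u : LatticeL2 d) :
    ∀ᵐ τ ∂(cubeMeasure d), fourierVec (toeplitzOperator hd u) τ =
      symbolOperator τ (fourierVec u τ) := by
  have h1 : ∀ i, (cubeBasis d).repr.symm (componentProj d i (toeplitzOperator hd u)) =
      ∑ j, symbolMul hd i j ((cubeBasis d).repr.symm (componentProj d j u)) := by
    intro i
    rw [componentProj_toeplitzOperator, map_sum]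
    simp only [scalarToeplitz_apply, LinearIsometryEquiv.symm_apply_apply]
  have h2 : ∀ᵐ τ ∂(cubeMeasure d), ∀ i,
      (∑ j, symbolMul hd i j ((cubeBasis d).repr.symm (componentProj d j u)) :
        Lp ℂ 2 (cubeMeasure d)) τ =
      ∑ j, symbolMul hd i j ((cubeBasis d).repr.symm (componentProj d j u)) τ := by
    rw [ae_all_iff]
    intro i
    filter_upwards [Lp.coeFn_finsetSum Finset.univ fun j =>
      symbolMul hd i j ((cubeBasis d).repr.symm (componentProj d j u))] with τ h
    rw [h, Finset.sum_apply]
  have h3 : ∀ᵐ τ ∂(cubeMeasure d), ∀ i j,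
      symbolMul hd i j ((cubeBasis d).repr.symm (componentProj d j u)) τ =
        (realSymbol τ i j : ℂ) * (cubeBasis d).repr.symm (componentProj d j u) τ :=
    ae_all_iff.mpr fun i => ae_all_iff.mpr fun j => coeFn_symbolMul hd i j _
  filter_upwards [h2, h3] with τ h2 h3
  ext i
  rw [symbolOperator_apply]
  simp only [fourierVec, h1, h2, h3]

/-- The quadratic form of the Toeplitz operator on the Fourier side. -/
theorem inner_toeplitzOperator {d : ℕ} (hd : 2 ≤ d) (u : LatticeL2 d) :
    Integrable (fun τ => inner ℂ (fourierVec u τ) (symbolOperator τ (fourierVec u τ)))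
        (cubeMeasure d) ∧
      inner ℂ u (toeplitzOperator hd u) =
        ∫ τ, inner ℂ (fourierVec u τ) (symbolOperator τ (fourierVec u τ)) ∂(cubeMeasure d) := by
  have h := inner_eq_integral_fourierVec u (toeplitzOperator hd u)
  have e : (fun τ => inner ℂ (fourierVec u τ) (fourierVec (toeplitzOperator hd u) τ))
      =ᵐ[cubeMeasure d]
      fun τ => inner ℂ (fourierVec u τ) (symbolOperator τ (fourierVec u τ)) := by
    filter_upwards [fourierVec_toeplitzOperator hd u] with τ hτ
    rw [hτ]
  exact ⟨h.1.congr e, h.2.trans (integral_congr_ae e)⟩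

theorem inner_fourierVec_self {d : ℕ} (u : LatticeL2 d) :
    Integrable (fun τ => ‖fourierVec u τ‖ ^ 2) (cubeMeasure d) ∧
      ‖u‖ ^ 2 = ∫ τ, ‖fourierVec u τ‖ ^ 2 ∂(cubeMeasure d) := by
  have h := inner_eq_integral_fourierVec u u
  have e : ∀ τ, inner ℂ (fourierVec u τ) (fourierVec u τ) = ((‖fourierVec u τ‖ ^ 2 : ℝ) : ℂ) := by
    intro τ
    rw [inner_self_eq_norm_sq_to_K]
    push_cast
    rfl
  have e' : inner ℂ u u = ((‖u‖ ^ 2 : ℝ) : ℂ) := by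
    rw [inner_self_eq_norm_sq_to_K]
    push_cast
    rfl
  simp only [e] at h
  refine ⟨?_, ?_⟩
  · exact h.1.re
  · have h2 := h.2
    rw [e', integral_complex_ofReal] at h2
    exact_mod_cast h2

theorem ae_ne_zero {d : ℕ} (hd : 2 ≤ d) : ∀ᵐ τ ∂(cubeMeasure d), τ ≠ 0 := by
  have hne : Nonempty (Fin d) := ⟨⟨0, by omega⟩⟩
  refine Measure.ae_smul_measure (ae_restrict_of_ae ?_) _
  simp [ae_iff]

theorem isSelfAdjoint_symbolOperator {d : ℕ} (τ : Fin d → ℝ) :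
    IsSelfAdjoint (symbolOperator τ) := by
  have h : IsSelfAdjoint ((realSymbol τ).map Complex.ofReal) := by
    ext i j
    have h1 := congrFun (congrFun (realSymbol_isSymm τ) i) j
    rw [Matrix.transpose_apply] at h1
    simp [Matrix.star_apply, h1]
  exact h.map (Matrix.toEuclideanCLM (𝕜 := ℂ))

/-- Bounds for the symbol are bounds for the quadratic form of the Toeplitz operator. -/
theorem inner_toeplitzOperator_mem {d : ℕ} (hd : 2 ≤ d) {a b : ℝ}
    (h : ∀ τ ∈ periodCube d, τ ≠ 0 → ∀ v : EuclideanSpace ℂ (Fin d),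
      a * ‖v‖ ^ 2 ≤ (inner ℂ v (symbolOperator τ v)).re ∧
      (inner ℂ v (symbolOperator τ v)).re ≤ b * ‖v‖ ^ 2) (u : LatticeL2 d) :
    ∃ q : ℝ, inner ℂ u (toeplitzOperator hd u) = q ∧ a * ‖u‖ ^ 2 ≤ q ∧ q ≤ b * ‖u‖ ^ 2 := by
  obtain ⟨hi, he⟩ := inner_toeplitzOperator hd u
  obtain ⟨hn, hne⟩ := inner_fourierVec_self u
  -- The symbol is self-adjoint, so its quadratic form is real and can be compared pointwise with
  -- the bounds.
  have hre : ∀ τ, inner ℂ (fourierVec u τ) (symbolOperator τ (fourierVec u τ)) =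
      ((inner ℂ (fourierVec u τ) (symbolOperator τ (fourierVec u τ))).re : ℂ) := by
    intro τ
    refine (Complex.conj_eq_iff_re.mp ?_).symm
    rw [inner_conj_symm]
    exact (ContinuousLinearMap.isSelfAdjoint_iff_isSymmetric.mp
      (isSelfAdjoint_symbolOperator τ)) _ _
  have hi' : Integrable (fun τ => (inner ℂ (fourierVec u τ)
      (symbolOperator τ (fourierVec u τ))).re) (cubeMeasure d) := hi.re
  refine ⟨∫ τ, (inner ℂ (fourierVec u τ) (symbolOperator τ (fourierVec u τ))).re
    ∂(cubeMeasure d), ?_, ?_, ?_⟩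
  · rw [he, ← integral_complex_ofReal]
    exact integral_congr_ae (Eventually.of_forall hre)
  · rw [hne, ← integral_const_mul]
    refine integral_mono_ae (hn.const_mul _) hi' ?_
    filter_upwards [ae_mem_periodCube d, ae_ne_zero hd] with τ h1 h2 using (h τ h1 h2 _).1
  · rw [hne, ← integral_const_mul]
    refine integral_mono_ae hi' (hn.const_mul _) ?_
    filter_upwards [ae_mem_periodCube d, ae_ne_zero hd] with τ h1 h2 using (h τ h1 h2 _).2

/-! ### Spectrum, numerical range and resolvent in finite dimension. -/

section FiniteDimensional

variable {H : Type*} [NormedAddCommGroup H] [InnerProductSpace ℂ H]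

theorem mem_resolventSet_of_lower_bound [FiniteDimensional ℂ H] (A : H →L[ℂ] H) {z : ℂ} {δ : ℝ}
    (hδ : 0 < δ) (h : ∀ u, δ * ‖u‖ ≤ ‖z • u - A u‖) :
    z ∈ resolventSet ℂ A ∧ ‖resolvent A z‖ ≤ δ⁻¹ := by
  have happ : ∀ u, (algebraMap ℂ (H →L[ℂ] H) z - A) u = z • u - A u := fun u => rfl
  have hinj : Function.Injective (algebraMap ℂ (H →L[ℂ] H) z - A) := by
    refine (injective_iff_map_eq_zero _).mpr fun u hu => ?_
    have h1 := h u
    rw [← happ, hu, norm_zero] at h1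
    have : ‖u‖ ≤ 0 := by nlinarith [norm_nonneg u]
    exact norm_le_zero_iff.mp this
  have hunit : IsUnit (algebraMap ℂ (H →L[ℂ] H) z - A) := by
    have : CompleteSpace H := FiniteDimensional.complete ℂ H
    rw [ContinuousLinearMap.isUnit_iff_bijective]
    exact ⟨hinj, (LinearMap.injective_iff_surjective (f := ((algebraMap ℂ (H →L[ℂ] H) z - A :
      H →L[ℂ] H) : H →ₗ[ℂ] H))).mp hinj⟩
  refine ⟨hunit, ContinuousLinearMap.opNorm_le_bound _ (inv_nonneg.mpr hδ.le) fun v => ?_⟩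
  have h2 : (algebraMap ℂ (H →L[ℂ] H) z - A) (resolvent A z v) = v := by
    have := Ring.mul_inverse_cancel _ hunit
    exact congrArg (fun B : H →L[ℂ] H => B v) this
  have h3 := h (resolvent A z v)
  rw [← happ, h2] at h3
  rwa [inv_mul_eq_div, le_div_iff₀ hδ, mul_comm]

theorem mem_spectrum_iff_exists_unit [FiniteDimensional ℂ H] (A : H →L[ℂ] H) (z : ℂ) :
    z ∈ spectrum ℂ A ↔ ∃ u : H, ‖u‖ = 1 ∧ A u = z • u := by
  have happ : ∀ u, (algebraMap ℂ (H →L[ℂ] H) z - A) u = z • u - A u := fun u => rfl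
  have : CompleteSpace H := FiniteDimensional.complete ℂ H
  rw [spectrum.mem_iff, ContinuousLinearMap.isUnit_iff_bijective]
  constructor
  · intro h
    have hinj : ¬ Function.Injective (algebraMap ℂ (H →L[ℂ] H) z - A) := fun hinj =>
      h ⟨hinj, (LinearMap.injective_iff_surjective (f := ((algebraMap ℂ (H →L[ℂ] H) z - A :
        H →L[ℂ] H) : H →ₗ[ℂ] H))).mp hinj⟩
    rw [injective_iff_map_eq_zero] at hinj
    push Not at hinj
    obtain ⟨u, hu, hu0⟩ := hinj
    have hn : ‖u‖ ≠ 0 := norm_ne_zero_iff.mpr hu0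
    refine ⟨((‖u‖⁻¹ : ℝ) : ℂ) • u, ?_, ?_⟩
    · rw [norm_smul, Complex.norm_real, norm_inv, norm_norm, inv_mul_cancel₀ hn]
    · rw [happ, sub_eq_zero] at hu
      rw [map_smul, ← hu, smul_comm]
  · rintro ⟨u, hu, hAu⟩ hb
    have h1 : (algebraMap ℂ (H →L[ℂ] H) z - A) u = 0 := by rw [happ, hAu, sub_self]
    have h2 := (injective_iff_map_eq_zero _).mp hb.1 u h1
    rw [h2, norm_zero] at hu
    exact zero_ne_one hu

theorem spectrum_subset_numericalRange [FiniteDimensional ℂ H] (A : H →L[ℂ] H) :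
    spectrum ℂ A ⊆ numericalRange A := by
  intro z hz
  obtain ⟨u, hu, hAu⟩ := (mem_spectrum_iff_exists_unit A z).mp hz
  refine ⟨u, hu, ?_⟩
  rw [hAu, inner_smul_right, inner_self_eq_norm_sq_to_K, hu]
  simp

variable [CompleteSpace H]

/-- The top eigenvalue is the supremum of the Rayleigh quotient, attained in finite dimension. -/
theorem exists_isGreatest_realSpectrum [FiniteDimensional ℂ H] [Nontrivial H] {A : H →L[ℂ] H}
    (hA : IsSelfAdjoint A) :
    ∃ μ : ℝ, IsGreatest (realSpectrum A) μ ∧ (∀ u, (inner ℂ u (A u)).re ≤ μ * ‖u‖ ^ 2) ∧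
      ∃ u, ‖u‖ = 1 ∧ A u = (μ : ℂ) • u := by
  have hS := ContinuousLinearMap.isSelfAdjoint_iff_isSymmetric.mp hA
  have hev := hS.hasEigenvalue_iSup_of_finiteDimensional
  set f : { x : H // x ≠ 0 } → ℝ := fun x =>
    RCLike.re (inner ℂ ((A : H →ₗ[ℂ] H) x) (x : H)) / ‖(x : H)‖ ^ 2 with hf
  have hfx : ∀ x, f x = (inner ℂ (x : H) (A x)).re / ‖(x : H)‖ ^ 2 := by
    intro x
    rw [hf]
    simp only
    congr 1
    exact inner_re_symm (𝕜 := ℂ) _ _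
  -- Boundedness makes the real-valued supremum a genuine one and not a default value.
  have hbdd : BddAbove (Set.range f) := by
    refine ⟨‖A‖, ?_⟩
    rintro _ ⟨x, rfl⟩
    have hx : 0 < ‖(x : H)‖ := norm_pos_iff.mpr x.2
    rw [hfx, div_le_iff₀ (by positivity)]
    calc _ ≤ ‖inner ℂ (x : H) (A x)‖ := Complex.re_le_norm _
      _ ≤ ‖(x : H)‖ * (‖A‖ * ‖(x : H)‖) :=
        (norm_inner_le_norm _ _).trans (by gcongr; exact A.le_opNorm _)
      _ = _ := by ring
  have hle : ∀ u, (inner ℂ u (A u)).re ≤ (⨆ x, f x) * ‖u‖ ^ 2 := by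
    intro u
    by_cases hu : u = 0
    · simp [hu]
    · have hx : 0 < ‖u‖ := norm_pos_iff.mpr hu
      have := le_ciSup hbdd ⟨u, hu⟩
      rwa [hfx, div_le_iff₀ (by positivity)] at this
  obtain ⟨u, hu⟩ := hev.exists_hasEigenvector
  have hu0 : ‖u‖ ≠ 0 := norm_ne_zero_iff.mpr hu.2
  have hAu : A u = ((⨆ x, f x : ℝ) : ℂ) • u := hu.apply_eq_smul
  have hex : ∃ u, ‖u‖ = 1 ∧ A u = ((⨆ x, f x : ℝ) : ℂ) • u := by
    refine ⟨((‖u‖⁻¹ : ℝ) : ℂ) • u, ?_, ?_⟩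
    · rw [norm_smul, Complex.norm_real, norm_inv, norm_norm, inv_mul_cancel₀ hu0]
    · rw [map_smul, hAu, smul_comm]
  refine ⟨⨆ x, f x, ⟨(mem_spectrum_iff_exists_unit A _).mpr hex, fun x hx => ?_⟩, hle, hex⟩
  obtain ⟨v, hv, hAv⟩ := (mem_spectrum_iff_exists_unit A _).mp hx
  have := hle v
  rw [hAv, inner_smul_right, inner_self_eq_norm_sq_to_K, hv] at this
  simpa using this

theorem realSpectrum_neg {R : Type*} [Ring R] [Algebra ℂ R] (A : R) (x : ℝ) :
    x ∈ realSpectrum (-A) ↔ -x ∈ realSpectrum A := by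
  change (x : ℂ) ∈ spectrum ℂ (-A) ↔ ((-x : ℝ) : ℂ) ∈ spectrum ℂ A
  rw [← spectrum.neg_eq, Set.mem_neg, Complex.ofReal_neg]

theorem exists_isLeast_realSpectrum [FiniteDimensional ℂ H] [Nontrivial H] {A : H →L[ℂ] H}
    (hA : IsSelfAdjoint A) :
    ∃ μ : ℝ, IsLeast (realSpectrum A) μ ∧ (∀ u, μ * ‖u‖ ^ 2 ≤ (inner ℂ u (A u)).re) ∧
      ∃ u, ‖u‖ = 1 ∧ A u = (μ : ℂ) • u := by
  obtain ⟨μ, h1, h2, u, hu, hAu⟩ := exists_isGreatest_realSpectrum hA.neg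
  refine ⟨-μ, ⟨(realSpectrum_neg A μ).mp h1.1, fun x hx => ?_⟩, fun v => ?_, u, hu, ?_⟩
  · have h3 := h1.2 ((realSpectrum_neg A (-x)).mpr (by rwa [neg_neg]))
    linarith
  · have h3 := h2 v
    rw [_root_.neg_apply, inner_neg_right, Complex.neg_re] at h3
    linarith
  · rw [_root_.neg_apply] at hAu
    rw [Complex.ofReal_neg, neg_smul, ← hAu, neg_neg]

/-- The largest eigenvalue depends on the operator in a Lipschitz way. -/
theorem sSup_realSpectrum_le_add [FiniteDimensional ℂ H] [Nontrivial H] {A B : H →L[ℂ] H}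
    (hA : IsSelfAdjoint A) (hB : IsSelfAdjoint B) :
    sSup (realSpectrum A) ≤ sSup (realSpectrum B) + ‖A - B‖ := by
  obtain ⟨a, ha, -, u, hu, hAu⟩ := exists_isGreatest_realSpectrum hA
  obtain ⟨b, hb, hle, -⟩ := exists_isGreatest_realSpectrum hB
  rw [ha.csSup_eq, hb.csSup_eq]
  -- A unit eigenvector for the top eigenvalue of `A` serves as a test vector for `B`.
  have h1 : (inner ℂ u (A u)).re = a := by
    rw [hAu, inner_smul_right, inner_self_eq_norm_sq_to_K, hu]
    simp
  have h2 : (inner ℂ u (A u)).re = (inner ℂ u (B u)).re + (inner ℂ u ((A - B) u)).re := by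
    rw [← Complex.add_re, ← inner_add_right, _root_.sub_apply, add_sub_cancel]
  have h3 : (inner ℂ u ((A - B) u)).re ≤ ‖A - B‖ := by
    refine (Complex.re_le_norm _).trans ((norm_inner_le_norm _ _).trans ?_)
    rw [hu, one_mul]
    simpa [hu] using (A - B).le_opNorm u
  have h4 := hle u
  rw [hu] at h4
  linarith

theorem continuousOn_sSup_realSpectrum [FiniteDimensional ℂ H] [Nontrivial H] {X : Type*}
    [TopologicalSpace X] {s : Set X} {A : X → H →L[ℂ] H} (hA : ContinuousOn A s)
    (hsa : ∀ x, IsSelfAdjoint (A x)) : ContinuousOn (fun x => sSup (realSpectrum (A x))) s := by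
  intro x hx
  have hnorm : Tendsto (fun y => ‖A y - A x‖) (𝓝[s] x) (𝓝 0) :=
    tendsto_iff_norm_sub_tendsto_zero.mp (hA x hx)
  refine tendsto_iff_norm_sub_tendsto_zero.mpr
    (squeeze_zero (fun _ => norm_nonneg _) (fun y => ?_) hnorm)
  have h1 := sSup_realSpectrum_le_add (hsa y) (hsa x)
  have h2 := sSup_realSpectrum_le_add (hsa x) (hsa y)
  rw [norm_sub_rev] at h2
  rw [Real.norm_eq_abs, abs_le]
  exact ⟨by linarith, by linarith⟩

end FiniteDimensional

/-! ### The range of the eigenvalues of the symbol. -/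

theorem realSpectrum_symbolOperator {d : ℕ} (τ : Fin d → ℝ) :
    realSpectrum (symbolOperator τ) = realSpectrum ((realSymbol τ).map Complex.ofReal) := by
  have h : spectrum ℂ (symbolOperator τ) = spectrum ℂ ((realSymbol τ).map Complex.ofReal) :=
    AlgEquiv.spectrum_eq (Matrix.toEuclideanCLM (𝕜 := ℂ) (n := Fin d)) _
  simp only [realSpectrum, h]

theorem spectrum_symbolOperator {d : ℕ} (τ : Fin d → ℝ) :
    spectrum ℂ (symbolOperator τ) = spectrum ℂ ((realSymbol τ).map Complex.ofReal) :=
  AlgEquiv.spectrum_eq (Matrix.toEuclideanCLM (𝕜 := ℂ) (n := Fin d)) _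

theorem continuousOn_symbolOperator {d : ℕ} (hd : 2 ≤ d) :
    ContinuousOn (fun τ : Fin d → ℝ => symbolOperator τ) (periodCube d \ {0}) := by
  have h1 : Continuous (fun A : Matrix (Fin d) (Fin d) ℂ =>
      Matrix.toEuclideanCLM (𝕜 := ℂ) A) :=
    LinearMap.continuous_of_finiteDimensional
      (Matrix.toEuclideanCLM (𝕜 := ℂ) (n := Fin d)).toAlgEquiv.toLinearMap
  exact h1.comp_continuousOn (isSymbol_realSymbol hd).1

theorem symbolOperator_cubeCorner {d : ℕ} (hd : 2 ≤ d) : symbolOperator (cubeCorner d) = 0 := by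
  have h : (realSymbol (cubeCorner d)).map Complex.ofReal = 0 := by
    rw [realSymbol_cubeCorner hd]
    ext i j
    simp
  rw [symbolOperator, h, map_zero]

theorem symbolOperator_neg {d : ℕ} (τ : Fin d → ℝ) : symbolOperator (-τ) = symbolOperator τ := by
  rw [symbolOperator, realSymbol_neg, symbolOperator]

theorem neg_mem_periodCube {d : ℕ} {τ : Fin d → ℝ} (hτ : τ ∈ periodCube d) :
    -τ ∈ periodCube d := by
  rw [mem_periodCube_iff] at hτ ⊢
  simpa using hτ

/-- Up to a reflection, a segment joins a point of `Q \ {0}` to the corner within `Q \ {0}`. -/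
theorem exists_segment_subset {d : ℕ} {τ : Fin d → ℝ} (hτ : τ ∈ periodCube d) (h0 : τ ≠ 0) :
    ∃ τ' ∈ periodCube d, τ' ≠ 0 ∧ (τ' = τ ∨ τ' = -τ) ∧
      segment ℝ τ' (cubeCorner d) ⊆ periodCube d \ {0} := by
  have hconv : Convex ℝ (periodCube d) := convex_Icc _ _
  obtain ⟨i, hi⟩ := Function.ne_iff.mp h0
  -- A coordinate that is positive at `τ'` and equals `π` at the corner stays positive along the
  -- segment, which therefore misses the origin.
  have key : ∀ τ' ∈ periodCube d, 0 < τ' i →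
      segment ℝ τ' (cubeCorner d) ⊆ periodCube d \ {0} := by
    intro τ' hτ' hpos x hx
    refine ⟨hconv.segment_subset hτ' (cubeCorner_mem d) hx, ?_⟩
    rintro rfl
    obtain ⟨a, b, ha, hb, hab, h⟩ := hx
    have h1 : a * τ' i + b * Real.pi = 0 := congrFun h i
    have hpi := Real.pi_pos
    rcases ha.eq_or_lt with h2 | h2
    · have : b = 1 := by linarith
      rw [← h2, this] at h1
      linarith
    · nlinarith [mul_pos h2 hpos, mul_nonneg hb hpi.le]
  rcases lt_or_gt_of_ne hi with h | h
  · have h' : τ i < 0 := h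
    exact ⟨-τ, neg_mem_periodCube hτ, neg_ne_zero.mpr h0, Or.inr rfl,
      key _ (neg_mem_periodCube hτ) (by simpa using h')⟩
  · exact ⟨τ, hτ, h0, Or.inl rfl, key _ hτ h⟩

/-- Every number between `0` and an eigenvalue of the symbol is an eigenvalue of the symbol, for
the largest eigenvalue of a continuous self-adjoint family that vanishes in the corner. -/
theorem exists_sSup_realSpectrum_eq {d : ℕ} (hd : 2 ≤ d)
    {A : (Fin d → ℝ) → EuclideanSpace ℂ (Fin d) →L[ℂ] EuclideanSpace ℂ (Fin d)}
    (hA : ContinuousOn A (periodCube d \ {0})) (hsa : ∀ τ, IsSelfAdjoint (A τ))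
    (hcorner : A (cubeCorner d) = 0) (heven : ∀ τ, A (-τ) = A τ) {τ : Fin d → ℝ}
    (hτ : τ ∈ periodCube d) (h0 : τ ≠ 0) {x : ℝ} (hx0 : 0 ≤ x)
    (hx : x ≤ sSup (realSpectrum (A τ))) :
    ∃ τ' ∈ periodCube d, τ' ≠ 0 ∧ ∃ v, ‖v‖ = 1 ∧ A τ' v = (x : ℂ) • v := by
  have hne : Nonempty (Fin d) := ⟨⟨0, by omega⟩⟩
  obtain ⟨τ₁, -, -, h2, hseg⟩ := exists_segment_subset hτ h0
  have h3 : A τ₁ = A τ := by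
    rcases h2 with rfl | rfl
    · rfl
    · exact heven τ
  have hcont := (continuousOn_sSup_realSpectrum hA hsa).mono hseg
  have hpre : IsPreconnected (segment ℝ τ₁ (cubeCorner d)) :=
    (convex_segment _ _).isPreconnected
  have hzero : sSup (realSpectrum (A (cubeCorner d))) = 0 := by
    rw [hcorner]
    have hz : realSpectrum (0 : EuclideanSpace ℂ (Fin d) →L[ℂ] EuclideanSpace ℂ (Fin d)) = {0} := by
      ext y
      simp [realSpectrum]
    rw [hz, csSup_singleton]
  -- The top eigenvalue is continuous along the segment and runs from `0` at the corner to its value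
  -- at `τ`.
  have himg := hpre.intermediate_value (right_mem_segment ℝ _ _) (left_mem_segment ℝ _ _) hcont
  rw [hzero, h3] at himg
  obtain ⟨τ', hτ', he⟩ := himg ⟨hx0, hx⟩
  obtain ⟨μ, hμ, -, v, hv, hAv⟩ := exists_isGreatest_realSpectrum (hsa τ')
  refine ⟨τ', (hseg hτ').1, (hseg hτ').2, v, hv, ?_⟩
  simp only [hμ.csSup_eq] at he
  rwa [← he]

theorem isSelfAdjoint_neg {H : Type*} [NormedAddCommGroup H] [InnerProductSpace ℂ H]
    [CompleteSpace H] {A : H →L[ℂ] H} (hA : IsSelfAdjoint A) : IsSelfAdjoint (-A) :=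
  hA.neg

/-- The supremum `Λ₊` of the eigenvalues of the symbol. -/
def symbolMax (d : ℕ) : ℝ :=
  sSup {x : ℝ | ∃ τ ∈ periodCube d, τ ≠ 0 ∧ IsGreatest (realSpectrum (symbolOperator τ)) x}

/-- The infimum `Λ₋` of the eigenvalues of the symbol. -/
def symbolMin (d : ℕ) : ℝ :=
  sInf {x : ℝ | ∃ τ ∈ periodCube d, τ ≠ 0 ∧ IsLeast (realSpectrum (symbolOperator τ)) x}

/-- A crude entrywise estimate; it suffices to make `symbolMax` and `symbolMin` true extrema. -/
theorem exists_abs_le_of_mem_realSpectrum {d : ℕ} (hd : 2 ≤ d) :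
    ∃ C : ℝ, ∀ τ ∈ periodCube d, ∀ x ∈ realSpectrum (symbolOperator τ), |x| ≤ C := by
  obtain ⟨C, hC⟩ := exists_abs_realSymbol_le hd
  refine ⟨Real.sqrt (∑ _i : Fin d, (∑ _j : Fin d, C) ^ 2), fun τ hτ x hx => ?_⟩
  obtain ⟨v, hv, hF⟩ := (mem_spectrum_iff_exists_unit _ _).mp hx
  have h1 : ‖symbolOperator τ v‖ = |x| := by
    rw [hF, norm_smul, hv, mul_one, Complex.norm_real, Real.norm_eq_abs]
  rw [← h1, EuclideanSpace.norm_eq]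
  refine Real.sqrt_le_sqrt (Finset.sum_le_sum fun i _ => ?_)
  refine pow_le_pow_left₀ (norm_nonneg _) ?_ 2
  rw [symbolOperator_apply]
  refine (norm_sum_le _ _).trans (Finset.sum_le_sum fun j _ => ?_)
  rw [norm_mul, Complex.norm_real, Real.norm_eq_abs]
  have h2 : ‖v j‖ ≤ 1 := hv ▸ PiLp.norm_apply_le v j
  have h3 := hC τ hτ i j
  calc _ ≤ C * 1 := mul_le_mul h3 h2 (norm_nonneg _) ((abs_nonneg _).trans h3)
    _ = C := mul_one C

theorem exists_isGreatest_symbolOperator {d : ℕ} (hd : 2 ≤ d) (τ : Fin d → ℝ) :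
    ∃ μ : ℝ, IsGreatest (realSpectrum (symbolOperator τ)) μ ∧
      ∀ u, (inner ℂ u (symbolOperator τ u)).re ≤ μ * ‖u‖ ^ 2 := by
  have hne : Nonempty (Fin d) := ⟨⟨0, by omega⟩⟩
  obtain ⟨μ, h1, h2, -⟩ := exists_isGreatest_realSpectrum (isSelfAdjoint_symbolOperator τ)
  exact ⟨μ, h1, h2⟩

theorem exists_isLeast_symbolOperator {d : ℕ} (hd : 2 ≤ d) (τ : Fin d → ℝ) :
    ∃ μ : ℝ, IsLeast (realSpectrum (symbolOperator τ)) μ ∧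
      ∀ u, μ * ‖u‖ ^ 2 ≤ (inner ℂ u (symbolOperator τ u)).re := by
  have hne : Nonempty (Fin d) := ⟨⟨0, by omega⟩⟩
  obtain ⟨μ, h1, h2, -⟩ := exists_isLeast_realSpectrum (isSelfAdjoint_symbolOperator τ)
  exact ⟨μ, h1, h2⟩

theorem isLUB_symbolMax {d : ℕ} (hd : 2 ≤ d) :
    IsLUB {x : ℝ | ∃ τ ∈ periodCube d, τ ≠ 0 ∧ IsGreatest (realSpectrum (symbolOperator τ)) x}
      (symbolMax d) := by
  obtain ⟨C, hC⟩ := exists_abs_le_of_mem_realSpectrum hd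
  obtain ⟨μ, hμ, -⟩ := exists_isGreatest_symbolOperator hd (cubeCorner d)
  refine isLUB_csSup ⟨μ, _, cubeCorner_mem d, cubeCorner_ne_zero hd, hμ⟩ ⟨C, ?_⟩
  rintro x ⟨τ, hτ, -, hx⟩
  exact (abs_le.mp (hC τ hτ x hx.1)).2

theorem isGLB_symbolMin {d : ℕ} (hd : 2 ≤ d) :
    IsGLB {x : ℝ | ∃ τ ∈ periodCube d, τ ≠ 0 ∧ IsLeast (realSpectrum (symbolOperator τ)) x}
      (symbolMin d) := by
  obtain ⟨C, hC⟩ := exists_abs_le_of_mem_realSpectrum hd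
  obtain ⟨μ, hμ, -⟩ := exists_isLeast_symbolOperator hd (cubeCorner d)
  refine isGLB_csInf ⟨μ, _, cubeCorner_mem d, cubeCorner_ne_zero hd, hμ⟩ ⟨-C, ?_⟩
  rintro x ⟨τ, hτ, -, hx⟩
  exact (abs_le.mp (hC τ hτ x hx.1)).1

theorem symbolOperator_mem_bounds {d : ℕ} (hd : 2 ≤ d) {τ : Fin d → ℝ} (hτ : τ ∈ periodCube d)
    (h0 : τ ≠ 0) (v : EuclideanSpace ℂ (Fin d)) :
    symbolMin d * ‖v‖ ^ 2 ≤ (inner ℂ v (symbolOperator τ v)).re ∧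
      (inner ℂ v (symbolOperator τ v)).re ≤ symbolMax d * ‖v‖ ^ 2 := by
  obtain ⟨a, ha, ha'⟩ := exists_isLeast_symbolOperator hd τ
  obtain ⟨b, hb, hb'⟩ := exists_isGreatest_symbolOperator hd τ
  have h1 : symbolMin d ≤ a := (isGLB_symbolMin hd).1 ⟨τ, hτ, h0, ha⟩
  have h2 : b ≤ symbolMax d := (isLUB_symbolMax hd).1 ⟨τ, hτ, h0, hb⟩
  exact ⟨le_trans (by gcongr) (ha' v), (hb' v).trans (by gcongr)⟩

theorem inner_single_symbolOperator {d : ℕ} (τ : Fin d → ℝ) (k : Fin d) :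
    (inner ℂ (EuclideanSpace.single k (1 : ℂ))
      (symbolOperator τ (EuclideanSpace.single k (1 : ℂ)))).re = realSymbol τ k k := by
  rw [EuclideanSpace.inner_single_left, symbolOperator_apply]
  simp

theorem realSymbol_diag_mem {d : ℕ} (hd : 2 ≤ d) {τ : Fin d → ℝ} (hτ : τ ∈ periodCube d)
    (h0 : τ ≠ 0) (k : Fin d) :
    symbolMin d ≤ realSymbol τ k k ∧ realSymbol τ k k ≤ symbolMax d := by
  have h := symbolOperator_mem_bounds hd hτ h0 (EuclideanSpace.single k (1 : ℂ))
  rw [inner_single_symbolOperator] at h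
  simpa using h

/-- A diagonal entry is the quadratic form at a basis vector, hence at most `Λ₊`; the bound passes
to the limit along the axis. -/
theorem le_symbolMax {d : ℕ} (hd : 2 ≤ d) : 1 - 1 / (d : ℝ) ≤ symbolMax d := by
  let l : Fin d := ⟨0, by omega⟩
  refine le_of_tendsto (tendsto_realSymbol_single_self hd l) ?_
  filter_upwards [(tendsto_single_nhdsWithin l).eventually self_mem_nhdsWithin] with t ht
  exact (realSymbol_diag_mem hd ht.1 ht.2 l).2

theorem symbolMin_le {d : ℕ} (hd : 2 ≤ d) : symbolMin d ≤ -(1 / (d : ℝ)) := by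
  let l : Fin d := ⟨0, by omega⟩
  -- The limit `-1/d` needs a direction transverse to the axis, which exists because `2 ≤ d`.
  have hk : (⟨1, by omega⟩ : Fin d) ≠ l := by
    intro h
    exact one_ne_zero (congrArg Fin.val h)
  refine ge_of_tendsto (tendsto_realSymbol_single_of_ne hd hk) ?_
  filter_upwards [(tendsto_single_nhdsWithin l).eventually self_mem_nhdsWithin] with t ht
  exact (realSymbol_diag_mem hd ht.1 ht.2 _).1

theorem spectrum_symbolOperator_subset {d : ℕ} (hd : 2 ≤ d) {τ : Fin d → ℝ}
    (hτ : τ ∈ periodCube d) (h0 : τ ≠ 0) :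
    spectrum ℂ (symbolOperator τ) ⊆ Complex.ofReal '' Set.Icc (symbolMin d) (symbolMax d) := by
  intro z hz
  obtain ⟨v, hv, hz'⟩ := spectrum_subset_numericalRange _ hz
  have h1 : z = (z.re : ℂ) := by
    refine (Complex.conj_eq_iff_re.mp ?_).symm
    rw [hz', inner_conj_symm]
    exact (ContinuousLinearMap.isSelfAdjoint_iff_isSymmetric.mp
      (isSelfAdjoint_symbolOperator τ)) _ _
  have h2 := symbolOperator_mem_bounds hd hτ h0 v
  rw [hv, ← hz'] at h2
  exact ⟨z.re, ⟨by linarith [h2.1], by linarith [h2.2]⟩, h1.symm⟩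

/-- The eigenvalues of the symbol fill the open interval `(Λ₋, Λ₊)`. -/
theorem exists_eigenvector_symbolOperator {d : ℕ} (hd : 2 ≤ d) {x : ℝ}
    (hx : x ∈ Set.Ioo (symbolMin d) (symbolMax d)) :
    ∃ τ ∈ periodCube d, τ ≠ 0 ∧ ∃ v, ‖v‖ = 1 ∧ symbolOperator τ v = (x : ℂ) • v := by
  -- The corner value `0` separates the two cases: nonnegative `x` is reached by the largest
  -- eigenvalue, and nonpositive `x` by applying the same argument to the negative of the symbol.
  rcases le_total 0 x with h | h
  · obtain ⟨b, ⟨τ, hτ, h0, hb⟩, hxb, -⟩ := (isLUB_symbolMax hd).exists_between hx.2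
    exact exists_sSup_realSpectrum_eq hd (continuousOn_symbolOperator hd)
      isSelfAdjoint_symbolOperator (symbolOperator_cubeCorner hd) symbolOperator_neg hτ h0 h
      (by rw [hb.csSup_eq]; exact hxb.le)
  · obtain ⟨a, ⟨τ, hτ, h0, ha⟩, -, hax⟩ := (isGLB_symbolMin hd).exists_between hx.1
    have hb : IsGreatest (realSpectrum (-symbolOperator τ)) (-a) := by
      refine ⟨(realSpectrum_neg _ _).mpr (by rw [neg_neg]; exact ha.1), fun y hy => ?_⟩
      have := ha.2 ((realSpectrum_neg _ _).mp hy)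
      linarith
    have hneg : ∀ τ : Fin d → ℝ, IsSelfAdjoint (-symbolOperator τ) := fun τ =>
      isSelfAdjoint_neg (isSelfAdjoint_symbolOperator τ)
    obtain ⟨τ', h1, h2, v, hv, hAv⟩ := exists_sSup_realSpectrum_eq hd
      (A := fun τ => -symbolOperator τ) (continuousOn_symbolOperator hd).neg
      hneg (by rw [symbolOperator_cubeCorner hd, neg_zero])
      (fun τ => by rw [symbolOperator_neg]) hτ h0 (x := -x) (by linarith)
      (by rw [hb.csSup_eq]; linarith)
    refine ⟨τ', h1, h2, v, hv, ?_⟩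
    rw [_root_.neg_apply, Complex.ofReal_neg, neg_smul, neg_inj] at hAv
    exact hAv

/-! ### Approximate eigenvectors of the Toeplitz operator. -/

theorem fourierVec_sub_smul {d : ℕ} (u w : LatticeL2 d) (c : ℂ) :
    ∀ᵐ τ ∂(cubeMeasure d), fourierVec (u - c • w) τ = fourierVec u τ - c • fourierVec w τ := by
  have h1 : ∀ᵐ τ ∂(cubeMeasure d), ∀ j,
      ((cubeBasis d).repr.symm (componentProj d j u) -
        c • (cubeBasis d).repr.symm (componentProj d j w) : Lp ℂ 2 (cubeMeasure d)) τ =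
      (cubeBasis d).repr.symm (componentProj d j u) τ -
        c • (cubeBasis d).repr.symm (componentProj d j w) τ := by
    rw [ae_all_iff]
    intro j
    filter_upwards [Lp.coeFn_sub ((cubeBasis d).repr.symm (componentProj d j u))
      (c • (cubeBasis d).repr.symm (componentProj d j w)),
      Lp.coeFn_smul c ((cubeBasis d).repr.symm (componentProj d j w))] with τ h2 h3
    rw [h2, Pi.sub_apply, h3, Pi.smul_apply]
  filter_upwards [h1] with τ h1
  ext j
  simp only [fourierVec, map_sub, map_smul, h1]
  simp

/-- A vector-valued sequence whose Fourier transform is a given scalar function times a vector. -/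
theorem exists_fourierVec_eq {d : ℕ} (f : Lp ℂ 2 (cubeMeasure d)) (v : EuclideanSpace ℂ (Fin d)) :
    ∃ u : LatticeL2 d, ∀ᵐ τ ∂(cubeMeasure d), fourierVec u τ = f τ • v := by
  refine ⟨∑ j, v j • (componentProj d j).adjoint ((cubeBasis d).repr f), ?_⟩
  have h1 : ∀ i, (cubeBasis d).repr.symm (componentProj d i
      (∑ j, v j • (componentProj d j).adjoint ((cubeBasis d).repr f))) = v i • f := by
    intro i
    rw [map_sum, Finset.sum_eq_single i]
    · rw [map_smul, componentProj_adjoint, if_pos rfl, map_smul,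
        LinearIsometryEquiv.symm_apply_apply]
    · intro j _ hj
      rw [map_smul, componentProj_adjoint, if_neg hj.symm, smul_zero]
    · exact fun h => absurd (Finset.mem_univ i) h
  have h2 : ∀ᵐ τ ∂(cubeMeasure d), ∀ i, (v i • f : Lp ℂ 2 (cubeMeasure d)) τ = v i • f τ := by
    rw [ae_all_iff]
    intro i
    filter_upwards [Lp.coeFn_smul (v i) f] with τ h
    rw [h, Pi.smul_apply]
  filter_upwards [h2] with τ h2
  ext i
  simp only [fourierVec, h1, h2]
  simp [mul_comm]

/-- A wave packet: the Fourier transform is `v` on a small neighborhood of `τ₀` in the cube and `0`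
elsewhere. On that neighborhood the symbol is within `ε` of its value at `τ₀`. -/
theorem exists_approx_eigenvector_of_eigenvalue {d : ℕ} (hd : 2 ≤ d) {τ₀ : Fin d → ℝ}
    (hτ : τ₀ ∈ periodCube d) (h0 : τ₀ ≠ 0) {z : ℂ} {v : EuclideanSpace ℂ (Fin d)} (hv : ‖v‖ = 1)
    (hF : symbolOperator τ₀ v = z • v) {ε : ℝ} (hε : 0 < ε) :
    ∃ u : LatticeL2 d, u ≠ 0 ∧ ‖toeplitzOperator hd u - z • u‖ ≤ ε * ‖u‖ := by
  have hnhds : {τ | ‖symbolOperator τ - symbolOperator τ₀‖ < ε} ∈ 𝓝[periodCube d \ {0}] τ₀ := by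
    have h := tendsto_iff_norm_sub_tendsto_zero.mp (continuousOn_symbolOperator hd τ₀ ⟨hτ, h0⟩)
    exact h.eventually_lt_const hε
  obtain ⟨U, hU, hτU, hsub⟩ := mem_nhdsWithin.mp hnhds
  have hB : MeasurableSet (U ∩ periodCube d) := hU.measurableSet.inter measurableSet_Icc
  have hpos : 0 < cubeMeasure d (U ∩ periodCube d) :=
    cubeMeasure_pos_of_mem_nhds hτ (mem_nhdsWithin_of_mem_nhds (hU.mem_nhds hτU))
  set f : Lp ℂ 2 (cubeMeasure d) := indicatorConstLp 2 hB (measure_ne_top _ _) (1 : ℂ) with hf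
  have hfτ : ∀ᵐ τ ∂(cubeMeasure d), f τ = (U ∩ periodCube d).indicator (fun _ => (1 : ℂ)) τ :=
    indicatorConstLp_coeFn
  obtain ⟨u, hu⟩ := exists_fourierVec_eq f v
  have hunorm := inner_fourierVec_self u
  have hwnorm := inner_fourierVec_self (toeplitzOperator hd u - z • u)
  refine ⟨u, ?_, ?_⟩
  -- The squared norm of the packet is the measure of the neighborhood, which is positive.
  · rintro rfl
    have h1 : ∀ᵐ τ ∂(cubeMeasure d), ‖fourierVec (0 : LatticeL2 d) τ‖ ^ 2 =
        (U ∩ periodCube d).indicator (fun _ => (1 : ℝ)) τ := by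
      filter_upwards [hu, hfτ] with τ h2 h3
      rw [h2, h3, norm_smul, hv]
      by_cases h : τ ∈ U ∩ periodCube d <;> simp [h]
    have h2 := hunorm.2
    rw [integral_congr_ae h1, integral_indicator_const _ hB] at h2
    have h3 : 0 < (cubeMeasure d).real (U ∩ periodCube d) :=
      ENNReal.toReal_pos hpos.ne' (measure_ne_top _ _)
    simp only [norm_zero, smul_eq_mul, mul_one] at h2
    norm_num at h2
    exact h3.ne h2
  · refine abs_le_of_sq_le_sq' ?_ (by positivity) |>.2
    rw [mul_pow, hwnorm.2, hunorm.2, ← integral_const_mul]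
    refine integral_mono_ae hwnorm.1 (hunorm.1.const_mul _) ?_
    filter_upwards [hu, hfτ, fourierVec_sub_smul (toeplitzOperator hd u) u z,
      fourierVec_toeplitzOperator hd u, ae_ne_zero hd] with τ h1 h2 h3 h4 h5
    rw [h3, h4, h1, h2, ← mul_pow]
    refine pow_le_pow_left₀ (norm_nonneg _) ?_ 2
    by_cases h : τ ∈ U ∩ periodCube d
    · have h6 : ‖symbolOperator τ - symbolOperator τ₀‖ < ε := hsub ⟨h.1, h.2, h5⟩
      rw [Set.indicator_of_mem h, one_smul, ← hF, ← _root_.sub_apply]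
      exact (ContinuousLinearMap.le_opNorm _ _).trans (by gcongr)
    · rw [Set.indicator_of_notMem h]
      simp

/-- Every point of `[Λ₋, Λ₊]` is an approximate eigenvalue of the Toeplitz operator, with finitely
supported approximate eigenvectors. -/
theorem exists_finite_approx_eigenvector {d : ℕ} (hd : 2 ≤ d) {x : ℝ}
    (hx : x ∈ Set.Icc (symbolMin d) (symbolMax d)) {ε : ℝ} (hε : 0 < ε) :
    ∃ (s : Finset (Fin d → ℤ)) (u : LatticeL2 d), u ≠ 0 ∧ (∀ n ∉ s, u n = 0) ∧
      ‖toeplitzOperator hd u - (x : ℂ) • u‖ ≤ ε * ‖u‖ := by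
  have hlt : symbolMin d < symbolMax d := by
    have h1 := symbolMin_le hd
    have h2 := le_symbolMax hd
    linarith
  obtain ⟨y, hy, hxy⟩ : ∃ y ∈ Set.Ioo (symbolMin d) (symbolMax d), dist x y < ε / 2 := by
    rw [← closure_Ioo hlt.ne] at hx
    exact Metric.mem_closure_iff.mp hx _ (by positivity)
  obtain ⟨τ, hτ, h0, v, hv, hF⟩ := exists_eigenvector_symbolOperator hd hy
  -- The budget is `ε/4` for the packet and `ε/2` for moving from `x` to the nearby interior point
  -- `y`; the total stays strictly below `ε`, which leaves room for truncation.
  obtain ⟨u, hu0, hu⟩ := exists_approx_eigenvector_of_eigenvalue hd hτ h0 hv hF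
    (show 0 < ε / 4 by positivity)
  have hun : 0 < ‖u‖ := norm_pos_iff.mpr hu0
  have hlt' : ‖toeplitzOperator hd u - (x : ℂ) • u‖ < ε * ‖u‖ := by
    have h1 : toeplitzOperator hd u - (x : ℂ) • u =
        (toeplitzOperator hd u - (y : ℂ) • u) - ((x - y : ℝ) : ℂ) • u := by
      rw [Complex.ofReal_sub, sub_smul]
      abel
    have h2 : ‖((x - y : ℝ) : ℂ) • u‖ ≤ ε / 2 * ‖u‖ := by
      rw [norm_smul, Complex.norm_real, ← dist_eq_norm]
      gcongr
    rw [h1]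
    refine (norm_sub_le _ _).trans_lt ?_
    nlinarith [mul_pos hε hun]
  have hs := lp.hasSum_single (by norm_num) u
  have hcont : Continuous fun w : LatticeL2 d =>
      ε * ‖w‖ - ‖toeplitzOperator hd w - (x : ℂ) • w‖ := by fun_prop
  -- The strict inequality is an open condition and the finite truncations converge in norm to `u`.
  have hev := (hcont.tendsto u).comp hs |>.eventually_const_lt (sub_pos.mpr hlt')
  obtain ⟨s, hs⟩ := hev.exists
  refine ⟨s, ∑ n ∈ s, lp.single 2 n (u n), ?_, fun n hn => ?_, ?_⟩
  -- For the zero sequence the strict inequality would read `0 < 0`, so the truncation is nonzero as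
  -- well.
  · intro h
    simp only [Function.comp_apply, h] at hs
    simp at hs
  · rw [lp.coeFn_sum, Finset.sum_apply]
    refine Finset.sum_eq_zero fun m hm => ?_
    rw [lp.single_apply_ne]
    rintro rfl
    exact hn hm
  · exact (sub_pos.mp hs).le

/-! ### The system matrices as finite sections of the Toeplitz operator. -/

theorem kernel_smul {d : ℕ} (hd : 2 ≤ d) {x : EuclideanSpace ℝ (Fin d)} (hx : x ≠ 0) {c : ℝ}
    (hc : 0 < c) (i j : Fin d) : kernel d (c • x) i j = (c ^ d)⁻¹ * kernel d x i j := by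
  have hx0 : ‖x‖ ≠ 0 := norm_ne_zero_iff.mpr hx
  rw [kernel_apply hd (smul_ne_zero hc.ne' hx), kernel_apply hd hx, norm_smul, Real.norm_eq_abs,
    abs_of_pos hc]
  simp only [PiLp.smul_apply, smul_eq_mul]
  field_simp
  rw [mul_pow]
  ring

section Section

variable {d : ℕ} {Ω : Set (EuclideanSpace ℝ (Fin d))} (hΩ : Bornology.IsBounded Ω)
  (a : EuclideanSpace ℝ (Fin d)) (N : ℕ+)

theorem mem_gridIndex {m : Fin d → ℤ} : m ∈ gridIndex hΩ a N ↔ gridPoint a N m ∈ Ω := by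
  simp [gridIndex]

theorem gridPoint_sub (m n : Fin d → ℤ) :
    gridPoint a N m - gridPoint a N n = (1 / (N : ℝ)) • latticePoint (m - n) := by
  ext i
  simp [gridPoint, latticePoint]
  ring

/-- Homogeneity of degree `-d` makes `K((m - n)/N)` equal to `N^d K(m - n)`, so the factor `N^{-d}`
cancels and neither `N` nor the origin enters except through the index set. -/
theorem systemMatrix_apply (hd : 2 ≤ d) (p q : gridIndex hΩ a N × Fin d) :
    systemMatrix hΩ a N p q = toeplitzBlock d p.1 q.1 p.2 q.2 := by
  have hN : (0 : ℝ) < N := by exact_mod_cast N.pos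
  rw [systemMatrix, Matrix.of_apply, toeplitzBlock]
  by_cases h : p.1 = q.1
  · simp [h]
  · have h' : (p.1 : Fin d → ℤ) ≠ q.1 := fun h' => h (Subtype.ext h')
    have h0 : latticePoint ((p.1 : Fin d → ℤ) - (q.1 : Fin d → ℤ)) ≠ 0 := by
      intro h0
      refine sub_ne_zero.mpr h' (funext fun i => ?_)
      have := congrArg (fun x : EuclideanSpace ℝ (Fin d) => x i) h0
      simp only [latticePoint, Pi.sub_apply, PiLp.zero_apply] at this
      exact_mod_cast this
    rw [if_neg h, if_neg h', gridPoint_sub, kernel_smul hd h0 (by positivity), Matrix.map_apply]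
    congr 1
    rw [← mul_assoc, one_div, inv_pow, inv_inv, inv_mul_cancel₀ (by positivity), one_mul]

/-- The values of a lattice sequence, shifted by `p`, on the finite grid. -/
def gridSection (p : Fin d → ℤ) :
    LatticeL2 d →ₗ[ℂ] EuclideanSpace ℂ (gridIndex hΩ a N × Fin d) where
  toFun u := WithLp.toLp 2 fun q => u (q.1 - p) q.2
  map_add' _ _ := rfl
  map_smul' _ _ := rfl

theorem gridSection_apply (p : Fin d → ℤ) (u : LatticeL2 d) (q : gridIndex hΩ a N × Fin d) :
    gridSection hΩ a N p u q = u (q.1 - p) q.2 := rfl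

theorem inner_gridSection (p : Fin d → ℤ) (u w : LatticeL2 d) :
    inner ℂ (gridSection hΩ a N p u) (gridSection hΩ a N p w) =
      ∑ n ∈ gridIndex hΩ a N, inner ℂ (u (n - p)) (w (n - p)) := by
  rw [PiLp.inner_apply, Fintype.sum_prod_type,
    ← Finset.sum_coe_sort (gridIndex hΩ a N) fun n => inner ℂ (u (n - p)) (w (n - p))]
  simp only [PiLp.inner_apply, gridSection_apply]

theorem hasSum_sub_right {E : Type*} [NormedAddCommGroup E] {f : (Fin d → ℤ) → E}
    {s : Finset (Fin d → ℤ)} {p : Fin d → ℤ} (h : ∀ n, n + p ∉ s → f n = 0) :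
    HasSum f (∑ n ∈ s, f (n - p)) := by
  rw [← (Equiv.subRight p).hasSum_iff]
  refine hasSum_sum_of_ne_finset_zero fun n hn => ?_
  exact h _ (by simpa using hn)

/-- Support of one of the two factors is enough: the discarded values of `w` meet only zeros of `u`.
-/
theorem inner_gridSection_of_support {p : Fin d → ℤ} {u : LatticeL2 d}
    (hu : ∀ n, n + p ∉ gridIndex hΩ a N → u n = 0) (w : LatticeL2 d) :
    inner ℂ (gridSection hΩ a N p u) (gridSection hΩ a N p w) = inner ℂ u w := by
  rw [inner_gridSection]
  refine (hasSum_sub_right fun n hn => ?_).unique (lp.hasSum_inner (𝕜 := ℂ)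
    (G := fun _ : Fin d → ℤ => EuclideanSpace ℂ (Fin d)) u w)
  rw [hu n hn, inner_zero_left]

theorem norm_gridSection_of_support {p : Fin d → ℤ} {u : LatticeL2 d}
    (hu : ∀ n, n + p ∉ gridIndex hΩ a N → u n = 0) : ‖gridSection hΩ a N p u‖ = ‖u‖ := by
  have h := inner_gridSection_of_support hΩ a N hu u
  rw [inner_self_eq_norm_sq_to_K, inner_self_eq_norm_sq_to_K] at h
  refine (sq_eq_sq₀ (norm_nonneg _) (norm_nonneg _)).mp ?_
  exact_mod_cast h

theorem norm_gridSection_le (p : Fin d → ℤ) (u : LatticeL2 d) :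
    ‖gridSection hΩ a N p u‖ ≤ ‖u‖ := by
  have h1 : ‖gridSection hΩ a N p u‖ ^ 2 = ∑ n ∈ gridIndex hΩ a N, ‖u (n - p)‖ ^ 2 := by
    have h := inner_gridSection hΩ a N p u u
    simp only [inner_self_eq_norm_sq_to_K] at h
    exact_mod_cast h
  have h2 : HasSum (fun n => ‖u n‖ ^ 2) (‖u‖ ^ 2) := by
    have h := lp.hasSum_inner (𝕜 := ℂ) (G := fun _ : Fin d → ℤ => EuclideanSpace ℂ (Fin d)) u u
    simp only [inner_self_eq_norm_sq_to_K] at h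
    exact_mod_cast h
  refine abs_le_of_sq_le_sq' ?_ (norm_nonneg _) |>.2
  rw [h1]
  exact sum_le_hasSum _ (fun _ _ => by positivity) ((Equiv.subRight p).hasSum_iff.mpr h2)

/-- The blocks depend only on `m - n`, so the shift by `p` is harmless, and the support condition
reduces the Toeplitz series to a sum over the grid. -/
theorem systemOperator_gridSection (hd : 2 ≤ d) {p : Fin d → ℤ} {u : LatticeL2 d}
    (hu : ∀ n, n + p ∉ gridIndex hΩ a N → u n = 0) :
    systemOperator hΩ a N (gridSection hΩ a N p u) =
      gridSection hΩ a N p (toeplitzOperator hd u) := by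
  ext q
  rw [gridSection_apply]
  have h1 := isToeplitzOperator_toeplitzOperator hd u ((q.1 : Fin d → ℤ) - p)
  have h2 := (hasSum_sub_right (s := gridIndex hΩ a N) (p := p) fun n hn => by
    rw [hu n hn, map_zero]).unique h1
  rw [← h2]
  have h3 : systemOperator hΩ a N (gridSection hΩ a N p u) q =
      ∑ r, systemMatrix hΩ a N q r * gridSection hΩ a N p u r := rfl
  have h4 : ∀ n : Fin d → ℤ, toeplitzBlock d ((q.1 : Fin d → ℤ) - p) (n - p) =
      toeplitzBlock d q.1 n := by
    intro n
    rw [← toeplitzBlock_sub, sub_sub_sub_cancel_right, toeplitzBlock_sub]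
  rw [h3, Fintype.sum_prod_type, WithLp.ofLp_sum, Finset.sum_apply]
  simp only [h4, systemMatrix_apply _ _ _ hd, gridSection_apply]
  exact Finset.sum_coe_sort (gridIndex hΩ a N) fun n => ∑ j, toeplitzBlock d q.1 n q.2 j *
    u (n - p) j

theorem exists_gridSection_eq (w : EuclideanSpace ℂ (gridIndex hΩ a N × Fin d)) :
    ∃ u : LatticeL2 d, (∀ n, n + 0 ∉ gridIndex hΩ a N → u n = 0) ∧
      gridSection hΩ a N 0 u = w := by
  refine ⟨∑ n : gridIndex hΩ a N, lp.single 2 n.1 (WithLp.toLp 2 fun i => w (n, i)), ?_, ?_⟩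
  · intro n hn
    rw [lp.coeFn_sum, Finset.sum_apply]
    refine Finset.sum_eq_zero fun m _ => ?_
    rw [lp.single_apply_ne]
    rintro rfl
    exact hn (by rw [add_zero]; exact m.2)
  · ext q
    rw [gridSection_apply, sub_zero, lp.coeFn_sum, Finset.sum_apply, Finset.sum_eq_single q.1]
    · rw [lp.single_apply_self]
    · intro m _ hm
      rw [lp.single_apply_ne]
      exact fun h => hm (Subtype.ext h.symm)
    · exact fun h => absurd (Finset.mem_univ _) h

/-- Extension by zero is isometric and carries the quadratic form of the section to that of `T`. -/
theorem numericalRange_systemOperator_subset (hd : 2 ≤ d) :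
    numericalRange (systemOperator hΩ a N) ⊆ numericalRange (toeplitzOperator hd) := by
  rintro z ⟨w, hw, rfl⟩
  obtain ⟨u, hu, rfl⟩ := exists_gridSection_eq hΩ a N w
  refine ⟨u, by rw [← hw, norm_gridSection_of_support hΩ a N hu], ?_⟩
  rw [systemOperator_gridSection hΩ a N hd hu, inner_gridSection_of_support hΩ a N hu]

end Section

/-! ### Translating finitely supported sequences into the grid. -/

/-- Every finite set of lattice points can be shifted into the grid in `Ω`, if `N` is large. -/
theorem eventually_exists_shift_mem {d : ℕ} {Ω : Set (EuclideanSpace ℝ (Fin d))}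
    (hΩ : Bornology.IsBounded Ω) (hopen : IsOpen Ω) (hne : Ω.Nonempty)
    (a : ℕ+ → EuclideanSpace ℝ (Fin d)) (s : Finset (Fin d → ℤ)) :
    ∀ᶠ N : ℕ+ in atTop, ∃ p : Fin d → ℤ, ∀ n ∈ s, n + p ∈ gridIndex hΩ (a N) N := by
  obtain ⟨y, hy⟩ := hne
  obtain ⟨r, hr, hball⟩ := Metric.isOpen_iff.mp hopen y hy
  -- `c` dominates the rounding error, whose coordinates are at most `1/2`; `R` bounds, in lattice
  -- units, the distance from the translated points of `s` to `N(y - a N)`.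
  set c : EuclideanSpace ℝ (Fin d) := WithLp.toLp 2 fun _ => 1 with hc
  set R : ℝ := ∑ n ∈ s, ‖latticePoint n‖ + ‖c‖ with hR
  have hlim : Tendsto (fun N : ℕ+ => R / (N : ℝ)) atTop (𝓝 0) :=
    (tendsto_const_div_atTop_nhds_zero_nat R).comp tendsto_PNat_val_atTop_atTop
  filter_upwards [hlim.eventually_lt_const hr] with N hN
  have hNpos : (0 : ℝ) < N := by exact_mod_cast N.pos
  -- The shift is the lattice point nearest to `N(y - a N)` in each coordinate, so the translated
  -- set lies within `R/N` of the center `y`.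
  refine ⟨fun i => round ((N : ℝ) * (y i - a N i)), fun n hn => ?_⟩
  rw [mem_gridIndex]
  refine hball ?_
  set e : EuclideanSpace ℝ (Fin d) := WithLp.toLp 2 fun i =>
    (round ((N : ℝ) * (y i - a N i)) : ℝ) - (N : ℝ) * (y i - a N i) with he
  have he1 : ‖e‖ ≤ ‖c‖ := by
    rw [EuclideanSpace.norm_eq, EuclideanSpace.norm_eq]
    refine Real.sqrt_le_sqrt (Finset.sum_le_sum fun i _ => ?_)
    refine pow_le_pow_left₀ (norm_nonneg _) ?_ 2
    have h := abs_sub_round ((N : ℝ) * (y i - a N i))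
    rw [abs_sub_comm] at h
    simp only [he, hc, Real.norm_eq_abs, abs_one]
    linarith
  have h1 : gridPoint (a N) N (n + fun i => round ((N : ℝ) * (y i - a N i))) - y =
      (1 / (N : ℝ)) • (latticePoint n + e) := by
    ext i
    simp [gridPoint, latticePoint, he]
    field_simp
    ring
  rw [mem_ball_iff_norm, h1, norm_smul, Real.norm_eq_abs, abs_of_pos (by positivity),
    one_div_mul_eq_div]
  refine lt_of_le_of_lt ?_ hN
  gcongr
  refine (norm_add_le _ _).trans (add_le_add ?_ he1)
  exact Finset.single_le_sum (f := fun n : Fin d → ℤ => ‖latticePoint n‖)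
    (fun _ _ => norm_nonneg _) hn

/-- Every point of `[Λ₋, Λ₊]` is, for large `N`, an approximate eigenvalue of the system matrix. -/
theorem eventually_exists_approx_eigenvector {d : ℕ} (hd : 2 ≤ d)
    {Ω : Set (EuclideanSpace ℝ (Fin d))} (hΩ : Bornology.IsBounded Ω) (hopen : IsOpen Ω)
    (hne : Ω.Nonempty) (a : ℕ+ → EuclideanSpace ℝ (Fin d)) {x : ℝ}
    (hx : x ∈ Set.Icc (symbolMin d) (symbolMax d)) {ε : ℝ} (hε : 0 < ε) :
    ∀ᶠ N : ℕ+ in atTop, ∃ w : EuclideanSpace ℂ (gridIndex hΩ (a N) N × Fin d), w ≠ 0 ∧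
      ‖systemOperator hΩ (a N) N w - (x : ℂ) • w‖ ≤ ε * ‖w‖ := by
  obtain ⟨s, u, hu0, hs, hu⟩ := exists_finite_approx_eigenvector hd hx hε
  filter_upwards [eventually_exists_shift_mem hΩ hopen hne a s] with N ⟨p, hp⟩
  have hsupp : ∀ n, n + p ∉ gridIndex hΩ (a N) N → u n = 0 := fun n hn =>
    hs n fun h => hn (hp n h)
  refine ⟨gridSection hΩ (a N) N p u, ?_, ?_⟩
  · rwa [← norm_ne_zero_iff, norm_gridSection_of_support hΩ (a N) N hsupp, norm_ne_zero_iff]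
  · rw [systemOperator_gridSection hΩ (a N) N hd hsupp, ← map_smul, ← map_sub,
      norm_gridSection_of_support hΩ (a N) N hsupp]
    exact (norm_gridSection_le hΩ (a N) N p _).trans hu

/-! ### Closure of the numerical range and resolvent bounds. -/

/-- The segment `𝒞 = [Λ₋, Λ₊] ⊂ ℂ`. -/
def symbolSegment (d : ℕ) : Set ℂ := Complex.ofReal '' Set.Icc (symbolMin d) (symbolMax d)

theorem isClosed_symbolSegment (d : ℕ) : IsClosed (symbolSegment d) :=
  (isCompact_Icc.image Complex.continuous_ofReal).isClosed

theorem symbolMin_lt_symbolMax {d : ℕ} (hd : 2 ≤ d) : symbolMin d < symbolMax d := by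
  have h1 := symbolMin_le hd
  have h2 := le_symbolMax hd
  linarith

theorem numericalRange_toeplitzOperator_subset {d : ℕ} (hd : 2 ≤ d) :
    numericalRange (toeplitzOperator hd) ⊆ symbolSegment d := by
  rintro z ⟨u, hu, rfl⟩
  obtain ⟨q, h1, h2, h3⟩ := inner_toeplitzOperator_mem hd
    (fun τ hτ h0 v => symbolOperator_mem_bounds hd hτ h0 v) u
  rw [hu, one_pow, mul_one] at h2 h3
  exact ⟨q, ⟨h2, h3⟩, h1.symm⟩

theorem closure_numericalRange_toeplitzOperator {d : ℕ} (hd : 2 ≤ d) :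
    closure (numericalRange (toeplitzOperator hd)) = symbolSegment d := by
  refine (closure_minimal (numericalRange_toeplitzOperator_subset hd)
    (isClosed_symbolSegment d)).antisymm ?_
  rintro _ ⟨x, hx, rfl⟩
  refine Metric.mem_closure_iff.mpr fun ε hε => ?_
  -- By Cauchy–Schwarz, a normalized approximate eigenvector has its Rayleigh quotient within the
  -- same error of `x`; convexity of the numerical range is not needed.
  obtain ⟨-, u, hu0, -, hu⟩ := exists_finite_approx_eigenvector hd hx (half_pos hε)
  have hn : ‖u‖ ≠ 0 := norm_ne_zero_iff.mpr hu0
  set w : LatticeL2 d := ((‖u‖⁻¹ : ℝ) : ℂ) • u with hw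
  have hw1 : ‖w‖ = 1 := by
    rw [hw, norm_smul, Complex.norm_real, norm_inv, norm_norm, inv_mul_cancel₀ hn]
  have hw2 : ‖toeplitzOperator hd w - (x : ℂ) • w‖ ≤ ε / 2 := by
    rw [hw, map_smul, smul_comm, ← smul_sub, norm_smul, Complex.norm_real, norm_inv, norm_norm,
      inv_mul_le_iff₀ (norm_pos_iff.mpr hu0), mul_comm]
    exact hu
  refine ⟨_, ⟨w, hw1, rfl⟩, ?_⟩
  have h1 : inner ℂ w (toeplitzOperator hd w) - (x : ℂ) =
      inner ℂ w (toeplitzOperator hd w - (x : ℂ) • w) := by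
    rw [inner_sub_right, inner_smul_right, inner_self_eq_norm_sq_to_K, hw1]
    simp
  rw [dist_comm, dist_eq_norm, h1]
  refine (norm_inner_le_norm _ _).trans_lt ?_
  rw [hw1, one_mul]
  linarith

section Section

variable {d : ℕ} {Ω : Set (EuclideanSpace ℝ (Fin d))} (hΩ : Bornology.IsBounded Ω)
  (a : EuclideanSpace ℝ (Fin d)) (N : ℕ+)

theorem inner_systemOperator_mem (hd : 2 ≤ d)
    (w : EuclideanSpace ℂ (gridIndex hΩ a N × Fin d)) :
    ∃ q : ℝ, inner ℂ w (systemOperator hΩ a N w) = q ∧ symbolMin d * ‖w‖ ^ 2 ≤ q ∧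
      q ≤ symbolMax d * ‖w‖ ^ 2 := by
  obtain ⟨u, hu, rfl⟩ := exists_gridSection_eq hΩ a N w
  rw [systemOperator_gridSection hΩ a N hd hu, inner_gridSection_of_support hΩ a N hu,
    norm_gridSection_of_support hΩ a N hu]
  exact inner_toeplitzOperator_mem hd (fun τ hτ h0 v => symbolOperator_mem_bounds hd hτ h0 v) u

/-- On a complex space a real quadratic form already forces symmetry, and the form is that of `T`.
-/
theorem isSelfAdjoint_systemOperator (hd : 2 ≤ d) : IsSelfAdjoint (systemOperator hΩ a N) := by
  rw [ContinuousLinearMap.isSelfAdjoint_iff_isSymmetric,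
    LinearMap.isSymmetric_iff_inner_map_self_real]
  intro w
  obtain ⟨q, hq, -, -⟩ := inner_systemOperator_mem hΩ a N hd w
  have h : inner ℂ (systemOperator hΩ a N w) w = (q : ℂ) := by
    rw [← inner_conj_symm, hq, Complex.conj_ofReal]
  exact (congrArg (starRingEnd ℂ) h).trans ((Complex.conj_ofReal q).trans h.symm)

theorem realSpectrum_systemOperator_subset (hd : 2 ≤ d) :
    realSpectrum (systemOperator hΩ a N) ⊆ Set.Icc (symbolMin d) (symbolMax d) := by
  intro x hx
  obtain ⟨y, hy, hxy⟩ := numericalRange_toeplitzOperator_subset hd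
    (numericalRange_systemOperator_subset hΩ a N hd (spectrum_subset_numericalRange _ hx))
  rwa [← Complex.ofReal_injective hxy]

/-- The Rayleigh quotient of `w` lies in `𝒞`, so its distance to `z` is at least `dist(z, 𝒞)`;
Cauchy–Schwarz turns this into a lower bound for `z - T^N`. -/
theorem infDist_mul_norm_le (hd : 2 ≤ d) (z : ℂ)
    (w : EuclideanSpace ℂ (gridIndex hΩ a N × Fin d)) :
    Metric.infDist z (symbolSegment d) * ‖w‖ ≤ ‖z • w - systemOperator hΩ a N w‖ := by
  by_cases hw : w = 0
  · simp [hw]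
  have hn : 0 < ‖w‖ := norm_pos_iff.mpr hw
  have hn2 : 0 < ‖w‖ ^ 2 := by positivity
  obtain ⟨q, hq, h1, h2⟩ := inner_systemOperator_mem hΩ a N hd w
  have hmem : ((q / ‖w‖ ^ 2 : ℝ) : ℂ) ∈ symbolSegment d :=
    ⟨_, ⟨(le_div_iff₀ hn2).mpr h1, (div_le_iff₀ hn2).mpr h2⟩, rfl⟩
  have h3 := Metric.infDist_le_dist_of_mem (x := z) hmem
  have h4 : inner ℂ w (z • w - systemOperator hΩ a N w) =
      (z - ((q / ‖w‖ ^ 2 : ℝ) : ℂ)) * ((‖w‖ ^ 2 : ℝ) : ℂ) := by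
    rw [inner_sub_right, inner_smul_right, hq, inner_self_eq_norm_sq_to_K, sub_mul,
      ← Complex.ofReal_mul, div_mul_cancel₀ _ hn2.ne']
    push_cast
    rfl
  have h5 := norm_inner_le_norm (𝕜 := ℂ) w (z • w - systemOperator hΩ a N w)
  rw [h4, norm_mul, Complex.norm_real, Real.norm_eq_abs, abs_of_pos hn2, ← dist_eq_norm] at h5
  have h6 : Metric.infDist z (symbolSegment d) * ‖w‖ ^ 2 ≤
      ‖w‖ * ‖z • w - systemOperator hΩ a N w‖ :=
    (mul_le_mul_of_nonneg_right h3 hn2.le).trans h5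
  refine le_of_mul_le_mul_left ?_ hn
  linarith

/-- The resolvent bound outside of the segment `𝒞`. -/
theorem resolvent_systemOperator (hd : 2 ≤ d) {z : ℂ} (hz : z ∉ symbolSegment d) :
    z ∈ resolventSet ℂ (systemOperator hΩ a N) ∧
      ‖resolvent (systemOperator hΩ a N) z‖ ≤ (Metric.infDist z (symbolSegment d))⁻¹ := by
  have hne : (symbolSegment d).Nonempty :=
    ⟨_, symbolMin d, ⟨le_rfl, (symbolMin_lt_symbolMax hd).le⟩, rfl⟩
  exact mem_resolventSet_of_lower_bound _
    (((isClosed_symbolSegment d).notMem_iff_infDist_pos hne).mp hz)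
    (infDist_mul_norm_le hΩ a N hd z)

end Section

/-! ### Sharpness of the extreme eigenvalues, and stability. -/

section Scheme

variable {d : ℕ} {Ω : Set (EuclideanSpace ℝ (Fin d))}

theorem exists_abs_inner_systemOperator_sub_le (hΩ : Bornology.IsBounded Ω)
    (hopen : IsOpen Ω) (hne : Ω.Nonempty) (a : ℕ+ → EuclideanSpace ℝ (Fin d)) (hd : 2 ≤ d) {x : ℝ}
    (hx : x ∈ Set.Icc (symbolMin d) (symbolMax d)) {ε : ℝ} (hε : 0 < ε) :
    ∃ (N : ℕ+) (w : EuclideanSpace ℂ (gridIndex hΩ (a N) N × Fin d)), w ≠ 0 ∧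
      |(inner ℂ w (systemOperator hΩ (a N) N w)).re - x * ‖w‖ ^ 2| ≤ ε * ‖w‖ ^ 2 := by
  obtain ⟨N, w, hw0, hw⟩ :=
    (eventually_exists_approx_eigenvector hd hΩ hopen hne a hx hε).exists
  refine ⟨N, w, hw0, ?_⟩
  have h1 : (inner ℂ w (systemOperator hΩ (a N) N w)).re - x * ‖w‖ ^ 2 =
      (inner ℂ w (systemOperator hΩ (a N) N w - (x : ℂ) • w)).re := by
    have h2 : (x : ℂ) * ((‖w‖ : ℂ)) ^ 2 = ((x * ‖w‖ ^ 2 : ℝ) : ℂ) := by push_cast; rfl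
    rw [inner_sub_right, inner_smul_right, inner_self_eq_norm_sq_to_K, Complex.sub_re]
    exact congrArg _ (congrArg Complex.re h2).symm
  rw [h1]
  calc _ ≤ ‖inner ℂ w (systemOperator hΩ (a N) N w - (x : ℂ) • w)‖ := Complex.abs_re_le_norm _
    _ ≤ ‖w‖ * (ε * ‖w‖) := (norm_inner_le_norm _ _).trans (by gcongr)
    _ = _ := by ring

/-- The least eigenvalue is at most the Rayleigh quotient of an approximate eigenvector for `Λ₋`. An
`N` with empty grid contributes nothing: the spectrum on the zero space is empty and has no least
element. -/
theorem isGLB_realSpectrum_systemOperator (hΩ : Bornology.IsBounded Ω)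
    (hopen : IsOpen Ω) (hne : Ω.Nonempty) (a : ℕ+ → EuclideanSpace ℝ (Fin d)) (hd : 2 ≤ d) :
    IsGLB {x : ℝ | ∃ N : ℕ+, IsLeast (realSpectrum (systemOperator hΩ (a N) N)) x}
      (symbolMin d) := by
  refine ⟨?_, fun b hb => le_of_forall_pos_le_add fun ε hε => ?_⟩
  · rintro x ⟨N, hN⟩
    exact (realSpectrum_systemOperator_subset hΩ (a N) N hd hN.1).1
  · obtain ⟨N, w, hw0, hw⟩ := exists_abs_inner_systemOperator_sub_le hΩ hopen hne a hd
      ⟨le_rfl, (symbolMin_lt_symbolMax hd).le⟩ hε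
    have : Nontrivial (EuclideanSpace ℂ (gridIndex hΩ (a N) N × Fin d)) := ⟨w, 0, hw0⟩
    obtain ⟨μ, hμ, hle, -⟩ :=
      exists_isLeast_realSpectrum (isSelfAdjoint_systemOperator hΩ (a N) N hd)
    have h1 : b ≤ μ := hb ⟨N, hμ⟩
    have h2 := hle w
    have h3 : 0 < ‖w‖ ^ 2 := by have := norm_pos_iff.mpr hw0; positivity
    have h4 := (abs_le.mp hw).2
    refine h1.trans (le_of_mul_le_mul_right ?_ h3)
    linarith

theorem isLUB_realSpectrum_systemOperator (hΩ : Bornology.IsBounded Ω)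
    (hopen : IsOpen Ω) (hne : Ω.Nonempty) (a : ℕ+ → EuclideanSpace ℝ (Fin d)) (hd : 2 ≤ d) :
    IsLUB {x : ℝ | ∃ N : ℕ+, IsGreatest (realSpectrum (systemOperator hΩ (a N) N)) x}
      (symbolMax d) := by
  refine ⟨?_, fun b hb => le_of_forall_pos_le_add fun ε hε => ?_⟩
  · rintro x ⟨N, hN⟩
    exact (realSpectrum_systemOperator_subset hΩ (a N) N hd hN.1).2
  · obtain ⟨N, w, hw0, hw⟩ := exists_abs_inner_systemOperator_sub_le hΩ hopen hne a hd
      ⟨(symbolMin_lt_symbolMax hd).le, le_rfl⟩ hε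
    have : Nontrivial (EuclideanSpace ℂ (gridIndex hΩ (a N) N × Fin d)) := ⟨w, 0, hw0⟩
    obtain ⟨μ, hμ, hle, -⟩ :=
      exists_isGreatest_realSpectrum (isSelfAdjoint_systemOperator hΩ (a N) N hd)
    have h1 : μ ≤ b := hb ⟨N, hμ⟩
    have h2 := hle w
    have h3 : 0 < ‖w‖ ^ 2 := by have := norm_pos_iff.mpr hw0; positivity
    have h4 := (abs_le.mp hw).1
    have h5 : symbolMax d ≤ μ + ε := by
      refine le_of_mul_le_mul_right ?_ h3
      linarith
    linarith

theorem isStable_iff_notMem_symbolSegment (hΩ : Bornology.IsBounded Ω)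
    (hopen : IsOpen Ω) (hne : Ω.Nonempty) (a : ℕ+ → EuclideanSpace ℝ (Fin d)) (hd : 2 ≤ d) (z : ℂ) :
    IsStable hΩ a z ↔ z ∉ symbolSegment d := by
  constructor
  · rintro ⟨M, hM⟩ ⟨x, hx, rfl⟩
    -- With error `1/(|M| + 1)` the product with `M` is below `1`, contradicting the resolvent
    -- bound; the absolute value is there because `M` is not assumed nonnegative.
    have hpos : 0 < |M| + 1 := by positivity
    have hev := eventually_exists_approx_eigenvector hd hΩ hopen hne a hx (inv_pos.mpr hpos)
    obtain ⟨N, ⟨hres, hle⟩, w, hw0, hw⟩ := (hM.and hev).exists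
    have hn : 0 < ‖w‖ := norm_pos_iff.mpr hw0
    have h1 : resolvent (systemOperator hΩ (a N) N) (x : ℂ)
        ((x : ℂ) • w - systemOperator hΩ (a N) N w) = w :=
      congrArg (fun B => B w) (Ring.inverse_mul_cancel _ hres)
    have h2 : ‖w‖ ≤ M * ((|M| + 1)⁻¹ * ‖w‖) := by
      rw [norm_sub_rev] at hw
      calc ‖w‖ = ‖resolvent (systemOperator hΩ (a N) N) (x : ℂ)
            ((x : ℂ) • w - systemOperator hΩ (a N) N w)‖ := by rw [h1]
        _ ≤ _ := ContinuousLinearMap.le_of_opNorm_le_of_le _ hle hw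
    have h3 : M * ((|M| + 1)⁻¹ * ‖w‖) < ‖w‖ := by
      rw [← mul_assoc, ← div_eq_mul_inv]
      refine mul_lt_of_lt_one_left hn ?_
      rw [div_lt_one hpos]
      linarith [le_abs_self M]
    linarith
  · exact fun hz => ⟨_, Eventually.of_forall fun N => resolvent_systemOperator hΩ (a N) N hd hz⟩

end Scheme

end QuasiStaticMaxwell

end

open QuasiStaticMaxwell in
theorem propositionP (d : ℕ) (hd : 2 ≤ d) :
    ∃ (F : (Fin d → ℝ) → Matrix (Fin d) (Fin d) ℂ) (T : LatticeL2 d →L[ℂ] LatticeL2 d),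
      IsSymbol d F ∧ IsToeplitzOperator d T ∧
      ∃ Λm Λp : ℝ, Λm ≤ -(1 / (d : ℝ)) ∧ 1 - 1 / (d : ℝ) ≤ Λp ∧
        -- (i)
        (∀ τ ∈ periodCube d, τ ≠ 0 →
          (∃ S : Matrix (Fin d) (Fin d) ℝ, S.IsSymm ∧ F τ = S.map Complex.ofReal) ∧
          spectrum ℂ (F τ) ⊆ Complex.ofReal '' Set.Icc Λm Λp) ∧
        IsGLB {x : ℝ | ∃ τ ∈ periodCube d, τ ≠ 0 ∧ IsLeast (realSpectrum (F τ)) x} Λm ∧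
        IsLUB {x : ℝ | ∃ τ ∈ periodCube d, τ ≠ 0 ∧ IsGreatest (realSpectrum (F τ)) x} Λp ∧
        -- (ii), first part
        closure (numericalRange T) = Complex.ofReal '' Set.Icc Λm Λp ∧
        ∀ (Ω : Set (EuclideanSpace ℝ (Fin d))) (hΩ : Bornology.IsBounded Ω), IsOpen Ω →
          Ω.Nonempty → ∀ a : ℕ+ → EuclideanSpace ℝ (Fin d),
          -- (ii), second part
          (∀ N : ℕ+, numericalRange (systemOperator hΩ (a N) N) ⊆ numericalRange T) ∧
          IsGLB {x : ℝ | ∃ N : ℕ+, IsLeast (realSpectrum (systemOperator hΩ (a N) N)) x} Λm ∧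
          IsLUB {x : ℝ | ∃ N : ℕ+, IsGreatest (realSpectrum (systemOperator hΩ (a N) N)) x} Λp ∧
          -- (iii)
          ∀ lam : ℂ,
            (IsStable hΩ a lam ↔ lam ∉ Complex.ofReal '' Set.Icc Λm Λp) ∧
            (lam ∉ Complex.ofReal '' Set.Icc Λm Λp →
              ∀ N : ℕ+, lam ∈ resolventSet ℂ (systemOperator hΩ (a N) N) ∧
                ‖resolvent (systemOperator hΩ (a N) N) lam‖ ≤
                  (Metric.infDist lam (Complex.ofReal '' Set.Icc Λm Λp))⁻¹) := by
  refine ⟨fun τ => (realSymbol τ).map Complex.ofReal, toeplitzOperator hd, isSymbol_realSymbol hd,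
    isToeplitzOperator_toeplitzOperator hd, symbolMin d, symbolMax d, symbolMin_le hd,
    le_symbolMax hd, fun τ hτ h0 => ⟨⟨realSymbol τ, realSymbol_isSymm τ, rfl⟩, ?_⟩, ?_, ?_,
    closure_numericalRange_toeplitzOperator hd, fun Ω hΩ hopen hne a =>
    ⟨fun N => numericalRange_systemOperator_subset hΩ (a N) N hd,
      isGLB_realSpectrum_systemOperator hΩ hopen hne a hd,
      isLUB_realSpectrum_systemOperator hΩ hopen hne a hd, fun z =>
      ⟨isStable_iff_notMem_symbolSegment hΩ hopen hne a hd z,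
        fun hz N => resolvent_systemOperator hΩ (a N) N hd hz⟩⟩⟩
  · rw [← spectrum_symbolOperator]
    exact spectrum_symbolOperator_subset hd hτ h0
  · simpa only [realSpectrum_symbolOperator] using isGLB_symbolMin hd
  · simpa only [realSpectrum_symbolOperator] using isLUB_symbolMax hd
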